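/- \textbf{Setting.} A graphon over a probability space $(\Omega,\pi)$ is a measurable, symmetric, non-negative, integrable function $W\colon\Omega\times\Omega\to\mathbb R$; it is normalized if $\|W\|_1=1$. For functions $U$ over $(\Omega',\pi')$ and $W$ over $(\Omega,\pi)$ let \[ \delta_1(U,W)=\inf_\nu\int|U(x',y')-W(x,y)|\,d\nu(x',x)\,d\nu(y',y),\qquad \delta_\square(U,W)=\inf_\nu\sup_{S,T}\Bigl|\int_{S\times T}\bigl(U(x',y')-W(x,y)\bigr)\,d\nu(x',x)\,d\nu(y',y)\Bigr|, \] with $\nu$ over the couplings of $\pi'$ and $\pi$, and $S,T$ over the measurable subsets of $\Omega'\times\Omega$. A block model $(\mathbf p,B)$ is a probability vector $\mathbf p$ on $[k]$ with a symmetric non-negative $k\times k$ matrix $B$, viewed as the graphon $(i,j)\mapsto B_{ij}$ over $([k],\mathbf p)$. Let $\varepsilon^{(1)}_{\ge\kappa}(W)=\inf\delta_1(W,W')$ over the block models $W'=(\mathbf p,B)$ with $\min_ip_i\ge\kappa$, and $\mathrm{tail}^{(1)}_\rho(W)=\|W-\min\{W,\rho^{-1}\}\|_1$. A $W$-random graph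 $G$ on $[n]$ at target density $\rho>0$ is obtained by choosing $x_1,\dots,x_n$ i.i.d.\ from $\pi$ and, conditionally on these, joining the pairs $i<j$ independently with probabilities $\min\{1,\rho W(x_i,x_j)\}$. Let $A$ be its adjacency matrix and, for an $n\times n$ matrix $H$, let $\|H\|_\square=\max_{S,T\subseteq[n]}n^{-2}|\sum_{(i,j)\in S\times T}H_{ij}|$. Given $\kappa\in(0,1]$ with $\kappa n\ge1$, let $k=\lceil n/\lfloor\kappa n\rfloor\rceil$. For $\pi\colon[n]\to[k]$ let $A/\pi$ be the $k\times k$ matrix of averages of $A$ over the blocks $\pi^{-1}(i)\times\pi^{-1}(j)$ ($0$ if the block is empty), and let $A_\pi$ be the $n\times n$ matrix with entries $(A/\pi)_{\pi(u)\pi(v)}$. The least cut norm estimator is $\widehat W=(\hat{\mathbf p},A/\hat\pi)$ with $\hat p_i=|\hat\pi^{-1}(i)|/n$, where $\hat\pi$ is any minimizer of $\|A-A_\pi\|_\square$ over all $\pi\colon[n]\to[k]$ all of whose non-empty classes have size at least $\lfloor\kappa n\rfloor$. \textbf{Theorem.} (i) For each $\varepsilon>0$ there is a constant $M=M(\varepsilon)$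 such that for every normalized graphon $W$ over any probability space, all $n\ge2$, $\rho>0$ and $\kappa\in[\frac{\log n}n,1]$ with $\kappa n\ge1$, with probability at least $1-\varepsilon$, \[ \delta_\square\Bigl(\frac1\rho\widehat W,W\Bigr)\le M\Bigl(\varepsilon^{(1)}_{\ge\kappa}(W)+\sqrt{\frac1{\rho n}}+\sqrt{\frac{\log n}{\kappa n}}+\mathrm{tail}^{(1)}_\rho(W)\Bigr). \] In (ii) and (iii), $W$ is a normalized graphon over any probability space, $\rho_n>0$, $\rho_n\to0$, $n\rho_n\to\infty$; $x_1,x_2,\dots$ are i.i.d.\ from $\pi$; for each $n$, $G_n$ is a $W$-random graph on $[n]$ at target density $\rho_n$ with positions $x_1,\dots,x_n$ (the joint law of the $G_n$ for different $n$ is otherwise arbitrary); and $\widehat W_n$ is a least cut norm estimator computed from $G_n$ with parameter $\kappa$, respectively $\kappa_n$, for all $n$ for which $\kappa n\ge1$, respectively $\kappa_nn\ge1$. (ii) If $\kappa\in(0,1]$ is fixed, then almost surely $\limsup_{n\to\infty}\delta_\square(\frac1{\rho_n}\widehat W_n,W)\le2\varepsilon^{(1)}_{\ge\kappa}(W)$.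 (iii) If $\kappa_n\in(0,1]$, $\kappa_n\to0$ and $\frac{\log n}{n\kappa_n}\to0$, then almost surely $\delta_\square(\frac1{\rho_n}\widehat W_n,W)\to0$. -/

import Mathlib

open Filter Topology MeasureTheory ProbabilityTheory

universe u v

noncomputable section

/-- A graphon over a probability space `(Ω, π)`: a measurable, symmetric, non-negative, integrable
function on `Ω × Ω`. -/
structure Graphon (Ω : Type u) [MeasurableSpace Ω] (π : Measure Ω) where
  toFun : Ω → Ω → ℝ
  measurable' : Measurable fun z : Ω × Ω => toFun z.1 z.2
  symm' : ∀ x y, toFun x y = toFun y x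
  nonneg' : ∀ x y, 0 ≤ toFun x y
  integrable' : Integrable (fun z : Ω × Ω => toFun z.1 z.2) (π.prod π)

/-- A graphon is normalized if its `L¹` norm is one. -/
def Graphon.Normalized {Ω : Type u} [MeasurableSpace Ω] {π : Measure Ω} (W : Graphon Ω π) : Prop :=
  ∫ z : Ω × Ω, |W.toFun z.1 z.2| ∂(π.prod π) = 1

/-- `tail_ρ^{(1)}(W) = ‖W - min {W, ρ⁻¹}‖₁`. -/
def Graphon.tail {Ω : Type u} [MeasurableSpace Ω] {π : Measure Ω} (W : Graphon Ω π) (ρ : ℝ) : ℝ :=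
  ∫ z : Ω × Ω, |W.toFun z.1 z.2 - min (W.toFun z.1 z.2) ρ⁻¹| ∂(π.prod π)

/-- `ν` is a coupling of `π` and `π'`. -/
def IsCoupling {Ω : Type u} {Ω' : Type v} [MeasurableSpace Ω] [MeasurableSpace Ω']
    (π : Measure Ω) (π' : Measure Ω') (ν : Measure (Ω × Ω')) : Prop :=
  ν.map Prod.fst = π ∧ ν.map Prod.snd = π'

/-- The cut distance
`δ_□(U, W) = inf_ν sup_{S,T} |∫_{S × T} (U(x,y) - W(x',y')) dν(x,x') dν(y,y')|`,
with `ν` ranging over the couplings of `π` and `π'`, and `S`, `T` over the measurable subsets of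
`Ω × Ω'`. -/
def cutDist {Ω : Type u} {Ω' : Type v} [MeasurableSpace Ω] [MeasurableSpace Ω']
    (π : Measure Ω) (π' : Measure Ω') (U : Ω → Ω → ℝ) (W : Ω' → Ω' → ℝ) : ℝ :=
  ⨅ ν : {ν : Measure (Ω × Ω') // IsCoupling π π' ν},
    ⨆ ST : {S : Set (Ω × Ω') // MeasurableSet S} × {T : Set (Ω × Ω') // MeasurableSet T},
      |∫ z in (ST.1 : Set (Ω × Ω')) ×ˢ (ST.2 : Set (Ω × Ω')),
        (U z.1.1 z.2.1 - W z.1.2 z.2.2) ∂((ν : Measure (Ω × Ω')).prod (ν : Measure (Ω × Ω')))|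

/-- The distance `δ₁(U, W) = inf_ν ∫ |U(x,y) - W(x',y')| dν(x,x') dν(y,y')`, with `ν` ranging over
the couplings of `π` and `π'`. -/
def l1Dist {Ω : Type u} {Ω' : Type v} [MeasurableSpace Ω] [MeasurableSpace Ω']
    (π : Measure Ω) (π' : Measure Ω') (U : Ω → Ω → ℝ) (W : Ω' → Ω' → ℝ) : ℝ :=
  ⨅ ν : {ν : Measure (Ω × Ω') // IsCoupling π π' ν},
    ∫ z : (Ω × Ω') × (Ω × Ω'),
      |U z.1.1 z.2.1 - W z.1.2 z.2.2| ∂((ν : Measure (Ω × Ω')).prod (ν : Measure (Ω × Ω')))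

/-- A block model `(p, B)` on `k` blocks: `p` is a probability vector (zero entries are allowed)
and `B` is a symmetric matrix with non-negative entries. -/
structure BlockModel where
  k : ℕ
  p : Fin k → ℝ
  B : Matrix (Fin k) (Fin k) ℝ
  p_nonneg : ∀ i, 0 ≤ p i
  p_sum : ∑ i, p i = 1
  B_symm : B.IsSymm
  B_nonneg : ∀ i j, 0 ≤ B i j

/-- The probability measure on the set of blocks that is given by `p`. -/
def BlockModel.measure (V : BlockModel) : Measure (Fin V.k) :=
  ∑ i, ENNReal.ofReal (V.p i) • Measure.dirac i

/-- The oracle error `ε_{≥κ}^{(1)}(W)`: the infimum of `δ₁(W, W')` over the block models `W'` all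
of whose blocks have size at least `κ`. -/
def Graphon.oracleError {Ω : Type u} [MeasurableSpace Ω] {π : Measure Ω} (W : Graphon Ω π)
    (κ : ℝ) : ℝ :=
  ⨅ V : {V : BlockModel // ∀ i, κ ≤ V.p i}, l1Dist π V.1.measure W.toFun V.1.B

/-- The cut norm `max_{S,T ⊆ [n]} n⁻² |∑_{(i,j) ∈ S × T} A_{ij}|` of an `n × n` matrix. -/
def matrixCutNorm {n : ℕ} (A : Matrix (Fin n) (Fin n) ℝ) : ℝ :=
  ⨆ ST : Finset (Fin n) × Finset (Fin n), |∑ i ∈ ST.1, ∑ j ∈ ST.2, A i j| / (n : ℝ) ^ 2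

/-- The class `V_i = π⁻¹({i})` of the partition `π : [n] → [k]`. -/
def partClass {n k : ℕ} (π : Fin n → Fin k) (i : Fin k) : Finset (Fin n) :=
  Finset.univ.filter fun u => π u = i

/-- The `k × k` matrix `A / π` of block averages; an entry is `0` if one of the two classes is
empty. -/
def blockAverage {n k : ℕ} (A : Matrix (Fin n) (Fin n) ℝ) (π : Fin n → Fin k) :
    Matrix (Fin k) (Fin k) ℝ :=
  fun i j => (∑ u ∈ partClass π i, ∑ v ∈ partClass π j, A u v) /
    (((partClass π i).card : ℝ) * ((partClass π j).card : ℝ))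

/-- The `n × n` matrix `A_π = (A / π)^π`. -/
def blockAveraged {n k : ℕ} (A : Matrix (Fin n) (Fin n) ℝ) (π : Fin n → Fin k) :
    Matrix (Fin n) (Fin n) ℝ :=
  fun u v => blockAverage A π (π u) (π v)

/-- The adjacency matrix `A(G)`. -/
def adjacency {n : ℕ} (G : SimpleGraph (Fin n)) : Matrix (Fin n) (Fin n) ℝ := by
  classical exact G.adjMatrix ℝ

/-- Every non-empty class of the partition `π` has size at least `⌊κ n⌋`. -/
def AdmissiblePartition {n k : ℕ} (κ : ℝ) (π : Fin n → Fin k) : Prop :=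
  ∀ i, (partClass π i).Nonempty → ⌊κ * (n : ℝ)⌋₊ ≤ (partClass π i).card

/-- The number `⌈n / ⌊κ n⌋⌉` of classes that is used by the algorithm. -/
def numClasses (n : ℕ) (κ : ℝ) : ℕ := ⌈(n : ℝ) / (⌊κ * (n : ℝ)⌋₊ : ℝ)⌉₊

/-- `V = (p̂, B̂)` is an output of the least cut norm algorithm for the graph `G` on `n` vertices
with parameter `κ`: for some minimizer `π` of `‖A(G) - A(G)_π‖_□` over the admissible partitions of
`[n]` into `⌈n / ⌊κ n⌋⌉` classes, `p̂` is the vector of relative class sizes and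
`B̂ = A(G) / π`. -/
def IsLeastCutNormOutput {n : ℕ} (κ : ℝ) (G : SimpleGraph (Fin n)) (V : BlockModel) : Prop :=
  V.k = numClasses n κ ∧
  ∃ π : Fin n → Fin V.k,
    AdmissiblePartition κ π ∧
    (∀ π' : Fin n → Fin V.k, AdmissiblePartition κ π' →
      matrixCutNorm (adjacency G - blockAveraged (adjacency G) π) ≤
        matrixCutNorm (adjacency G - blockAveraged (adjacency G) π')) ∧
    (∀ i, V.p i = ((partClass π i).card : ℝ) / (n : ℝ)) ∧
    V.B = blockAverage (adjacency G) π

/-- The error `δ_□(ρ⁻¹ V, W)`. -/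
def estimationError {Ω : Type u} [MeasurableSpace Ω] {π : Measure Ω} (W : Graphon Ω π) (ρ : ℝ)
    (V : BlockModel) : ℝ :=
  cutDist V.measure π (fun i j => 1 / ρ * V.B i j) W.toFun

/-- The random variables `x i` on `(Θ, P)` are i.i.d. with distribution `π`. -/
def IsIIDSample {Ω : Type u} {Θ : Type v} [MeasurableSpace Ω] [MeasurableSpace Θ] {ι : Type}
    (π : Measure Ω) (P : Measure Θ) (x : ι → Θ → Ω) : Prop :=
  (∀ i, Measurable (x i)) ∧ iIndepFun x P ∧ ∀ i, P.map (x i) = π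

/-- The matrix with entries `min {1, ρ W(x_i, x_j)}` off the diagonal, and `0` on it. -/
def edgeProb {Ω : Type u} [MeasurableSpace Ω] {π : Measure Ω} (W : Graphon Ω π) (ρ : ℝ) {n : ℕ}
    (x : Fin n → Ω) : Matrix (Fin n) (Fin n) ℝ :=
  fun i j => if i = j then 0 else min 1 (ρ * W.toFun (x i) (x j))

open Classical in
/-- The probability of the graph `g` when each pair `i < j` is an edge with probability `Q i j`,
independently of the others. -/
def graphProb {n : ℕ} (Q : Matrix (Fin n) (Fin n) ℝ) (g : SimpleGraph (Fin n)) : ℝ :=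
  ∏ i, ∏ j ∈ Finset.Ioi i, if g.Adj i j then Q i j else 1 - Q i j

/-- `G` is a `W`-random graph at target density `ρ` with vertex positions `x 0, …, x (n - 1)`:
conditioned on the positions, the pairs `i < j` are edges independently, with probabilities
`min {1, ρ W(x_i, x_j)}`. Conditional probabilities are expressed by their defining property
`P (x ∈ S, G = g) = E [1_{x ∈ S} P (G = g | x)]`. -/
def IsWRandomGraph {Ω : Type u} {Θ : Type v} [MeasurableSpace Ω] [MeasurableSpace Θ]
    {π : Measure Ω} (W : Graphon Ω π) (ρ : ℝ) (P : Measure Θ) {n : ℕ} (x : Fin n → Θ → Ω)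
    (G : Θ → SimpleGraph (Fin n)) : Prop :=
  ∀ g : SimpleGraph (Fin n), MeasurableSet {θ | G θ = g} ∧
    ∀ S : Set (Fin n → Ω), MeasurableSet S →
      P {θ | (fun i => x i θ) ∈ S ∧ G θ = g} =
        ∫⁻ θ in {θ | (fun i => x i θ) ∈ S},
          ENNReal.ofReal (graphProb (edgeProb W ρ fun i => x i θ) g) ∂P

end

noncomputable section

/-! The core is a deterministic inequality. Let `A` be the adjacency matrix and `Q` the matrix of
edge probabilities given the positions. Block averaging has the form `A ↦ P A P` with `P` symmetric
and doubly stochastic, so it contracts both the cut norm and the `L¹` norm. If a block model `V₁`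
has blocks of size at least `κ`, spreading it over a balanced partition `z₁` of the vertices gives
an admissible competitor of the minimizer `σ`. The triangle inequality then bounds `‖Q - A_σ‖_□` by
three times `‖A - Q‖_□` plus twice the `L¹` distance from `Q` to the spread-out model
(`matrixCutNorm_sub_blockAveraged_le`).

To get from matrices to `W`, the vertices are coupled with the points of `Ω` through the blocks of a
second model `V₂`: a maximal coupling of vertices with blocks is glued to a coupling of blocks with
`π` (`estimationError_le`). The model `V₂` only needs blocks of positive size. The combination is
`estimationError_le_of_isLeastCutNormOutput`, and two random quantities remain to be controlled.

The first is `‖A - Q‖_□ / ρ`. A union bound over the `4 ^ n` pairs of vertex sets, with a Bernoulli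
moment generating function whose exponent is proportional to the edge probability, gives the order
`√(1 / (ρ n))`; for `ρ n ≤ 1` a first moment bound is enough. The second is the `L¹` fit of a
balanced partition to `Q / ρ`. Block labels are drawn jointly with the positions from a coupling of
`π` with the model; the fit is then an average over pairs of vertices, plus the cost of rebalancing
the label classes (`blockFitError`). Existence of a good balanced partition depends on the positions
alone, so the labels can live on an auxiliary product space.

In (i), `V₁ = V₂` is nearly optimal and the fit is controlled by its expectation and Markov's
inequality; fluctuations of the class sizes contribute `√(1 / (κ n))`. In (ii) and (iii), the
expectation is replaced by the upper half of a strong law for `U`-statistics with integrable kernel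
(`IsIIDSample.ae_eventually_pairSum_le_integral`). Truncation at dyadic scales, Chebyshev and
Borel–Cantelli give a crude almost sure bound, up to a constant factor; approximation by step
kernels reduces the sharp bound to the ordinary strong law, the crude one being applied to a
remainder of small mean. The cut norm is handled by summable exponential bounds, so the joint law of
the graphs is irrelevant.

The factor 2 in (ii) is the coefficient of the error of `V₁`; the model `V₂` can be chosen
arbitrarily close to `W` (`Graphon.exists_blockModel_approx`). In (iii) a fixed model with positive
blocks is eventually allowed as `V₁` as well, and the error tends to zero. -/

/-- The normalized `L¹` norm of a matrix. -/
def matrixL1 {n : ℕ} (A : Matrix (Fin n) (Fin n) ℝ) : ℝ :=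
  (∑ i, ∑ j, |A i j|) / (n : ℝ) ^ 2

/-! ### Matrix cut norm, and its formulation with fractional sets. -/

section CutNorm

variable {n : ℕ}

lemma matrixL1_nonneg (A : Matrix (Fin n) (Fin n) ℝ) : 0 ≤ matrixL1 A := by
  unfold matrixL1; positivity

lemma matrixL1_add_le (A B : Matrix (Fin n) (Fin n) ℝ) :
    matrixL1 (A + B) ≤ matrixL1 A + matrixL1 B := by
  unfold matrixL1
  rw [← add_div, ← Finset.sum_add_distrib]
  gcongr with i
  rw [← Finset.sum_add_distrib]
  gcongr with j
  exact abs_add_le _ _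

lemma matrixL1_sub_comm (A B : Matrix (Fin n) (Fin n) ℝ) :
    matrixL1 (A - B) = matrixL1 (B - A) := by
  simp only [matrixL1, Matrix.sub_apply, abs_sub_comm]

lemma matrixL1_smul (c : ℝ) (A : Matrix (Fin n) (Fin n) ℝ) :
    matrixL1 (c • A) = |c| * matrixL1 A := by
  simp only [matrixL1, Matrix.smul_apply, smul_eq_mul, abs_mul, ← Finset.mul_sum, mul_div_assoc]

lemma abs_sum_div_le_matrixCutNorm (A : Matrix (Fin n) (Fin n) ℝ) (S T : Finset (Fin n)) :
    |∑ i ∈ S, ∑ j ∈ T, A i j| / (n : ℝ) ^ 2 ≤ matrixCutNorm A :=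
  le_ciSup (f := fun ST : Finset (Fin n) × Finset (Fin n) =>
    |∑ i ∈ ST.1, ∑ j ∈ ST.2, A i j| / (n : ℝ) ^ 2) (Set.finite_range _).bddAbove (S, T)

lemma matrixCutNorm_le {A : Matrix (Fin n) (Fin n) ℝ} {c : ℝ}
    (h : ∀ S T : Finset (Fin n), |∑ i ∈ S, ∑ j ∈ T, A i j| / (n : ℝ) ^ 2 ≤ c) :
    matrixCutNorm A ≤ c :=
  ciSup_le fun ST => h ST.1 ST.2

lemma exists_matrixCutNorm_eq (A : Matrix (Fin n) (Fin n) ℝ) :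
    ∃ S T : Finset (Fin n), |∑ i ∈ S, ∑ j ∈ T, A i j| / (n : ℝ) ^ 2 = matrixCutNorm A := by
  obtain ⟨ST, h⟩ := exists_eq_ciSup_of_finite (f := fun ST : Finset (Fin n) × Finset (Fin n) =>
    |∑ i ∈ ST.1, ∑ j ∈ ST.2, A i j| / (n : ℝ) ^ 2)
  exact ⟨ST.1, ST.2, h⟩

lemma matrixCutNorm_add_le (A B : Matrix (Fin n) (Fin n) ℝ) :
    matrixCutNorm (A + B) ≤ matrixCutNorm A + matrixCutNorm B := by
  refine matrixCutNorm_le fun S T => ?_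
  refine le_trans ?_ (add_le_add (abs_sum_div_le_matrixCutNorm A S T)
    (abs_sum_div_le_matrixCutNorm B S T))
  rw [← add_div]
  gcongr
  simp only [Matrix.add_apply, Finset.sum_add_distrib]
  exact abs_add_le _ _

lemma matrixCutNorm_sub_comm (A B : Matrix (Fin n) (Fin n) ℝ) :
    matrixCutNorm (A - B) = matrixCutNorm (B - A) := by
  simp only [matrixCutNorm, Matrix.sub_apply, Finset.sum_sub_distrib, abs_sub_comm]

lemma matrixCutNorm_sub_le (A B C : Matrix (Fin n) (Fin n) ℝ) :
    matrixCutNorm (A - C) ≤ matrixCutNorm (A - B) + matrixCutNorm (B - C) := by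
  simpa using matrixCutNorm_add_le (A - B) (B - C)

lemma matrixCutNorm_le_matrixL1 (A : Matrix (Fin n) (Fin n) ℝ) :
    matrixCutNorm A ≤ matrixL1 A := by
  refine matrixCutNorm_le fun S T => ?_
  unfold matrixL1
  gcongr
  calc |∑ i ∈ S, ∑ j ∈ T, A i j| ≤ ∑ i ∈ S, |∑ j ∈ T, A i j| := Finset.abs_sum_le_sum_abs _ _
    _ ≤ ∑ i ∈ S, ∑ j ∈ T, |A i j| := by
        gcongr with i; exact Finset.abs_sum_le_sum_abs _ _
    _ ≤ ∑ i ∈ S, ∑ j, |A i j| := by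
        gcongr with i
        exact T.subset_univ
    _ ≤ ∑ i, ∑ j, |A i j| :=
        Finset.sum_le_univ_sum_of_nonneg fun i => Finset.sum_nonneg fun j _ => abs_nonneg _

/-- A linear form on the unit cube is at most its value at some vertex. -/
lemma exists_sum_mul_le_sum {ι : Type*} [Fintype ι] (a r : ι → ℝ) (h0 : ∀ i, 0 ≤ a i)
    (h1 : ∀ i, a i ≤ 1) : ∃ S : Finset ι, ∑ i, a i * r i ≤ ∑ i ∈ S, r i := by
  classical
  refine ⟨Finset.univ.filter fun i => 0 ≤ r i, ?_⟩
  rw [Finset.sum_filter]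
  refine Finset.sum_le_sum fun i _ => ?_
  split_ifs with h
  · nlinarith [h1 i]
  · nlinarith [h0 i]

/-- The form is linear in `a` for fixed `b` and conversely, so the weights can be rounded to
indicator functions one after the other without decreasing the value. -/
lemma sum_mul_mul_le_matrixCutNorm (A : Matrix (Fin n) (Fin n) ℝ) (a b : Fin n → ℝ)
    (ha0 : ∀ i, 0 ≤ a i) (ha1 : ∀ i, a i ≤ 1) (hb0 : ∀ i, 0 ≤ b i) (hb1 : ∀ i, b i ≤ 1) :
    (∑ i, ∑ j, a i * b j * A i j) / (n : ℝ) ^ 2 ≤ matrixCutNorm A := by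
  obtain ⟨S, hS⟩ := exists_sum_mul_le_sum a (fun i => ∑ j, b j * A i j) ha0 ha1
  obtain ⟨T, hT⟩ := exists_sum_mul_le_sum b (fun j => ∑ i ∈ S, A i j) hb0 hb1
  refine le_trans ?_ (abs_sum_div_le_matrixCutNorm A S T)
  gcongr
  refine le_trans ?_ (le_abs_self _)
  calc ∑ i, ∑ j, a i * b j * A i j = ∑ i, a i * ∑ j, b j * A i j := by
        simp only [Finset.mul_sum, mul_assoc]
    _ ≤ ∑ i ∈ S, ∑ j, b j * A i j := hS
    _ = ∑ j, b j * ∑ i ∈ S, A i j := by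
        rw [Finset.sum_comm]; simp only [Finset.mul_sum]
    _ ≤ ∑ j ∈ T, ∑ i ∈ S, A i j := hT
    _ = _ := Finset.sum_comm

lemma abs_sum_mul_mul_le_matrixCutNorm (A : Matrix (Fin n) (Fin n) ℝ) (a b : Fin n → ℝ)
    (ha0 : ∀ i, 0 ≤ a i) (ha1 : ∀ i, a i ≤ 1) (hb0 : ∀ i, 0 ≤ b i) (hb1 : ∀ i, b i ≤ 1) :
    |∑ i, ∑ j, a i * b j * A i j| / (n : ℝ) ^ 2 ≤ matrixCutNorm A := by
  have h1 := sum_mul_mul_le_matrixCutNorm A a b ha0 ha1 hb0 hb1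
  have h2 := sum_mul_mul_le_matrixCutNorm (0 - A) a b ha0 ha1 hb0 hb1
  rw [matrixCutNorm_sub_comm, sub_zero] at h2
  simp only [zero_sub, Matrix.neg_apply, mul_neg, Finset.sum_neg_distrib] at h2
  rcases abs_cases (∑ i, ∑ j, a i * b j * A i j) with h | h <;> rw [h.1] <;> assumption

end CutNorm

/-! ### Block averaging as a contraction, and the oracle inequality. -/

section Averaging

variable {n k : ℕ}

/-- The averaging matrix of a partition. -/
def classWeight (π : Fin n → Fin k) (u v : Fin n) : ℝ :=
  if π v = π u then ((partClass π (π u)).card : ℝ)⁻¹ else 0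

lemma mem_partClass {π : Fin n → Fin k} {i : Fin k} {u : Fin n} :
    u ∈ partClass π i ↔ π u = i := by simp [partClass]

lemma card_partClass_pos (π : Fin n → Fin k) (u : Fin n) :
    0 < ((partClass π (π u)).card : ℝ) := by
  exact_mod_cast Finset.card_pos.2 ⟨u, mem_partClass.2 rfl⟩

lemma sum_card_partClass (π : Fin n → Fin k) : ∑ i, ((partClass π i).card : ℝ) = n := by
  have := Finset.card_eq_sum_card_fiberwise (f := π) (s := Finset.univ) (t := Finset.univ)
    (fun _ _ => Finset.mem_coe.2 (Finset.mem_univ _))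
  simp only [Finset.card_univ, Fintype.card_fin] at this
  rw [← Nat.cast_sum]
  exact_mod_cast this.symm

lemma classWeight_nonneg (π : Fin n → Fin k) (u v : Fin n) : 0 ≤ classWeight π u v := by
  unfold classWeight; split_ifs <;> positivity

lemma classWeight_comm (π : Fin n → Fin k) (u v : Fin n) :
    classWeight π u v = classWeight π v u := by
  unfold classWeight
  by_cases h : π v = π u
  · rw [if_pos h, if_pos h.symm, h]
  · rw [if_neg h, if_neg (Ne.symm h)]

lemma sum_classWeight (π : Fin n → Fin k) (u : Fin n) : ∑ v, classWeight π u v = 1 := by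
  unfold classWeight
  rw [← Finset.sum_filter, Finset.sum_const, nsmul_eq_mul]
  exact mul_inv_cancel₀ (card_partClass_pos π u).ne'

lemma sum_classWeight' (π : Fin n → Fin k) (v : Fin n) : ∑ u, classWeight π u v = 1 := by
  simp only [classWeight_comm π _ v, sum_classWeight]

/-- This is the form `A_π = P A P` with `P` symmetric and doubly stochastic, from which both
contraction properties follow. -/
lemma blockAveraged_apply (A : Matrix (Fin n) (Fin n) ℝ) (π : Fin n → Fin k) (u v : Fin n) :
    blockAveraged A π u v = ∑ u', ∑ v', classWeight π u u' * classWeight π v v' * A u' v' := by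
  simp only [blockAveraged, blockAverage, classWeight, partClass]
  rw [Finset.sum_filter, Finset.sum_div]
  refine Finset.sum_congr rfl fun u' _ => ?_
  split_ifs with h
  · rw [Finset.sum_filter, Finset.sum_div]
    refine Finset.sum_congr rfl fun v' _ => ?_
    split_ifs
    · rw [div_eq_mul_inv, mul_inv]; ring
    · simp
  · simp

lemma blockAveraged_sub (A B : Matrix (Fin n) (Fin n) ℝ) (π : Fin n → Fin k) :
    blockAveraged (A - B) π = blockAveraged A π - blockAveraged B π := by
  ext u v
  simp only [Matrix.sub_apply, blockAveraged_apply, mul_sub, Finset.sum_sub_distrib]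

/-- Moving the averaging operators onto the indicators of `S` and `T` turns these into weights in
`[0, 1]`, because the columns of `classWeight` sum to one. The fractional form of the cut norm
applies. -/
lemma matrixCutNorm_blockAveraged_le (A : Matrix (Fin n) (Fin n) ℝ) (π : Fin n → Fin k) :
    matrixCutNorm (blockAveraged A π) ≤ matrixCutNorm A := by
  refine matrixCutNorm_le fun S T => ?_
  have key : ∑ u ∈ S, ∑ v ∈ T, blockAveraged A π u v =
      ∑ u', ∑ v', (∑ u ∈ S, classWeight π u u') * (∑ v ∈ T, classWeight π v v') * A u' v' := by
    simp only [blockAveraged_apply]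
    calc _ = ∑ u ∈ S, ∑ u', ∑ v ∈ T, ∑ v', classWeight π u u' * classWeight π v v' * A u' v' := by
          refine Finset.sum_congr rfl fun u _ => Finset.sum_comm
      _ = ∑ u', ∑ u ∈ S, ∑ v', ∑ v ∈ T, classWeight π u u' * classWeight π v v' * A u' v' := by
          rw [Finset.sum_comm]
          refine Finset.sum_congr rfl fun u' _ => Finset.sum_congr rfl fun u _ => Finset.sum_comm
      _ = _ := by
          refine Finset.sum_congr rfl fun u' _ => ?_
          rw [Finset.sum_comm]
          refine Finset.sum_congr rfl fun v' _ => ?_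
          rw [Finset.sum_mul_sum, Finset.sum_mul]
          refine Finset.sum_congr rfl fun u _ => ?_
          rw [Finset.sum_mul]
  have h1 : ∀ (S : Finset (Fin n)) v, ∑ u ∈ S, classWeight π u v ≤ 1 := fun S v =>
    (Finset.sum_le_univ_sum_of_nonneg fun u => classWeight_nonneg π u v).trans
      (sum_classWeight' π v).le
  rw [key]
  exact abs_sum_mul_mul_le_matrixCutNorm A _ _
    (fun v => Finset.sum_nonneg fun u _ => classWeight_nonneg π u v) (h1 S)
    (fun v => Finset.sum_nonneg fun u _ => classWeight_nonneg π u v) (h1 T)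

lemma matrixL1_blockAveraged_le (A : Matrix (Fin n) (Fin n) ℝ) (π : Fin n → Fin k) :
    matrixL1 (blockAveraged A π) ≤ matrixL1 A := by
  unfold matrixL1
  gcongr ?_ / _
  calc ∑ u, ∑ v, |blockAveraged A π u v|
      ≤ ∑ u, ∑ v, ∑ u', ∑ v', classWeight π u u' * classWeight π v v' * |A u' v'| := by
        gcongr with u _ v _
        rw [blockAveraged_apply]
        refine (Finset.abs_sum_le_sum_abs _ _).trans ?_
        gcongr with u'
        refine (Finset.abs_sum_le_sum_abs _ _).trans ?_
        gcongr with v'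
        rw [abs_mul, abs_of_nonneg (mul_nonneg (classWeight_nonneg π u u')
          (classWeight_nonneg π v v'))]
    _ = ∑ u, ∑ u', ∑ v, ∑ v', classWeight π u u' * classWeight π v v' * |A u' v'| :=
        Finset.sum_congr rfl fun u _ => Finset.sum_comm
    _ = ∑ u', ∑ u, ∑ v', ∑ v, classWeight π u u' * classWeight π v v' * |A u' v'| := by
        rw [Finset.sum_comm]
        refine Finset.sum_congr rfl fun u' _ => Finset.sum_congr rfl fun u _ => Finset.sum_comm
    _ = ∑ u', ∑ v', ∑ u, ∑ v, classWeight π u u' * classWeight π v v' * |A u' v'| :=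
        Finset.sum_congr rfl fun u _ => Finset.sum_comm
    _ = ∑ u', ∑ v', |A u' v'| := by
        refine Finset.sum_congr rfl fun u' _ => Finset.sum_congr rfl fun v' _ => ?_
        simp only [← Finset.sum_mul, ← Finset.mul_sum, sum_classWeight', mul_one, one_mul]

/-- A matrix that is constant on the blocks of a partition is its own block average. -/
lemma blockAveraged_eq_self {C : Matrix (Fin n) (Fin n) ℝ} {π : Fin n → Fin k}
    (hC : ∀ u v u' v', π u' = π u → π v' = π v → C u' v' = C u v) : blockAveraged C π = C := by
  ext u v
  rw [blockAveraged_apply]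
  calc ∑ u', ∑ v', classWeight π u u' * classWeight π v v' * C u' v'
      = ∑ u', ∑ v', classWeight π u u' * classWeight π v v' * C u v := by
        refine Finset.sum_congr rfl fun u' _ => Finset.sum_congr rfl fun v' _ => ?_
        unfold classWeight
        split_ifs with h1 h2
        · rw [hC u v u' v' h1 h2]
        all_goals simp
    _ = C u v := by
        simp only [← Finset.sum_mul, ← Finset.mul_sum, sum_classWeight, one_mul]

/-- Since `C` is fixed by averaging, `Q - Q_π = (Q - C) + (C - Q)_π`, and averaging contracts the
second term. Thus the block averages of `Q` are within a factor 2 of the best block-constant fit. -/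
lemma matrixL1_sub_blockAveraged_le (Q : Matrix (Fin n) (Fin n) ℝ)
    {C : Matrix (Fin n) (Fin n) ℝ} {π : Fin n → Fin k}
    (hC : ∀ u v u' v', π u' = π u → π v' = π v → C u' v' = C u v) :
    matrixL1 (Q - blockAveraged Q π) ≤ 2 * matrixL1 (Q - C) := by
  have h1 : Q - blockAveraged Q π = (Q - C) + blockAveraged (C - Q) π := by
    rw [blockAveraged_sub, blockAveraged_eq_self hC]; abel
  have h2 := matrixL1_add_le (Q - C) (blockAveraged (C - Q) π)
  have h3 := matrixL1_blockAveraged_le (C - Q) π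
  rw [matrixL1_sub_comm C Q] at h3
  rw [h1]; linarith

/-- The oracle inequality behind the least cut norm algorithm: a partition `σ` that is at least as
good as `τ` for `A` approximates `Q` up to the error of `τ` and the distance of `A` and `Q`. -/
lemma matrixCutNorm_sub_blockAveraged_le (A Q : Matrix (Fin n) (Fin n) ℝ)
    {C : Matrix (Fin n) (Fin n) ℝ} {σ τ : Fin n → Fin k}
    (hmin : matrixCutNorm (A - blockAveraged A σ) ≤ matrixCutNorm (A - blockAveraged A τ))
    (hC : ∀ u v u' v', τ u' = τ u → τ v' = τ v → C u' v' = C u v) :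
    matrixCutNorm (Q - blockAveraged A σ) ≤
      3 * matrixCutNorm (A - Q) + 2 * matrixL1 (Q - C) := by
  -- The distance of `A` and `Q` is paid three times: from `Q` to `A`, from `A` back to `Q` for the
  -- competitor `τ`, and from `Q_τ` to `A_τ`.
  have h1 := matrixCutNorm_sub_le Q A (blockAveraged A σ)
  have h2 := matrixCutNorm_sub_le A Q (blockAveraged A τ)
  have h3 := matrixCutNorm_sub_le Q (blockAveraged Q τ) (blockAveraged A τ)
  have h4 := (matrixCutNorm_le_matrixL1 _).trans (matrixL1_sub_blockAveraged_le Q hC)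
  have h5 := matrixCutNorm_blockAveraged_le (Q - A) τ
  rw [blockAveraged_sub] at h5
  rw [matrixCutNorm_sub_comm Q A] at *
  linarith

end Averaging

/-! ### Rounding class sizes and rebalancing partitions. -/

section Rearrangement

variable {n k : ℕ}

/-- The numbers `n p_i` can be rounded so that their sum remains `n`. -/
lemma exists_rounding (p : Fin k → ℝ) (hp : ∀ i, 0 ≤ p i) (hs : ∑ i, p i = 1) (n : ℕ) :
    ∃ m : Fin k → ℕ, ∑ i, m i = n ∧ ∀ i, ⌊n * p i⌋₊ ≤ m i ∧ m i ≤ ⌊n * p i⌋₊ + 1 := by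
  classical
  have h1 : ∑ i, ⌊n * p i⌋₊ ≤ n := by
    have : (∑ i, (⌊n * p i⌋₊ : ℝ)) ≤ ∑ i, n * p i :=
      Finset.sum_le_sum fun i _ => Nat.floor_le (mul_nonneg n.cast_nonneg (hp i))
    rw [← Finset.mul_sum, hs, mul_one] at this
    exact_mod_cast this
  have h2 : n ≤ ∑ i, ⌊n * p i⌋₊ + k := by
    have : ∑ i, n * p i ≤ (∑ i, ((⌊n * p i⌋₊ : ℝ) + 1)) :=
      Finset.sum_le_sum fun i _ => (Nat.lt_floor_add_one _).le
    rw [← Finset.mul_sum, hs, mul_one, Finset.sum_add_distrib] at this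
    simp only [Finset.sum_const, Finset.card_univ, Fintype.card_fin, nsmul_eq_mul, mul_one] at this
    exact_mod_cast this
  -- The rounded-down sizes fall short of `n` by at most `k`, so adding one on a set of that many
  -- indices repairs the sum.
  obtain ⟨s, -, hcard⟩ := Finset.exists_subset_card_eq (s := (Finset.univ : Finset (Fin k)))
    (n := n - ∑ i, ⌊n * p i⌋₊) (by simp; omega)
  refine ⟨fun i => ⌊n * p i⌋₊ + if i ∈ s then 1 else 0, ?_, fun i => ⟨by simp, ?_⟩⟩
  · rw [Finset.sum_add_distrib]
    simp [hcard]
    omega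
  · dsimp only; split_ifs <;> simp

/-- A partition can be turned into one with prescribed class sizes, so that each class only loses
or gains the vertices that it has to. -/
lemma exists_rearrangement (y : Fin n → Fin k) (m : Fin k → ℕ) (hm : ∑ i, m i = n) :
    ∃ z : Fin n → Fin k, (∀ i, (partClass z i).card = m i) ∧
      (∀ i, (Finset.univ.filter fun u => z u ≠ y u ∧ y u = i).card ≤ (partClass y i).card - m i) ∧
      (∀ i, (Finset.univ.filter fun u => z u ≠ y u ∧ z u = i).card ≤
        m i - (partClass y i).card) := by
  classical
  -- `K i` is the set of vertices that stay in class `i`; the vertices in `R` below are released.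
  have hK : ∀ i, ∃ K ⊆ partClass y i, K.card = min (partClass y i).card (m i) := fun i =>
    Finset.exists_subset_card_eq (min_le_left _ _)
  choose K hKs hKc using hK
  have hKy : ∀ i u, u ∈ K i → y u = i := fun i u h => mem_partClass.1 (hKs i h)
  set R : Finset (Fin n) := Finset.univ.filter fun u => u ∉ K (y u) with hR
  have hN : ∑ i, (partClass y i).card = n := by
    exact_mod_cast sum_card_partClass y
  have hRc : R.card = ∑ i, (m i - (partClass y i).card) := by
    have h1 : (Finset.univ.filter fun u => u ∈ K (y u)).card =
        ∑ i, min (partClass y i).card (m i) := by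
      rw [Finset.card_eq_sum_card_fiberwise (f := y) (t := Finset.univ)
        (fun _ _ => Finset.mem_coe.2 (Finset.mem_univ _))]
      refine Finset.sum_congr rfl fun i _ => ?_
      rw [← hKc]
      congr 1
      ext u
      simp only [Finset.mem_filter, Finset.mem_univ, true_and]
      constructor
      · rintro ⟨h, rfl⟩; exact h
      · intro h; have := hKy i u h; subst this; exact ⟨h, rfl⟩
    have h2 := Finset.card_filter_add_card_filter_not (s := (Finset.univ : Finset (Fin n)))
      (fun u => u ∈ K (y u))
    rw [h1, Finset.card_univ, Fintype.card_fin] at h2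
    have h3 : ∑ i, min (partClass y i).card (m i) + ∑ i, (m i - (partClass y i).card) =
        ∑ i, m i := by
      rw [← Finset.sum_add_distrib]
      refine Finset.sum_congr rfl fun i _ => by omega
    have h4 : R.card = (Finset.univ.filter fun u => ¬ u ∈ K (y u)).card := by rw [hR]
    rw [← h4] at h2
    omega
  -- There are as many released vertices as vacancies, and any bijection between them does. With
  -- truncated subtraction, overfull classes have no vacancies.
  have e : R ≃ (Σ i, Fin (m i - (partClass y i).card)) :=
    Fintype.equivOfCardEq (by simp [hRc])
  set z : Fin n → Fin k := fun u => if h : u ∈ R then (e ⟨u, h⟩).1 else y u with hz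
  have hzK : ∀ u, u ∉ R → z u = y u := fun u h => dif_neg h
  have hfib : ∀ i, (R.filter fun u => z u = i).card = m i - (partClass y i).card := by
    intro i
    have : (R.filter fun u => z u = i) = (Finset.univ : Finset (Fin (m i - (partClass y i).card))).map
        (((Function.Embedding.sigmaMk i).trans e.symm.toEmbedding).trans
          (Function.Embedding.subtype _)) := by
      ext u
      simp only [Finset.mem_filter, Finset.mem_map, Finset.mem_univ, true_and,
        Function.Embedding.trans_apply, Function.Embedding.sigmaMk_apply,
        Equiv.coe_toEmbedding, Function.Embedding.subtype_apply]
      constructor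
      · rintro ⟨h, h'⟩
        simp only [hz, h, dif_pos] at h'
        obtain ⟨s, hs⟩ : ∃ s, e ⟨u, h⟩ = s := ⟨_, rfl⟩
        obtain ⟨j, a⟩ := s
        rw [hs] at h'
        obtain rfl : j = i := h'
        exact ⟨a, by rw [← hs, Equiv.symm_apply_apply]⟩
      · rintro ⟨a, rfl⟩
        exact ⟨(e.symm ⟨i, a⟩).2, by simp [hz]⟩
    rw [this, Finset.card_map, Finset.card_univ, Fintype.card_fin]
  refine ⟨z, fun i => ?_, fun i => ?_, fun i => ?_⟩
  · have h1 : partClass z i = K i ∪ R.filter fun u => z u = i := by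
      ext u
      simp only [mem_partClass, Finset.mem_union, Finset.mem_filter]
      constructor
      · intro h
        by_cases hu : u ∈ R
        · exact Or.inr ⟨hu, h⟩
        · rw [hzK u hu] at h
          simp only [hR, Finset.mem_filter, Finset.mem_univ, true_and, not_not] at hu
          rw [h] at hu
          exact Or.inl hu
      · rintro (h | h)
        · have hy := hKy i u h
          rw [hzK u, hy]
          simp [hR, hy, h]
        · exact h.2
    have h2 : Disjoint (K i) (R.filter fun u => z u = i) := by
      rw [Finset.disjoint_left]
      intro u hu hu'
      have hy := hKy i u hu
      simp [hR, hy, hu] at hu'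
    rw [h1, Finset.card_union_of_disjoint h2, hKc, hfib]
    omega
  · have : (Finset.univ.filter fun u => z u ≠ y u ∧ y u = i) ⊆ partClass y i \ K i := by
      intro u hu
      simp only [Finset.mem_filter, Finset.mem_univ, true_and] at hu
      rw [Finset.mem_sdiff, mem_partClass]
      refine ⟨hu.2, fun h => hu.1 (hzK u ?_)⟩
      simp [hR, hu.2, h]
    refine (Finset.card_le_card this).trans ?_
    rw [Finset.card_sdiff_of_subset (hKs i), hKc]
    omega
  · rw [← hfib]
    refine Finset.card_le_card fun u hu => ?_
    simp only [Finset.mem_filter, Finset.mem_univ, true_and] at hu ⊢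
    exact ⟨by by_contra h; exact hu.1 (hzK u h), hu.2⟩

/-- The deviation of the class sizes of a partition from the sizes `n p_i`, with room for
rounding. -/
def classDeviation (p : Fin k → ℝ) (y : Fin n → Fin k) (i : Fin k) : ℝ :=
  |((partClass y i).card : ℝ) - n * p i| + 1

lemma classDeviation_nonneg (p : Fin k → ℝ) (y : Fin n → Fin k) (i : Fin k) :
    0 ≤ classDeviation p y i := by unfold classDeviation; positivity

/-- The class sizes of `z` are `n p_i`, up to rounding. -/
def IsBalanced (p : Fin k → ℝ) (z : Fin n → Fin k) : Prop :=
  ∀ i, ⌊n * p i⌋₊ ≤ (partClass z i).card ∧ (partClass z i).card ≤ ⌊n * p i⌋₊ + 1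

lemma IsBalanced.abs_sub_le {p : Fin k → ℝ} (hp : ∀ i, 0 ≤ p i) {z : Fin n → Fin k}
    (h : IsBalanced p z) (i : Fin k) : |((partClass z i).card : ℝ) - n * p i| ≤ 1 := by
  have h1 := Nat.floor_le (mul_nonneg n.cast_nonneg (hp i))
  have h2 := Nat.lt_floor_add_one (n * p i)
  have h3 : ((⌊n * p i⌋₊ : ℕ) : ℝ) ≤ (partClass z i).card := by exact_mod_cast (h i).1
  have h4 : ((partClass z i).card : ℝ) ≤ (⌊n * p i⌋₊ : ℕ) + 1 := by exact_mod_cast (h i).2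
  rw [abs_le]; constructor <;> linarith

lemma sum_filter_comp (y : Fin n → Fin k) (q : Fin n → Prop) [DecidablePred q] (f : Fin k → ℝ) :
    ∑ u ∈ Finset.univ.filter q, f (y u) =
      ∑ i, ((Finset.univ.filter fun u => q u ∧ y u = i).card : ℝ) * f i := by
  classical
  rw [← Finset.sum_fiberwise (Finset.univ.filter q) y]
  refine Finset.sum_congr rfl fun i _ => ?_
  rw [Finset.filter_filter, Finset.sum_congr rfl (g := fun _ => f i), Finset.sum_const,
    nsmul_eq_mul]
  intro u hu
  rw [(Finset.mem_filter.1 hu).2.2]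

lemma sum_comp (y : Fin n → Fin k) (f : Fin k → ℝ) :
    ∑ u, f (y u) = ∑ i, ((partClass y i).card : ℝ) * f i := by
  have := sum_filter_comp y (fun _ => True) f
  simpa [partClass] using this

/-- A term vanishes unless `u` or `v` has moved, and is otherwise at most the sum of the two
entries. The two cases are exchanged by the symmetry of `B`, whence the factor 2. -/
lemma sum_abs_sub_le_of_moved (B : Matrix (Fin k) (Fin k) ℝ) (hB : ∀ i j, 0 ≤ B i j)
    (hs : B.IsSymm) (y z : Fin n → Fin k) :
    ∑ u, ∑ v, |B (y u) (y v) - B (z u) (z v)| ≤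
      2 * ∑ u ∈ Finset.univ.filter (fun u => z u ≠ y u), ∑ v,
        (B (y u) (y v) + B (z u) (z v)) := by
  classical
  have h1 : ∀ u v, |B (y u) (y v) - B (z u) (z v)| ≤
      (if z u ≠ y u then (B (y u) (y v) + B (z u) (z v)) else 0) +
      (if z v ≠ y v then (B (y v) (y u) + B (z v) (z u)) else 0) := by
    intro u v
    have hy := hB (y u) (y v)
    have hz := hB (z u) (z v)
    rw [hs.apply (y u) (y v), hs.apply (z u) (z v)]
    have h : |B (y u) (y v) - B (z u) (z v)| ≤ B (y u) (y v) + B (z u) (z v) := by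
      rw [abs_le]; constructor <;> linarith
    split_ifs with h1 h2 h2
    · linarith
    · linarith
    · linarith
    · push Not at h1 h2
      rw [h1, h2]; simp
  calc _ ≤ ∑ u, ∑ v, ((if z u ≠ y u then (B (y u) (y v) + B (z u) (z v)) else 0) +
      (if z v ≠ y v then (B (y v) (y u) + B (z v) (z u)) else 0)) := by
        gcongr with u _ v _; exact h1 u v
    _ = (∑ u, ∑ v, if z u ≠ y u then (B (y u) (y v) + B (z u) (z v)) else 0) +
        ∑ u, ∑ v, if z v ≠ y v then (B (y v) (y u) + B (z v) (z u)) else 0 := by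
        simp only [Finset.sum_add_distrib]
    _ = 2 * ∑ u, ∑ v, if z u ≠ y u then (B (y u) (y v) + B (z u) (z v)) else 0 := by
        rw [Finset.sum_comm (f := fun u v => if z v ≠ y v then (B (y v) (y u) + B (z v) (z u))
          else 0)]
        ring
    _ = _ := by
        rw [Finset.sum_filter]
        congr 1
        refine Finset.sum_congr rfl fun u _ => ?_
        split_ifs <;> simp

/-- Every partition is close to a balanced one. -/
lemma exists_isBalanced (p : Fin k → ℝ) (hp : ∀ i, 0 ≤ p i) (hps : ∑ i, p i = 1)
    (B : Matrix (Fin k) (Fin k) ℝ) (hB : ∀ i j, 0 ≤ B i j) (hs : B.IsSymm) (y : Fin n → Fin k) :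
    ∃ z : Fin n → Fin k, IsBalanced p z ∧
      ∑ u, ∑ v, |B (y u) (y v) - B (z u) (z v)| ≤
        4 * ∑ i, ∑ j, classDeviation p y i * (n * p j + classDeviation p y j) * B i j := by
  classical
  obtain ⟨m, hm, hmp⟩ := exists_rounding p hp hps n
  obtain ⟨z, hz, hout, hin⟩ := exists_rearrangement y m hm
  have hzb : IsBalanced p z := fun i => by rw [hz]; exact hmp i
  refine ⟨z, hzb, ?_⟩
  have hN : ∀ j, ((partClass y j).card : ℝ) ≤ n * p j + classDeviation p y j := by
    intro j
    unfold classDeviation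
    have := le_abs_self (((partClass y j).card : ℝ) - n * p j)
    linarith
  have hM : ∀ j, ((partClass z j).card : ℝ) ≤ n * p j + classDeviation p y j := by
    intro j
    unfold classDeviation
    have h1 := (abs_le.1 (hzb.abs_sub_le hp j)).2
    have h2 := abs_nonneg (((partClass y j).card : ℝ) - n * p j)
    linarith
  have hdev : ∀ i, |((partClass y i).card : ℝ) - m i| ≤ classDeviation p y i := by
    intro i
    unfold classDeviation
    have h1 := hzb.abs_sub_le hp i
    rw [hz, abs_sub_comm] at h1
    have h2 := abs_sub_le ((partClass y i).card : ℝ) (n * p i) (m i)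
    linarith
  have hout' : ∀ i, ((Finset.univ.filter fun u => z u ≠ y u ∧ y u = i).card : ℝ) ≤
      classDeviation p y i := by
    intro i
    refine le_trans ?_ (hdev i)
    rcases le_total (m i) (partClass y i).card with h | h
    · refine le_trans ?_ (le_abs_self _)
      rw [← Nat.cast_sub h]; exact_mod_cast hout i
    · have := hout i
      rw [Nat.sub_eq_zero_of_le h, Nat.le_zero] at this
      rw [this]; simp
  have hin' : ∀ i, ((Finset.univ.filter fun u => z u ≠ y u ∧ z u = i).card : ℝ) ≤
      classDeviation p y i := by
    intro i
    refine le_trans ?_ (hdev i)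
    rcases le_total (partClass y i).card (m i) with h | h
    · rw [abs_sub_comm]
      refine le_trans ?_ (le_abs_self _)
      rw [← Nat.cast_sub h]; exact_mod_cast hin i
    · have := hin i
      rw [Nat.sub_eq_zero_of_le h, Nat.le_zero] at this
      rw [this]; simp
  have hD := classDeviation_nonneg p y
  -- The estimate is used for the old labels `w = y` and the new ones `w = z`; in both cases the
  -- moved vertices of class `i` number at most `classDeviation p y i`. The constant 4 is these two
  -- cases times the 2 of `sum_abs_sub_le_of_moved`.
  have key : ∀ w : Fin n → Fin k,
      (∀ i, ((Finset.univ.filter fun u => z u ≠ y u ∧ w u = i).card : ℝ) ≤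
        classDeviation p y i) →
      (∀ j, ((partClass w j).card : ℝ) ≤ n * p j + classDeviation p y j) →
      ∑ u ∈ Finset.univ.filter (fun u => z u ≠ y u), ∑ v, B (w u) (w v) ≤
        ∑ i, ∑ j, classDeviation p y i * (n * p j + classDeviation p y j) * B i j := by
    intro w h1 h2
    simp only [sum_comp w]
    rw [sum_filter_comp w (fun u => z u ≠ y u)
      (fun i => ∑ j, ((partClass w j).card : ℝ) * B i j)]
    refine Finset.sum_le_sum fun i _ => ?_
    rw [Finset.mul_sum]
    refine Finset.sum_le_sum fun j _ => ?_
    rw [← mul_assoc]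
    have := hB i j
    have := hD i
    have := h1 i
    have := h2 j
    gcongr
  have h1 := key y hout' hN
  have h2 := key z hin' hM
  have h3 := sum_abs_sub_le_of_moved B hB hs y z
  simp only [Finset.sum_add_distrib] at h3
  linarith

end Rearrangement

/-! ### Coupling vertices with blocks so that few labels disagree. -/

section MaximalCoupling

variable {n k : ℕ}

/-- The maximal coupling of the uniform distribution on `[n]`, classified by `z`, with `p`. -/
lemma exists_maximal_coupling (hn : 0 < n) (p : Fin k → ℝ) (hp : ∀ i, 0 ≤ p i)
    (hs : ∑ i, p i = 1) (z : Fin n → Fin k) :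
    ∃ q : Fin n → Fin k → ℝ, (∀ u i, 0 ≤ q u i) ∧ (∀ u, ∑ i, q u i = 1 / n) ∧
      (∀ i, ∑ u, q u i = p i) ∧
      (∀ j, ∑ u ∈ Finset.univ.filter (fun u => z u = j),
        ∑ i ∈ Finset.univ.filter (fun i => z u ≠ i), q u i ≤
          |((partClass z j).card : ℝ) / n - p j|) ∧
      (∀ i, ∑ u ∈ Finset.univ.filter (fun u => z u ≠ i), q u i ≤
          |((partClass z i).card : ℝ) / n - p i|) := by
  classical
  have hn' : (0 : ℝ) < n := by exact_mod_cast hn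
  set N : Fin k → ℝ := fun i => ((partClass z i).card : ℝ) with hN
  have hN0 : ∀ i, 0 ≤ N i := fun i => Nat.cast_nonneg _
  set c : Fin k → ℝ := fun i => N i / n with hc
  have hc0 : ∀ i, 0 ≤ c i := fun i => div_nonneg (hN0 i) hn'.le
  have hcs : ∑ i, c i = 1 := by
    simp only [hc, ← Finset.sum_div, hN, sum_card_partClass]
    exact div_self hn'.ne'
  -- The total variation distance of the empirical class distribution `c` and `p`: the total
  -- deficit, equal to the total excess.
  set D : ℝ := ∑ i, max (p i - c i) 0 with hD
  have hD' : D = ∑ i, max (c i - p i) 0 := by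
    have : ∑ i, (max (p i - c i) 0 - max (c i - p i) 0) = ∑ i, (p i - c i) := by
      refine Finset.sum_congr rfl fun i _ => ?_
      rcases le_total (p i) (c i) with h | h
      · rw [max_eq_right (by linarith), max_eq_left (by linarith)]; ring
      · rw [max_eq_left (by linarith), max_eq_right (by linarith)]; ring
    rw [Finset.sum_sub_distrib, Finset.sum_sub_distrib, hs, hcs] at this
    linarith
  have hD0 : 0 ≤ D := Finset.sum_nonneg fun i _ => le_max_right _ _
  have hDz : ∀ i, D = 0 → max (c i - p i) 0 = 0 := by
    intro i h
    rw [hD'] at h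
    exact (Finset.sum_eq_zero_iff_of_nonneg fun i _ => le_max_right _ _).1 h i (Finset.mem_univ i)
  have hDz' : ∀ i, D = 0 → max (p i - c i) 0 = 0 := by
    intro i h
    exact (Finset.sum_eq_zero_iff_of_nonneg fun i _ => le_max_right _ _).1 h i (Finset.mem_univ i)
  have hNpos : ∀ u, 0 < N (z u) := fun u => card_partClass_pos z u
  set e : Fin k → ℝ := fun j => max (c j - p j) 0 / N j with he
  have he0 : ∀ j, 0 ≤ e j := fun j => div_nonneg (le_max_right _ _) (hN0 j)
  have hNe : ∀ j, N j * e j = max (c j - p j) 0 := by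
    intro j
    rcases (hN0 j).eq_or_lt with h | h
    · have : c j = 0 := by simp [hc, ← h]
      rw [← h, zero_mul, this, max_eq_right (by linarith [hp j])]
    · simp only [he]; field_simp
  -- The common mass `min (c i) (p i)` stays on the diagonal, spread evenly over class `i`. The
  -- excess of each class, again spread evenly, is distributed over the deficient blocks in
  -- proportion to their deficits. If `D = 0` or a class is empty, the quotients are zero, as they
  -- should be.
  set q : Fin n → Fin k → ℝ := fun u i =>
    (if z u = i then min (c i) (p i) / N i else 0) + e (z u) * (max (p i - c i) 0 / D) with hq
  have hq0 : ∀ u i, 0 ≤ q u i := by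
    intro u i
    have h1 : 0 ≤ min (c i) (p i) / N i := div_nonneg (le_min (hc0 i) (hp i)) (hN0 i)
    have h2 : 0 ≤ max (p i - c i) 0 / D := div_nonneg (le_max_right _ _) hD0
    simp only [hq]
    have := he0 (z u)
    split_ifs <;> positivity
  have hcol2 : ∀ i, ∑ u, e (z u) * (max (p i - c i) 0 / D) = max (p i - c i) 0 := by
    intro i
    rw [← Finset.sum_mul, sum_comp z e]
    have : ∑ j, ((partClass z j).card : ℝ) * e j = D := by
      rw [hD']; exact Finset.sum_congr rfl fun j _ => hNe j
    rw [this]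
    rcases eq_or_ne D 0 with h | h
    · rw [hDz' i h]; simp
    · field_simp
  have hmax : ∀ i, max (p i - c i) 0 ≤ |c i - p i| := fun i =>
    max_le (by rw [abs_sub_comm]; exact le_abs_self _) (abs_nonneg _)
  have hmax' : ∀ i, max (c i - p i) 0 ≤ |c i - p i| := fun i =>
    max_le (le_abs_self _) (abs_nonneg _)
  have hrow2 : ∀ u, ∑ i, e (z u) * (max (p i - c i) 0 / D) = e (z u) := by
    intro u
    rw [← Finset.mul_sum, ← Finset.sum_div, ← hD]
    rcases eq_or_ne D 0 with h | h
    · simp only [he]; rw [hDz _ h]; simp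
    · rw [div_self h, mul_one]
  refine ⟨q, hq0, fun u => ?_, fun i => ?_, fun j => ?_, fun i => ?_⟩
  · simp only [hq]
    rw [Finset.sum_add_distrib, hrow2, Finset.sum_ite_eq]
    simp only [Finset.mem_univ, if_true, he]
    rw [← add_div]
    have : min (c (z u)) (p (z u)) + max (c (z u) - p (z u)) 0 = c (z u) := by
      rcases le_total (p (z u)) (c (z u)) with h | h
      · rw [min_eq_right h, max_eq_left (by linarith)]; ring
      · rw [min_eq_left h, max_eq_right (by linarith)]; ring
    rw [this]
    have := hNpos u
    simp only [hc]
    field_simp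
  · simp only [hq]
    rw [Finset.sum_add_distrib, hcol2, ← Finset.sum_filter, Finset.sum_const, nsmul_eq_mul]
    have h1 : N i * (min (c i) (p i) / N i) = min (c i) (p i) := by
      rcases (hN0 i).eq_or_lt with h | h
      · have : c i = 0 := by simp [hc, ← h]
        rw [← h, zero_mul, this, min_eq_left (hp i)]
      · field_simp
    have h2 : (Finset.univ.filter fun u => z u = i).card = (partClass z i).card := rfl
    rw [h2, show ((partClass z i).card : ℝ) = N i from rfl, h1]
    rcases le_total (p i) (c i) with h | h
    · rw [min_eq_right h, max_eq_right (by linarith)]; ring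
    · rw [min_eq_left h, max_eq_left (by linarith)]; ring
  · refine le_trans ?_ (hmax' j)
    rw [← hNe]
    calc _ ≤ ∑ u ∈ Finset.univ.filter (fun u => z u = j), e j := by
          refine Finset.sum_le_sum fun u hu => ?_
          have hu' : z u = j := (Finset.mem_filter.1 hu).2
          rw [← hu', ← hrow2 u]
          calc _ = ∑ i ∈ Finset.univ.filter (fun i => z u ≠ i),
                e (z u) * (max (p i - c i) 0 / D) := by
                refine Finset.sum_congr rfl fun i hi => ?_
                simp only [hq]
                rw [if_neg (Finset.mem_filter.1 hi).2, zero_add]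
            _ ≤ _ := Finset.sum_le_univ_sum_of_nonneg fun i =>
                mul_nonneg (he0 _) (div_nonneg (le_max_right _ _) hD0)
      _ = N j * e j := by rw [Finset.sum_const, nsmul_eq_mul]; rfl
  · refine le_trans ?_ (hmax i)
    rw [← hcol2]
    calc _ = ∑ u ∈ Finset.univ.filter (fun u => z u ≠ i),
          e (z u) * (max (p i - c i) 0 / D) := by
          refine Finset.sum_congr rfl fun u hu => ?_
          simp only [hq]
          rw [if_neg (Finset.mem_filter.1 hu).2, zero_add]
      _ ≤ _ := Finset.sum_le_univ_sum_of_nonneg fun u =>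
          mul_nonneg (he0 _) (div_nonneg (le_max_right _ _) hD0)

end MaximalCoupling

/-! ### Block models and couplings as probability measures. -/

section Blocks

lemma BlockModel.measure_singleton (V : BlockModel) (i : Fin V.k) :
    V.measure {i} = ENNReal.ofReal (V.p i) := by
  classical
  simp only [BlockModel.measure, Measure.finsetSum_apply, Measure.smul_apply, smul_eq_mul,
    Measure.dirac_apply' _ (MeasurableSet.singleton i)]
  rw [Finset.sum_eq_single i]
  · simp
  · intro j _ hj
    simp [hj]
  · simp

instance BlockModel.isProbabilityMeasure (V : BlockModel) : IsProbabilityMeasure V.measure := by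
  constructor
  simp only [BlockModel.measure, Measure.finsetSum_apply, Measure.smul_apply, smul_eq_mul,
    measure_univ, mul_one]
  rw [← ENNReal.ofReal_sum_of_nonneg fun i _ => V.p_nonneg i, V.p_sum, ENNReal.ofReal_one]

lemma IsCoupling.isProbabilityMeasure {Ω : Type u} {Ω' : Type v} [MeasurableSpace Ω]
    [MeasurableSpace Ω'] {π : Measure Ω} {π' : Measure Ω'} {ν : Measure (Ω × Ω')}
    [IsProbabilityMeasure π] (h : IsCoupling π π' ν) : IsProbabilityMeasure ν := by
  constructor
  have h1 := h.1
  rw [← measure_univ (μ := π), ← h1, Measure.map_apply measurable_fst MeasurableSet.univ,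
    Set.preimage_univ]

end Blocks

/-! ### Gluing two couplings along the blocks. -/

section Gluing

variable {n k : ℕ} {Ω : Type u} [MeasurableSpace Ω]

/-- Two couplings with a common finite marginal can be glued. -/
lemma exists_glued_measure (ν : Measure (Ω × Fin k)) [IsProbabilityMeasure ν] (p : Fin k → ℝ)
    (hν : ∀ i, ν.map Prod.snd {i} = ENNReal.ofReal (p i)) (hp : ∀ i, 0 < p i)
    (q : Fin n → Fin k → ℝ) (hq0 : ∀ u i, 0 ≤ q u i) (hq : ∀ i, ∑ u, q u i = p i) :
    ∃ γ : Measure ((Ω × Fin k) × Fin n), IsProbabilityMeasure γ ∧ γ.map Prod.fst = ν ∧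
      ∀ u i, γ.map (fun a => (a.2, a.1.2)) {(u, i)} = ENNReal.ofReal (q u i) := by
  classical
  -- The conditional law of the vertex given the block. Under `γ` the vertex and the point of `Ω`
  -- are conditionally independent given the block; positivity of `p` makes this a Markov kernel.
  set κ₀ : Kernel (Fin k) (Fin n) := Kernel.ofFunOfCountable fun i =>
    ∑ u, ENNReal.ofReal (q u i / p i) • Measure.dirac u with hκ₀
  have hκ₀a : ∀ i u, κ₀ i {u} = ENNReal.ofReal (q u i / p i) := by
    intro i u
    simp only [hκ₀, Kernel.ofFunOfCountable, Kernel.coe_mk, Measure.finsetSum_apply,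
      Measure.smul_apply, smul_eq_mul, Measure.dirac_apply' _ (MeasurableSet.singleton u)]
    rw [Finset.sum_eq_single u]
    · simp
    · intro j _ hj
      simp [hj]
    · simp
  have hmk : IsMarkovKernel κ₀ := by
    refine ⟨fun i => ⟨?_⟩⟩
    simp only [hκ₀, Kernel.ofFunOfCountable, Kernel.coe_mk, Measure.finsetSum_apply,
      Measure.smul_apply, smul_eq_mul, measure_univ, mul_one]
    rw [← ENNReal.ofReal_sum_of_nonneg fun u _ => div_nonneg (hq0 u i) (hp i).le,
      ← Finset.sum_div, hq, div_self (hp i).ne', ENNReal.ofReal_one]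
  set κ : Kernel (Ω × Fin k) (Fin n) := κ₀.comap Prod.snd measurable_snd with hκ
  refine ⟨ν ⊗ₘ κ, inferInstance, ?_, fun u i => ?_⟩
  · exact Measure.fst_compProd ν κ
  · have hm : Measurable fun a : (Ω × Fin k) × Fin n => (a.2, a.1.2) := by fun_prop
    rw [Measure.map_apply hm (MeasurableSet.singleton _),
      Measure.compProd_apply (hm (MeasurableSet.singleton _))]
    have h1 : ∀ a : Ω × Fin k, κ a (Prod.mk a ⁻¹' ((fun a : (Ω × Fin k) × Fin n =>
        (a.2, a.1.2)) ⁻¹' {(u, i)})) =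
        (Prod.snd ⁻¹' {i}).indicator (fun _ => ENNReal.ofReal (q u i / p i)) a := by
      intro a
      by_cases h : a.2 = i
      · rw [Set.indicator_of_mem (by simpa using h), ← hκ₀a i u, hκ, Kernel.comap_apply, h]
        congr 1
        ext v
        simp [h]
      · rw [Set.indicator_of_notMem (by simpa using h)]
        convert measure_empty (μ := κ a)
        ext v
        simp [h]
    simp_rw [h1]
    rw [lintegral_indicator (measurable_snd (MeasurableSet.singleton i)), lintegral_const,
      Measure.restrict_apply_univ, ← Measure.map_apply measurable_snd (MeasurableSet.singleton i),
      hν, ← ENNReal.ofReal_mul (div_nonneg (hq0 u i) (hp i).le),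
      div_mul_cancel₀ _ (hp i).ne']

end Gluing

/-! ### The `L¹` cost of mismatched blocks. -/

section CouplingCost

variable {n k : ℕ}

/-- As for moved vertices, only terms with a mismatch in `a` or `b` survive, and symmetry reduces to
a mismatch in `a`. The other coordinate is then summed freely against its marginal, which is `c`
through `z` and `p` through the block, while the mismatched mass at `i` is at most `δ i`. -/
lemma sum_coupling_abs_sub_le (B : Matrix (Fin k) (Fin k) ℝ)
    (hB : ∀ i j, 0 ≤ B i j) (hs : B.IsSymm) (p : Fin k → ℝ)
    (z : Fin n → Fin k) (q : Fin n → Fin k → ℝ)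
    (hq0 : ∀ u i, 0 ≤ q u i) (hrow : ∀ u, ∑ i, q u i = 1 / n) (hcol : ∀ i, ∑ u, q u i = p i)
    (δ : Fin k → ℝ)
    (hout : ∀ j, ∑ u ∈ Finset.univ.filter (fun u => z u = j),
        ∑ i ∈ Finset.univ.filter (fun i => z u ≠ i), q u i ≤ δ j)
    (hin : ∀ i, ∑ u ∈ Finset.univ.filter (fun u => z u ≠ i), q u i ≤ δ i) :
    ∑ a : Fin n × Fin k, ∑ b : Fin n × Fin k,
      q a.1 a.2 * q b.1 b.2 * |B (z a.1) (z b.1) - B a.2 b.2| ≤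
      2 * ∑ i, ∑ j, δ i * (((partClass z j).card : ℝ) / n + p j) * B i j := by
  classical
  set w : Fin n × Fin k → ℝ := fun a => q a.1 a.2 with hw
  have hw0 : ∀ a, 0 ≤ w a := fun a => hq0 _ _
  set c : Fin k → ℝ := fun j => ((partClass z j).card : ℝ) / n with hc
  have hc0 : ∀ j, 0 ≤ c j := fun j => by simp only [hc]; positivity
  have hp0 : ∀ j, 0 ≤ p j := fun j => by
    rw [← hcol]; exact Finset.sum_nonneg fun u _ => hq0 u j
  have h1 : ∀ a b : Fin n × Fin k, w a * w b * |B (z a.1) (z b.1) - B a.2 b.2| ≤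
      (if z a.1 ≠ a.2 then w a * (w b * (B (z a.1) (z b.1) + B a.2 b.2)) else 0) +
      (if z b.1 ≠ b.2 then w b * (w a * (B (z b.1) (z a.1) + B b.2 a.2)) else 0) := by
    intro a b
    have hy := hB (z a.1) (z b.1)
    have hz := hB a.2 b.2
    rw [hs.apply (z a.1) (z b.1), hs.apply a.2 b.2]
    have h : |B (z a.1) (z b.1) - B a.2 b.2| ≤ B (z a.1) (z b.1) + B a.2 b.2 := by
      rw [abs_le]; constructor <;> linarith
    have hab : 0 ≤ w a * w b := mul_nonneg (hw0 a) (hw0 b)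
    have h' := mul_le_mul_of_nonneg_left h hab
    have h'' : 0 ≤ w a * w b * (B (z a.1) (z b.1) + B a.2 b.2) := by positivity
    split_ifs with h1 h2 h2
    · linarith
    · linarith
    · linarith
    · push Not at h1 h2
      rw [h1, h2]; simp
  have hsum : ∀ f : Fin k → ℝ, ∑ b, w b * f (z b.1) = ∑ j, c j * f j := by
    intro f
    rw [Fintype.sum_prod_type]
    simp only [hw, ← Finset.sum_mul, hrow, hc]
    rw [sum_comp z (fun j => 1 / (n : ℝ) * f j)]
    exact Finset.sum_congr rfl fun j _ => by ring
  have hsum' : ∀ f : Fin k → ℝ, ∑ b, w b * f b.2 = ∑ j, p j * f j := by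
    intro f
    rw [Fintype.sum_prod_type, Finset.sum_comm]
    simp only [hw, ← Finset.sum_mul, hcol]
  have hinner : ∀ a : Fin n × Fin k, ∑ b, w b * (B (z a.1) (z b.1) + B a.2 b.2) =
      ∑ j, c j * B (z a.1) j + ∑ j, p j * B a.2 j := by
    intro a
    simp only [mul_add, Finset.sum_add_distrib]
    rw [hsum (fun j => B (z a.1) j), hsum' (fun j => B a.2 j)]
  have hA : ∀ f : Fin k → ℝ, (∀ i, 0 ≤ f i) →
      ∑ a, (if z a.1 ≠ a.2 then w a * f (z a.1) else 0) ≤ ∑ i, δ i * f i := by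
    intro f hf
    rw [Fintype.sum_prod_type, ← Finset.sum_fiberwise Finset.univ z]
    refine Finset.sum_le_sum fun j _ => ?_
    refine le_trans (le_of_eq ?_) (mul_le_mul_of_nonneg_right (hout j) (hf j))
    rw [Finset.sum_mul]
    refine Finset.sum_congr rfl fun u hu => ?_
    rw [Finset.sum_filter, Finset.sum_mul]
    refine Finset.sum_congr rfl fun i _ => ?_
    rw [(Finset.mem_filter.1 hu).2, ite_mul, zero_mul]
  have hA' : ∀ f : Fin k → ℝ, (∀ i, 0 ≤ f i) →
      ∑ a, (if z a.1 ≠ a.2 then w a * f a.2 else 0) ≤ ∑ i, δ i * f i := by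
    intro f hf
    rw [Fintype.sum_prod_type, Finset.sum_comm]
    refine Finset.sum_le_sum fun j _ => ?_
    refine le_trans (le_of_eq ?_) (mul_le_mul_of_nonneg_right (hin j) (hf j))
    rw [Finset.sum_filter, Finset.sum_mul]
    refine Finset.sum_congr rfl fun i _ => ?_
    rw [ite_mul, zero_mul]
  calc _ ≤ ∑ a : Fin n × Fin k, ∑ b : Fin n × Fin k,
      ((if z a.1 ≠ a.2 then w a * (w b * (B (z a.1) (z b.1) + B a.2 b.2)) else 0) +
      (if z b.1 ≠ b.2 then w b * (w a * (B (z b.1) (z a.1) + B b.2 a.2)) else 0)) := by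
        gcongr with a _ b _; exact h1 a b
    _ = 2 * ∑ a : Fin n × Fin k, ∑ b : Fin n × Fin k,
        (if z a.1 ≠ a.2 then w a * (w b * (B (z a.1) (z b.1) + B a.2 b.2)) else 0) := by
        simp only [Finset.sum_add_distrib]
        rw [Finset.sum_comm (f := fun a b : Fin n × Fin k => if z b.1 ≠ b.2 then
          w b * (w a * (B (z b.1) (z a.1) + B b.2 a.2)) else 0)]
        ring
    _ = 2 * ∑ a : Fin n × Fin k, ((if z a.1 ≠ a.2 then w a * ∑ j, c j * B (z a.1) j else 0) +
        (if z a.1 ≠ a.2 then w a * ∑ j, p j * B a.2 j else 0)) := by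
        congr 1
        refine Finset.sum_congr rfl fun a _ => ?_
        split_ifs with h
        · rw [← Finset.mul_sum, hinner, mul_add]
        · simp
    _ ≤ 2 * (∑ i, δ i * ∑ j, c j * B i j + ∑ i, δ i * ∑ j, p j * B i j) := by
        rw [Finset.sum_add_distrib]
        have e1 := hA (fun i => ∑ j, c j * B i j)
          (fun i => Finset.sum_nonneg fun j _ => mul_nonneg (hc0 j) (hB i j))
        have e2 := hA' (fun i => ∑ j, p j * B i j)
          (fun i => Finset.sum_nonneg fun j _ => mul_nonneg (hp0 j) (hB i j))
        linarith
    _ = _ := by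
        rw [← Finset.sum_add_distrib]
        congr 1
        refine Finset.sum_congr rfl fun i _ => ?_
        rw [← mul_add, ← Finset.sum_add_distrib, Finset.mul_sum]
        refine Finset.sum_congr rfl fun j _ => by ring

/-- Two different measures are allowed because, in the cut distance, the two factors are restricted
to the different sets `S` and `T`. -/
lemma integral_prod_comp_finite {A X : Type*} [MeasurableSpace A] [MeasurableSpace X] [Fintype X]
    [MeasurableSingletonClass X] (μ₁ μ₂ : Measure A) [IsFiniteMeasure μ₁] [IsFiniteMeasure μ₂]
    {m : A → X} (hm : Measurable m) (φ : X → X → ℝ) :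
    ∫ a, φ (m a.1) (m a.2) ∂(μ₁.prod μ₂) =
      ∑ x, ∑ y, (μ₁.map m).real {x} * (μ₂.map m).real {y} * φ x y := by
  have h1 : ∫ a, φ (m a.1) (m a.2) ∂(μ₁.prod μ₂) =
      ∫ b : X × X, φ b.1 b.2 ∂((μ₁.map m).prod (μ₂.map m)) := by
    rw [Measure.map_prod_map _ _ hm hm, integral_map (by fun_prop)]
    · rfl
    · exact (measurable_of_countable _).aestronglyMeasurable
  rw [h1, integral_fintype (Integrable.of_finite), Fintype.sum_prod_type]
  refine Finset.sum_congr rfl fun x _ => Finset.sum_congr rfl fun y _ => ?_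
  rw [← Set.singleton_prod_singleton, measureReal_prod_prod, smul_eq_mul]

lemma integrable_prod_comp_finite {A X : Type*} [MeasurableSpace A] [MeasurableSpace X]
    [Finite X] [MeasurableSingletonClass X] (μ₁ μ₂ : Measure A) [IsFiniteMeasure μ₁]
    [IsFiniteMeasure μ₂] {m : A → X} (hm : Measurable m) (φ : X → X → ℝ) :
    Integrable (fun a => φ (m a.1) (m a.2)) (μ₁.prod μ₂) := by
  have h : Integrable (fun b : X × X => φ b.1 b.2)
      ((μ₁.prod μ₂).map (fun a => (m a.1, m a.2))) := Integrable.of_finite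
  exact h.comp_measurable (by fun_prop)

end CouplingCost

/-! ### From matrix norms to the cut distance of the estimator from `W`. -/

section Estimation

variable {Ω : Type u} [MeasurableSpace Ω] {π : Measure Ω}

lemma estimationError_nonneg (W : Graphon Ω π) (ρ : ℝ) (V : BlockModel) :
    0 ≤ estimationError W ρ V :=
  Real.iInf_nonneg fun _ => Real.iSup_nonneg fun _ => abs_nonneg _

lemma cutDist_le_of_coupling {Ω : Type u} {Ω' : Type v} [MeasurableSpace Ω] [MeasurableSpace Ω']
    {π : Measure Ω} {π' : Measure Ω'} {U : Ω → Ω → ℝ} {W : Ω' → Ω' → ℝ}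
    {μ : Measure (Ω × Ω')} (hμ : IsCoupling π π' μ) {c : ℝ}
    (h : ∀ S T : Set (Ω × Ω'), MeasurableSet S → MeasurableSet T →
      |∫ z in S ×ˢ T, (U z.1.1 z.2.1 - W z.1.2 z.2.2) ∂(μ.prod μ)| ≤ c) :
    cutDist π π' U W ≤ c := by
  refine (ciInf_le ⟨0, ?_⟩ ⟨μ, hμ⟩).trans ?_
  · rintro _ ⟨ν, rfl⟩
    exact Real.iSup_nonneg fun _ => abs_nonneg _
  · have : Nonempty ({S : Set (Ω × Ω') // MeasurableSet S} × {T : Set (Ω × Ω') // MeasurableSet T}) :=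
      ⟨⟨∅, MeasurableSet.empty⟩, ⟨∅, MeasurableSet.empty⟩⟩
    exact ciSup_le fun ST => h _ _ ST.1.2 ST.2.2

/-- The estimation error is bounded by comparing the estimate with a matrix `H`, this matrix with
a block model that is spread out over a balanced partition, and the block model with `W`. -/
lemma estimationError_le [IsProbabilityMeasure π] (W : Graphon Ω π) (ρ : ℝ) {n : ℕ} (hn : 0 < n)
    (V : BlockModel) (σ : Fin n → Fin V.k)
    (hσ : ∀ i, V.p i = ((partClass σ i).card : ℝ) / n)
    (V₀ : BlockModel) (hV₀ : ∀ i, 0 < V₀.p i) (ν : Measure (Ω × Fin V₀.k))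
    (hν : IsCoupling π V₀.measure ν) (z : Fin n → Fin V₀.k) (hz : IsBalanced V₀.p z)
    (H : Matrix (Fin n) (Fin n) ℝ) :
    estimationError W ρ V ≤
      matrixCutNorm (H - (1 / ρ) • V.B.submatrix σ σ) +
      matrixL1 (H - V₀.B.submatrix z z) +
      2 / n * ∑ i, ∑ j, (2 * V₀.p j + 1 / n) * V₀.B i j +
      ∫ a : (Ω × Fin V₀.k) × (Ω × Fin V₀.k),
        |W.toFun a.1.1 a.2.1 - V₀.B a.1.2 a.2.2| ∂(ν.prod ν) := by
  classical
  have hn' : (0 : ℝ) < n := by exact_mod_cast hn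
  have hνp := hν.isProbabilityMeasure
  obtain ⟨q, hq0, hrow, hcol, hout, hin⟩ :=
    exists_maximal_coupling hn V₀.p V₀.p_nonneg V₀.p_sum z
  have hδ : ∀ i, |((partClass z i).card : ℝ) / n - V₀.p i| ≤ 1 / n := by
    intro i
    have h := hz.abs_sub_le V₀.p_nonneg i
    rw [show ((partClass z i).card : ℝ) / n - V₀.p i =
      (((partClass z i).card : ℝ) - n * V₀.p i) / n by field_simp, abs_div,
      abs_of_pos hn']
    gcongr
  have hcost := sum_coupling_abs_sub_le V₀.B V₀.B_nonneg V₀.B_symm V₀.p z q hq0 hrow hcol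
    (fun _ => 1 / n) (fun j => (hout j).trans (hδ j)) (fun j => (hin j).trans (hδ j))
  -- Under `γ` a point of `Ω`, a block of `V₀` and a vertex are coupled, by `ν` in the first two
  -- coordinates and by `q` in the last two.
  obtain ⟨γ, hγp, hγ1, hγ2⟩ := exists_glued_measure ν V₀.p
    (fun i => by rw [hν.2, V₀.measure_singleton]) hV₀ q hq0 hcol
  have hγ2' : ∀ x : Fin n × Fin V₀.k, (γ.map (fun a => (a.2, a.1.2))).real {x} = q x.1 x.2 := by
    intro x
    rw [measureReal_def, hγ2 x.1 x.2, ENNReal.toReal_ofReal (hq0 _ _)]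
  have hm2 : Measurable fun a : (Ω × Fin V₀.k) × Fin n => (a.2, a.1.2) := by fun_prop
  have hγ3 : ∀ u, γ.map Prod.snd {u} = ENNReal.ofReal (1 / n) := by
    intro u
    have : γ.map Prod.snd = (γ.map (fun a => (a.2, a.1.2))).map Prod.fst := by
      rw [Measure.map_map measurable_fst hm2]; rfl
    rw [this, Measure.map_apply measurable_fst (MeasurableSet.singleton u)]
    have hset : (Prod.fst ⁻¹' {u} : Set (Fin n × Fin V₀.k)) =
        ((Finset.univ.image fun i => (u, i) : Finset (Fin n × Fin V₀.k)) : Set _) := by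
      ext ⟨a, b⟩
      simp [eq_comm]
    rw [hset, ← sum_measure_singleton, Finset.sum_image (fun i _ j _ h => (Prod.ext_iff.1 h).2)]
    simp only [hγ2]
    rw [← ENNReal.ofReal_sum_of_nonneg fun i _ => hq0 u i, hrow]
  have hγ3' : ∀ u, (γ.map Prod.snd).real {u} = 1 / n := by
    intro u
    rw [measureReal_def, hγ3, ENNReal.toReal_ofReal (by positivity)]
  have hσm : Measurable σ := measurable_of_countable _
  have hf : Measurable fun a : (Ω × Fin V₀.k) × Fin n => (σ a.2, a.1.1) := by fun_prop
  set f : (Ω × Fin V₀.k) × Fin n → Fin V.k × Ω := fun a => (σ a.2, a.1.1) with hfdef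
  -- The vertex marginal of `γ` is uniform, so its image under `σ` has the relative class sizes
  -- `V.p` as weights. The coupling used for the cut distance thus passes from an estimated block to
  -- a vertex, to a block of `V₀`, to a point of `Ω`.
  have hμ : IsCoupling V.measure π (γ.map f) := by
    constructor
    · rw [Measure.map_map measurable_fst hf]
      have : Prod.fst ∘ f = σ ∘ Prod.snd := rfl
      rw [this, ← Measure.map_map hσm measurable_snd]
      refine Measure.ext_of_singleton fun i => ?_
      rw [Measure.map_apply hσm (MeasurableSet.singleton i), V.measure_singleton, hσ]
      have hset : σ ⁻¹' {i} = (partClass σ i : Set (Fin n)) := by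
        ext u; simp [mem_partClass]
      rw [hset, ← sum_measure_singleton]
      simp only [hγ3, Finset.sum_const, nsmul_eq_mul]
      rw [div_eq_mul_one_div ((partClass σ i).card : ℝ), ENNReal.ofReal_mul (Nat.cast_nonneg _), ENNReal.ofReal_natCast]
    · rw [Measure.map_map measurable_snd hf]
      have : Prod.snd ∘ f = Prod.fst ∘ Prod.fst := rfl
      rw [this, ← Measure.map_map measurable_fst measurable_fst, hγ1, hν.1]
  refine cutDist_le_of_coupling hμ fun S T hS hT => ?_
  -- the four differences
  set g₁ : ((Ω × Fin V₀.k) × Fin n) × ((Ω × Fin V₀.k) × Fin n) → ℝ := fun a =>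
    (fun u v => 1 / ρ * V.B (σ u) (σ v) - H u v) a.1.2 a.2.2 with hg₁
  set g₂ : ((Ω × Fin V₀.k) × Fin n) × ((Ω × Fin V₀.k) × Fin n) → ℝ := fun a =>
    (fun u v => H u v - V₀.B (z u) (z v)) a.1.2 a.2.2 with hg₂
  set g₃ : ((Ω × Fin V₀.k) × Fin n) × ((Ω × Fin V₀.k) × Fin n) → ℝ := fun a =>
    (fun x y : Fin n × Fin V₀.k => V₀.B (z x.1) (z y.1) - V₀.B x.2 y.2)
      (a.1.2, a.1.1.2) (a.2.2, a.2.1.2) with hg₃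
  set g₄ : ((Ω × Fin V₀.k) × Fin n) × ((Ω × Fin V₀.k) × Fin n) → ℝ := fun a =>
    V₀.B a.1.1.2 a.2.1.2 - W.toFun a.1.1.1 a.2.1.1 with hg₄
  have hγπ : (γ.prod γ).map (fun a => (a.1.1.1, a.2.1.1)) = π.prod π := by
    have h1 : γ.map (fun a => a.1.1) = π := by
      rw [← hν.1, ← hγ1, Measure.map_map measurable_fst measurable_fst]; rfl
    have hm : Measurable fun a : (Ω × Fin V₀.k) × Fin n => a.1.1 := by fun_prop
    conv_rhs => rw [← h1, Measure.map_prod_map _ _ hm hm]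
    rfl
  have hi₁ : Integrable g₁ (γ.prod γ) := integrable_prod_comp_finite γ γ measurable_snd
    (fun u v => 1 / ρ * V.B (σ u) (σ v) - H u v)
  have hi₂ : Integrable g₂ (γ.prod γ) := integrable_prod_comp_finite γ γ measurable_snd
    (fun u v => H u v - V₀.B (z u) (z v))
  have hi₃ : Integrable g₃ (γ.prod γ) := integrable_prod_comp_finite γ γ hm2
    (fun x y : Fin n × Fin V₀.k => V₀.B (z x.1) (z y.1) - V₀.B x.2 y.2)
  have hi₄ : Integrable g₄ (γ.prod γ) := by
    refine Integrable.sub ?_ ?_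
    · exact integrable_prod_comp_finite γ γ (m := fun a => a.1.2) (by fun_prop) V₀.B
    · have hW := W.integrable'
      rw [← hγπ] at hW
      exact hW.comp_measurable (by fun_prop)
  have habs : ∀ g : ((Ω × Fin V₀.k) × Fin n) × ((Ω × Fin V₀.k) × Fin n) → ℝ,
      Integrable g (γ.prod γ) → ∀ E, |∫ a in E, g a ∂(γ.prod γ)| ≤ ∫ a, |g a| ∂(γ.prod γ) := by
    intro g hg E
    refine (abs_integral_le_integral_abs).trans ?_
    exact setIntegral_le_integral hg.abs (Eventually.of_forall fun a => abs_nonneg _)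
  have hS' : MeasurableSet (f ⁻¹' S) := hf hS
  have hT' : MeasurableSet (f ⁻¹' T) := hf hT
  have hint : ∫ w in S ×ˢ T, (1 / ρ * V.B w.1.1 w.2.1 - W.toFun w.1.2 w.2.2)
      ∂((γ.map f).prod (γ.map f)) =
      ∫ a in (f ⁻¹' S) ×ˢ (f ⁻¹' T), (g₁ a + g₂ a + g₃ a + g₄ a) ∂(γ.prod γ) := by
    rw [Measure.map_prod_map _ _ hf hf, setIntegral_map (hS.prod hT)]
    · refine setIntegral_congr_fun (hS'.prod hT') fun a _ => ?_
      simp only [hg₁, hg₂, hg₃, hg₄, Prod.map_fst, Prod.map_snd, hfdef]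
      ring
    · refine Measurable.aestronglyMeasurable (Measurable.sub (Measurable.const_mul ?_ _) ?_)
      · exact (measurable_of_countable (fun x : Fin V.k × Fin V.k => V.B x.1 x.2)).comp
          (by fun_prop : Measurable fun w : (Fin V.k × Ω) × (Fin V.k × Ω) => (w.1.1, w.2.1))
      · exact W.measurable'.comp
          (by fun_prop : Measurable fun w : (Fin V.k × Ω) × (Fin V.k × Ω) => (w.1.2, w.2.2))
    · exact (hf.prodMap hf).aemeasurable
  have e₁ : |∫ a in (f ⁻¹' S) ×ˢ (f ⁻¹' T), g₁ a ∂(γ.prod γ)| ≤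
      matrixCutNorm (H - (1 / ρ) • V.B.submatrix σ σ) := by
    rw [← Measure.prod_restrict, hg₁]
    rw [integral_prod_comp_finite _ _ measurable_snd
      (fun u v => 1 / ρ * V.B (σ u) (σ v) - H u v)]
    -- `α u` is the conditional probability of `f ⁻¹' S` given the vertex `u`. The sets `S` and `T`
    -- thereby become fractional vertex sets, so only the cut norm of the matrix difference is
    -- needed here; the other three differences are bounded in `L¹`.
    set α : Fin n → ℝ := fun u => n * ((γ.restrict (f ⁻¹' S)).map Prod.snd).real {u} with hα
    set β : Fin n → ℝ := fun u => n * ((γ.restrict (f ⁻¹' T)).map Prod.snd).real {u} with hβ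
    have hle : ∀ (E : Set ((Ω × Fin V₀.k) × Fin n)) u,
        n * ((γ.restrict E).map Prod.snd).real {u} ≤ 1 := by
      intro E u
      have : ((γ.restrict E).map Prod.snd).real {u} ≤ (γ.map Prod.snd).real {u} := by
        rw [map_measureReal_apply measurable_snd (MeasurableSet.singleton u),
          map_measureReal_apply measurable_snd (MeasurableSet.singleton u)]
        exact ENNReal.toReal_mono (measure_ne_top _ _) (Measure.restrict_apply_le _ _)
      rw [hγ3'] at this
      calc _ ≤ (n : ℝ) * (1 / n) := by gcongr
        _ = 1 := by field_simp
    rw [matrixCutNorm_sub_comm]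
    refine le_trans (le_of_eq ?_) (abs_sum_mul_mul_le_matrixCutNorm _ α β
      (fun u => by positivity) (hle _) (fun u => by positivity) (hle _))
    rw [← abs_of_pos (pow_pos hn' 2), ← abs_div, Finset.sum_div]
    congr 1
    refine Finset.sum_congr rfl fun u _ => ?_
    rw [Finset.sum_div]
    refine Finset.sum_congr rfl fun v _ => ?_
    simp only [hα, hβ, Matrix.sub_apply, Matrix.smul_apply, Matrix.submatrix_apply, smul_eq_mul]
    field_simp
  have e₂ : ∫ a, |g₂ a| ∂(γ.prod γ) = matrixL1 (H - V₀.B.submatrix z z) := by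
    rw [integral_prod_comp_finite _ _ measurable_snd (fun u v => |H u v - V₀.B (z u) (z v)|)]
    simp only [hγ3', matrixL1, Matrix.sub_apply, Matrix.submatrix_apply]
    rw [Finset.sum_div]
    refine Finset.sum_congr rfl fun u _ => ?_
    rw [Finset.sum_div]
    refine Finset.sum_congr rfl fun v _ => ?_
    field_simp
  have e₃ : ∫ a, |g₃ a| ∂(γ.prod γ) ≤
      2 / n * ∑ i, ∑ j, (2 * V₀.p j + 1 / n) * V₀.B i j := by
    rw [hg₃]
    rw [integral_prod_comp_finite _ _ hm2
      (fun x y : Fin n × Fin V₀.k => |V₀.B (z x.1) (z y.1) - V₀.B x.2 y.2|)]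
    simp only [hγ2']
    refine hcost.trans ?_
    rw [show (2 : ℝ) / n = 2 * (1 / n) by ring, mul_assoc (2 : ℝ)]
    refine mul_le_mul_of_nonneg_left ?_ (zero_le_two : (0 : ℝ) ≤ 2)
    rw [Finset.mul_sum]
    refine Finset.sum_le_sum fun i _ => ?_
    rw [Finset.mul_sum]
    refine Finset.sum_le_sum fun j _ => ?_
    rw [mul_assoc]
    have h1 := (abs_le.1 (hδ j)).2
    have h2 := V₀.B_nonneg i j
    exact mul_le_mul_of_nonneg_left (mul_le_mul_of_nonneg_right (by linarith) h2)
      (by positivity)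
  have e₄ : ∫ a, |g₄ a| ∂(γ.prod γ) = ∫ a : (Ω × Fin V₀.k) × (Ω × Fin V₀.k),
        |W.toFun a.1.1 a.2.1 - V₀.B a.1.2 a.2.2| ∂(ν.prod ν) := by
    rw [← hγ1, Measure.map_prod_map _ _ measurable_fst measurable_fst, integral_map]
    · simp only [hg₄, Prod.map_fst, Prod.map_snd, abs_sub_comm]
    · exact (measurable_fst.prodMap measurable_fst).aemeasurable
    · refine Measurable.aestronglyMeasurable (Measurable.abs (Measurable.sub ?_ ?_))
      · exact W.measurable'.comp (by fun_prop :
          Measurable fun a : (Ω × Fin V₀.k) × (Ω × Fin V₀.k) => (a.1.1, a.2.1))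
      · exact (measurable_of_countable (fun x : Fin V₀.k × Fin V₀.k => V₀.B x.1 x.2)).comp
          (by fun_prop : Measurable fun a : (Ω × Fin V₀.k) × (Ω × Fin V₀.k) => (a.1.2, a.2.2))
  rw [hint, integral_add (f := fun a => g₁ a + g₂ a + g₃ a)
      ((hi₁.add hi₂).add hi₃).integrableOn hi₄.integrableOn,
    integral_add (f := fun a => g₁ a + g₂ a) (hi₁.add hi₂).integrableOn hi₃.integrableOn,
    integral_add hi₁.integrableOn hi₂.integrableOn]
  have a₂ := habs g₂ hi₂ ((f ⁻¹' S) ×ˢ (f ⁻¹' T))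
  have a₃ := habs g₃ hi₃ ((f ⁻¹' S) ×ˢ (f ⁻¹' T))
  have a₄ := habs g₄ hi₄ ((f ⁻¹' S) ×ˢ (f ⁻¹' T))
  refine (abs_add_le _ _).trans ?_
  refine (add_le_add_left ((abs_add_le _ _).trans
    (add_le_add_left (abs_add_le _ _) _)) _).trans ?_
  rw [e₂] at a₂
  rw [e₄] at a₄
  linarith [a₃.trans e₃]

end Estimation

/-! ### The deterministic error bound for a minimizing partition. -/

section Output

variable {Ω : Type u} [MeasurableSpace Ω] {π : Measure Ω}

lemma matrixCutNorm_smul {n : ℕ} (c : ℝ) (A : Matrix (Fin n) (Fin n) ℝ) :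
    matrixCutNorm (c • A) = |c| * matrixCutNorm A := by
  unfold matrixCutNorm
  rw [Real.mul_iSup_of_nonneg (abs_nonneg c)]
  congr 1
  ext ST
  simp only [Matrix.smul_apply, smul_eq_mul, ← Finset.mul_sum, abs_mul, mul_div_assoc]

/-- Blocks of mass at least `κ` number at most `1 / κ`, and `⌊κ n⌋ ≤ κ n`. Hence every comparison
model fits into the classes available to the estimator. -/
lemma k_le_numClasses {V : BlockModel} {n : ℕ} {κ : ℝ} (hn : 0 < n)
    (h1 : 1 ≤ κ * n) (hV : ∀ i, κ ≤ V.p i) : V.k ≤ numClasses n κ := by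
  have hn' : (0 : ℝ) < n := by exact_mod_cast hn
  have h2 : (V.k : ℝ) * κ ≤ 1 := by
    rw [← V.p_sum]
    have := Finset.sum_le_sum fun i (_ : i ∈ Finset.univ) => hV i
    simpa using this
  have h3 : (1 : ℝ) ≤ (⌊κ * n⌋₊ : ℕ) := by
    exact_mod_cast (Nat.one_le_floor_iff _).2 h1
  have h4 : ((⌊κ * n⌋₊ : ℕ) : ℝ) ≤ κ * n := Nat.floor_le (by linarith)
  have h5 : (V.k : ℝ) ≤ (n : ℝ) / (⌊κ * n⌋₊ : ℕ) := by
    rw [le_div_iff₀ (by linarith)]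
    calc (V.k : ℝ) * (⌊κ * n⌋₊ : ℕ) ≤ V.k * (κ * n) := by gcongr
      _ = (V.k * κ) * n := by ring
      _ ≤ 1 * n := by gcongr
      _ = n := one_mul _
  exact_mod_cast h5.trans (Nat.le_ceil _)

/-- The deterministic error bound for the least cut norm algorithm. -/
lemma estimationError_le_of_isLeastCutNormOutput [IsProbabilityMeasure π] (W : Graphon Ω π)
    {ρ κ : ℝ} (hρ : 0 < ρ) {n : ℕ} (hn : 0 < n) (hκn : 1 ≤ κ * n) {G : SimpleGraph (Fin n)}
    {V : BlockModel} (hV : IsLeastCutNormOutput κ G V)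
    (V₁ : BlockModel) (hV₁ : ∀ i, κ ≤ V₁.p i) (z₁ : Fin n → Fin V₁.k)
    (hz₁ : IsBalanced V₁.p z₁)
    (V₂ : BlockModel) (hV₂ : ∀ i, 0 < V₂.p i) (ν : Measure (Ω × Fin V₂.k))
    (hν : IsCoupling π V₂.measure ν) (z₂ : Fin n → Fin V₂.k) (hz₂ : IsBalanced V₂.p z₂)
    (Q : Matrix (Fin n) (Fin n) ℝ) :
    estimationError W ρ V ≤
      3 * ((1 / ρ) * matrixCutNorm (adjacency G - Q)) +
      2 * matrixL1 ((1 / ρ) • Q - V₁.B.submatrix z₁ z₁) +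
      matrixL1 ((1 / ρ) • Q - V₂.B.submatrix z₂ z₂) +
      2 / n * ∑ i, ∑ j, (2 * V₂.p j + 1 / n) * V₂.B i j +
      ∫ a : (Ω × Fin V₂.k) × (Ω × Fin V₂.k),
        |W.toFun a.1.1 a.2.1 - V₂.B a.1.2 a.2.2| ∂(ν.prod ν) := by
  classical
  obtain ⟨hk, σ, hσ, hmin, hp, hB⟩ := hV
  have hle : V₁.k ≤ V.k := by rw [hk]; exact k_le_numClasses hn hκn hV₁
  -- The balanced partition is viewed as a competitor by leaving the additional classes empty, which
  -- admissibility permits.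
  set τ : Fin n → Fin V.k := fun u => Fin.castLE hle (z₁ u) with hτ
  have hinj : Function.Injective (Fin.castLE hle) := Fin.castLE_injective hle
  have hτadm : AdmissiblePartition κ τ := by
    rintro i ⟨u, hu⟩
    rw [mem_partClass] at hu
    have : partClass τ i = partClass z₁ (z₁ u) := by
      ext v
      rw [mem_partClass, mem_partClass, ← hu]
      exact hinj.eq_iff
    rw [this]
    -- Here it matters that balanced classes have at least `⌊n p_i⌋` elements, rather than just
    -- approximately `n p_i`.
    refine le_trans (Nat.floor_mono ?_) (hz₁ (z₁ u)).1
    rw [mul_comm]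
    exact mul_le_mul_of_nonneg_left (hV₁ _) n.cast_nonneg
  have hm := matrixCutNorm_sub_blockAveraged_le (adjacency G) Q (hmin τ hτadm)
    (C := ρ • V₁.B.submatrix z₁ z₁) (by
      intro u v u' v' h1 h2
      have e1 := hinj h1
      have e2 := hinj h2
      simp only [Matrix.smul_apply, Matrix.submatrix_apply, e1, e2])
  have hest := estimationError_le W ρ hn V σ hp V₂ hV₂ ν hν z₂ hz₂ ((1 / ρ) • Q)
  have e1 : matrixCutNorm ((1 / ρ) • Q - (1 / ρ) • V.B.submatrix σ σ) =
      (1 / ρ) * matrixCutNorm (Q - blockAveraged (adjacency G) σ) := by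
    rw [← smul_sub, matrixCutNorm_smul, abs_of_pos (by positivity), hB]
    rfl
  have e2 : matrixL1 ((1 / ρ) • Q - V₁.B.submatrix z₁ z₁) =
      (1 / ρ) * matrixL1 (Q - ρ • V₁.B.submatrix z₁ z₁) := by
    rw [← abs_of_pos (show 0 < 1 / ρ by positivity), ← matrixL1_smul, smul_sub, smul_smul,
      abs_of_pos (show 0 < 1 / ρ by positivity), one_div_mul_cancel hρ.ne', one_smul]
  have e3 := mul_le_mul_of_nonneg_left hm (show 0 ≤ 1 / ρ by positivity)
  rw [e1] at hest
  rw [e2]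
  linarith

end Output

/-! ### Random graphs with fixed edge probabilities: moments and exponential moments. -/

section RandomGraph

variable {n : ℕ}

lemma sum_sum_eq_sum_Ioi (f : Fin n → Fin n → ℝ) (h : ∀ i, f i i = 0) :
    ∑ i, ∑ j, f i j = ∑ i, ∑ j ∈ Finset.Ioi i, (f i j + f j i) := by
  have h1 : ∀ i, ∑ j, f i j = ∑ j ∈ Finset.Ioi i, f i j + ∑ j ∈ Finset.Iio i, f i j := by
    intro i
    have hu : (Finset.univ : Finset (Fin n)) = insert i (Finset.Ioi i ∪ Finset.Iio i) := by
      ext j; simp; omega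
    rw [hu, Finset.sum_insert (by simp), h, zero_add, Finset.sum_union]
    rw [Finset.disjoint_left]
    intro j hj hj'
    rw [Finset.mem_Ioi] at hj
    rw [Finset.mem_Iio] at hj'
    exact absurd hj' (not_lt_of_gt hj)
  simp only [h1, Finset.sum_add_distrib]
  congr 1
  exact Finset.sum_comm' (by simp)

/-- A sum over all graphs of a product over the pairs is at most the product of the sums. -/
lemma sum_prod_adj_le (F : Fin n → Fin n → Bool → ℝ) (hF : ∀ i j b, 0 ≤ F i j b) :
    letI := Classical.decEq (Fin n)
    letI := Classical.propDecidable
    ∑ g : SimpleGraph (Fin n), ∏ i, ∏ j ∈ Finset.Ioi i, F i j (decide (g.Adj i j)) ≤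
      ∏ i, ∏ j ∈ Finset.Ioi i, (F i j true + F i j false) := by
  classical
  set s : Finset (Σ _ : Fin n, Fin n) := Finset.univ.sigma fun i => Finset.Ioi i with hs
  have h1 : ∀ f : Fin n → Fin n → ℝ, ∏ i, ∏ j ∈ Finset.Ioi i, f i j = ∏ e ∈ s, f e.1 e.2 := by
    intro f
    rw [hs, Finset.prod_sigma]
  simp only [h1]
  have h2 : ∀ e : Σ _ : Fin n, Fin n, F e.1 e.2 true + F e.1 e.2 false =
      ∑ b ∈ (Finset.univ : Finset Bool), F e.1 e.2 b := by
    intro e; simp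
  simp only [h2]
  rw [Finset.prod_sum]
  -- A graph is encoded by its adjacencies on pairs `i < j`. As the summands are non-negative,
  -- injectivity of this encoding suffices for the inequality.
  set φ : SimpleGraph (Fin n) → ((e : Σ _ : Fin n, Fin n) → e ∈ s → Bool) := fun g e _ =>
    decide (g.Adj e.1 e.2) with hφ
  have hinj : Function.Injective φ := by
    intro g g' h
    have key : ∀ i j, i < j → (g.Adj i j ↔ g'.Adj i j) := by
      intro i j hij
      have := congrFun (congrFun h ⟨i, j⟩) (by simp [hs, hij])
      simpa [hφ] using this
    ext i j
    rcases lt_trichotomy i j with h | h | h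
    · exact key i j h
    · subst h; simp
    · rw [g.adj_comm, g'.adj_comm]; exact key j i h
  calc _ = ∑ g : SimpleGraph (Fin n), ∏ e ∈ s.attach, F e.1.1 e.1.2 (φ g e.1 e.2) := by
        refine Finset.sum_congr (by congr!) fun g _ => ?_
        rw [← Finset.prod_attach s]
    _ = ∑ p ∈ Finset.univ.image φ, ∏ e ∈ s.attach, F e.1.1 e.1.2 (p e.1 e.2) := by
        rw [Finset.sum_image fun _ _ _ _ h => hinj h]
    _ ≤ _ := by
        refine Finset.sum_le_sum_of_subset_of_nonneg ?_ fun p _ _ =>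
          Finset.prod_nonneg fun e _ => hF _ _ _
        intro p _
        simp

lemma graphProb_nonneg {Q : Matrix (Fin n) (Fin n) ℝ} (h0 : ∀ i j, 0 ≤ Q i j)
    (h1 : ∀ i j, Q i j ≤ 1) (g : SimpleGraph (Fin n)) : 0 ≤ graphProb Q g := by
  refine Finset.prod_nonneg fun i _ => Finset.prod_nonneg fun j _ => ?_
  split_ifs
  · exact h0 i j
  · linarith [h1 i j]

lemma adjacency_apply (g : SimpleGraph (Fin n)) (i j : Fin n) :
    letI := Classical.propDecidable
    adjacency g i j = if g.Adj i j then 1 else 0 := by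
  simp [adjacency, SimpleGraph.adjMatrix_apply]

lemma adjacency_nonneg (g : SimpleGraph (Fin n)) (i j : Fin n) : 0 ≤ adjacency g i j := by
  classical
  rw [adjacency_apply]; split_ifs <;> norm_num

open Classical in
/-- The expected number of edges between two given vertices. -/
lemma sum_graphProb_mul_adjacency_le {Q : Matrix (Fin n) (Fin n) ℝ} (h0 : ∀ i j, 0 ≤ Q i j)
    (h1 : ∀ i j, Q i j ≤ 1) (hs : Q.IsSymm) (a b : Fin n) :
    ∑ g : SimpleGraph (Fin n), graphProb Q g * adjacency g a b ≤ Q a b := by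
  wlog hab : a < b generalizing a b
  · rcases (not_lt.1 hab).eq_or_lt with h | h
    · subst h
      simpa [adjacency_apply] using h0 b b
    · have := this b a h
      rw [hs.apply] at this
      refine le_trans (le_of_eq ?_) this
      refine Finset.sum_congr rfl fun g _ => ?_
      rw [adjacency_apply, adjacency_apply, g.adj_comm]
  -- Setting the factor for a missing edge `ab` to zero encodes multiplication by the adjacency; all
  -- other pairs contribute the factor one.
  set F : Fin n → Fin n → Bool → ℝ := fun i j c =>
    if c then Q i j else if i = a ∧ j = b then 0 else 1 - Q i j with hF
  have hF0 : ∀ i j c, 0 ≤ F i j c := by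
    intro i j c
    have := h0 i j
    have := h1 i j
    simp only [hF]
    split_ifs <;> linarith
  have hle := sum_prod_adj_le F hF0
  have e1 : ∀ g : SimpleGraph (Fin n), graphProb Q g * adjacency g a b ≤
      ∏ i, ∏ j ∈ Finset.Ioi i, F i j (decide (g.Adj i j)) := by
    intro g
    rw [adjacency_apply]
    by_cases hg : g.Adj a b
    · rw [if_pos hg, mul_one]
      refine le_of_eq (Finset.prod_congr rfl fun i _ => Finset.prod_congr rfl fun j _ => ?_)
      simp only [hF, decide_eq_true_eq]
      split_ifs with h2 h3
      · rfl
      · exact absurd (h3.1 ▸ h3.2 ▸ hg) h2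
      · rfl
    · rw [if_neg hg, mul_zero]
      exact Finset.prod_nonneg fun i _ => Finset.prod_nonneg fun j _ => hF0 _ _ _
  refine (Finset.sum_le_sum fun g _ => e1 g).trans ?_
  refine le_trans (le_of_eq ?_) (hle.trans (le_of_eq ?_))
  · refine Finset.sum_congr (by congr!) fun g _ => ?_
    refine Finset.prod_congr rfl fun i _ => Finset.prod_congr rfl fun j _ => ?_
    congr
  · rw [Finset.prod_eq_single a, Finset.prod_eq_single b]
    · simp [hF]
    · intro j _ hj
      simp [hF, hj]
    · intro h; exact absurd (Finset.mem_Ioi.2 hab) h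
    · intro i _ hi
      refine Finset.prod_eq_one fun j _ => ?_
      simp [hF, hi]
    · simp

open Classical in
lemma sum_graphProb_le_one {Q : Matrix (Fin n) (Fin n) ℝ} (h0 : ∀ i j, 0 ≤ Q i j)
    (h1 : ∀ i j, Q i j ≤ 1) : ∑ g : SimpleGraph (Fin n), graphProb Q g ≤ 1 := by
  have hle := sum_prod_adj_le (fun i j (c : Bool) => if c then Q i j else 1 - Q i j) (by
    intro i j c
    have := h0 i j
    have := h1 i j
    split_ifs <;> linarith)
  refine le_trans (le_of_eq ?_) (hle.trans (le_of_eq ?_))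
  · refine Finset.sum_congr (by congr!) fun g _ => ?_
    refine Finset.prod_congr rfl fun i _ => Finset.prod_congr rfl fun j _ => ?_
    by_cases h : g.Adj i j <;> simp [h]
  · simp

/-- This follows from `1 + x ≤ exp x` and `exp t - 1 - t ≤ t ^ 2`. The factor `q` in the exponent,
absent from a Hoeffding bound, is what makes the estimate useful for sparse graphs. -/
lemma bernoulli_mgf_le {q t : ℝ} (hq0 : 0 ≤ q) (ht : |t| ≤ 1) :
    q * Real.exp (t * (1 - q)) + (1 - q) * Real.exp (t * (0 - q)) ≤ Real.exp (q * t ^ 2) := by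
  have h1 : q * Real.exp (t * (1 - q)) + (1 - q) * Real.exp (t * (0 - q)) =
      Real.exp (-(t * q)) * (q * (Real.exp t - 1) + 1) := by
    rw [show t * (1 - q) = -(t * q) + t by ring, show t * (0 - q) = -(t * q) by ring,
      Real.exp_add]
    ring
  rw [h1]
  have h2 := Real.add_one_le_exp (q * (Real.exp t - 1))
  have h3 := (abs_le.1 (Real.abs_exp_sub_one_sub_id_le ht)).2
  calc _ ≤ Real.exp (-(t * q)) * Real.exp (q * (Real.exp t - 1)) := by gcongr
    _ = Real.exp (-(t * q) + q * (Real.exp t - 1)) := (Real.exp_add _ _).symm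
    _ ≤ _ := by
        refine Real.exp_le_exp.2 ?_
        nlinarith

open Classical in
/-- The moment generating function of a weighted sum of the centered edges. -/
lemma sum_graphProb_mul_exp_le {Q : Matrix (Fin n) (Fin n) ℝ} (h0 : ∀ i j, 0 ≤ Q i j)
    (h1 : ∀ i j, Q i j ≤ 1) (t : Fin n → Fin n → ℝ) (c : ℝ) (hc : c ≤ 1) (ht : ∀ i j, |t i j| ≤ c) :
    ∑ g : SimpleGraph (Fin n), graphProb Q g *
      Real.exp (∑ i, ∑ j ∈ Finset.Ioi i, t i j * (adjacency g i j - Q i j)) ≤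
    Real.exp (c ^ 2 * ∑ i, ∑ j ∈ Finset.Ioi i, Q i j) := by
  set F : Fin n → Fin n → Bool → ℝ := fun i j b =>
    (if b then Q i j else 1 - Q i j) * Real.exp (t i j * ((if b then 1 else 0) - Q i j)) with hF
  have hF0 : ∀ i j b, 0 ≤ F i j b := by
    intro i j b
    have := h0 i j
    have := h1 i j
    refine mul_nonneg ?_ (Real.exp_pos _).le
    split_ifs <;> linarith
  have hle := sum_prod_adj_le F hF0
  refine le_trans (le_of_eq ?_) (hle.trans ?_)
  · refine Finset.sum_congr (by congr!) fun g _ => ?_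
    rw [Real.exp_sum, graphProb, ← Finset.prod_mul_distrib]
    refine Finset.prod_congr rfl fun i _ => ?_
    rw [Real.exp_sum, ← Finset.prod_mul_distrib]
    refine Finset.prod_congr rfl fun j _ => ?_
    simp only [hF, adjacency_apply, decide_eq_true_eq]
  · simp only [Finset.mul_sum, Real.exp_sum]
    refine Finset.prod_le_prod (fun i _ => Finset.prod_nonneg fun j _ =>
      add_nonneg (hF0 _ _ _) (hF0 _ _ _)) fun i _ => ?_
    refine Finset.prod_le_prod (fun j _ => add_nonneg (hF0 _ _ _) (hF0 _ _ _)) fun j _ => ?_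
    have h2 := bernoulli_mgf_le (h0 i j) ((ht i j).trans hc)
    have h3 : t i j ^ 2 ≤ c ^ 2 := by
      rw [← sq_abs (t i j)]
      have := ht i j
      have := abs_nonneg (t i j)
      gcongr
    simp only [hF, if_true, Bool.false_eq_true, if_false]
    refine h2.trans (Real.exp_le_exp.2 ?_)
    rw [mul_comm]
    exact mul_le_mul_of_nonneg_right h3 (h0 i j)

open Classical in
/-- The exponential moment of the cut norm of the centered adjacency matrix. -/
lemma sum_graphProb_mul_exp_cutNorm_le {Q : Matrix (Fin n) (Fin n) ℝ} (h0 : ∀ i j, 0 ≤ Q i j)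
    (h1 : ∀ i j, Q i j ≤ 1) (hs : Q.IsSymm) (hd : ∀ i, Q i i = 0) (hn : 0 < n) {l : ℝ}
    (hl0 : 0 ≤ l) (hl : l ≤ 1 / 2) :
    ∑ g : SimpleGraph (Fin n), graphProb Q g *
      Real.exp (l * (n ^ 2 * matrixCutNorm (adjacency g - Q))) ≤
    2 * 4 ^ n * Real.exp (2 * l ^ 2 * ∑ i, ∑ j, Q i j) := by
  have hn' : (0 : ℝ) < (n : ℝ) ^ 2 := by positivity
  -- The multiplicity of the unordered pair in `S × T`. It may be 2, and the moment generating
  -- function needs coefficients at most one: hence the restriction `l ≤ 1 / 2`.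
  set c : Finset (Fin n) × Finset (Fin n) → Fin n → Fin n → ℝ := fun ST i j =>
    (if i ∈ ST.1 ∧ j ∈ ST.2 then 1 else 0) + (if j ∈ ST.1 ∧ i ∈ ST.2 then 1 else 0) with hc
  have hc2 : ∀ ST i j, |c ST i j| ≤ 2 := by
    intro ST i j
    simp only [hc]
    split_ifs <;> norm_num
  have hX : ∀ (g : SimpleGraph (Fin n)) (S T : Finset (Fin n)),
      ∑ i ∈ S, ∑ j ∈ T, (adjacency g - Q) i j =
        ∑ i, ∑ j ∈ Finset.Ioi i, c (S, T) i j * (adjacency g i j - Q i j) := by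
    intro g S T
    have e1 : ∑ i ∈ S, ∑ j ∈ T, (adjacency g - Q) i j =
        ∑ i, ∑ j, if i ∈ S ∧ j ∈ T then (adjacency g - Q) i j else 0 := by
      simp only [ite_and, Finset.sum_ite_mem, Finset.univ_inter,
        Finset.sum_ite_irrel, Finset.sum_const_zero]
    rw [e1, sum_sum_eq_sum_Ioi]
    · refine Finset.sum_congr rfl fun i _ => Finset.sum_congr rfl fun j _ => ?_
      have e2 : (adjacency g - Q) j i = (adjacency g - Q) i j := by
        simp only [Matrix.sub_apply, adjacency_apply, g.adj_comm, hs.apply i j]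
      rw [e2]
      simp only [hc, Matrix.sub_apply]
      split_ifs <;> ring
    · intro i
      simp [adjacency_apply, hd]
  -- The exponential of a maximum is at most the sum of the exponentials over all `4 ^ n` pairs of
  -- sets and both signs.
  have hexp : ∀ g : SimpleGraph (Fin n),
      Real.exp (l * (n ^ 2 * matrixCutNorm (adjacency g - Q))) ≤
      ∑ ST : Finset (Fin n) × Finset (Fin n),
        (Real.exp (∑ i, ∑ j ∈ Finset.Ioi i, (l * c ST i j) * (adjacency g i j - Q i j)) +
         Real.exp (∑ i, ∑ j ∈ Finset.Ioi i, (-(l * c ST i j)) * (adjacency g i j - Q i j))) := by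
    intro g
    obtain ⟨S, T, hST⟩ := exists_matrixCutNorm_eq (adjacency g - Q)
    refine le_trans ?_ (Finset.single_le_sum (fun ST _ =>
      add_nonneg (Real.exp_pos _).le (Real.exp_pos _).le) (Finset.mem_univ (S, T)))
    rw [← hST, mul_div_cancel₀ _ hn'.ne', hX g S T]
    have e : ∀ a : ℝ, ∑ i, ∑ j ∈ Finset.Ioi i, (a * c (S, T) i j) * (adjacency g i j - Q i j) =
        a * ∑ i, ∑ j ∈ Finset.Ioi i, c (S, T) i j * (adjacency g i j - Q i j) := by
      intro a
      simp only [Finset.mul_sum, mul_assoc]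
    simp only [← neg_mul, e]
    rcases abs_cases (∑ i, ∑ j ∈ Finset.Ioi i, c (S, T) i j * (adjacency g i j - Q i j))
      with h | h
    · rw [h.1]; linarith [Real.exp_pos (-l * ∑ i, ∑ j ∈ Finset.Ioi i, c (S, T) i j *
        (adjacency g i j - Q i j))]
    · rw [h.1, mul_neg, ← neg_mul]
      linarith [Real.exp_pos (l * ∑ i, ∑ j ∈ Finset.Ioi i, c (S, T) i j *
        (adjacency g i j - Q i j))]
  have hQ : ∑ i, ∑ j, Q i j = 2 * ∑ i, ∑ j ∈ Finset.Ioi i, Q i j := by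
    rw [sum_sum_eq_sum_Ioi Q hd]
    simp only [hs.apply, ← two_mul, ← Finset.mul_sum]
  have hm : ∀ (ST : Finset (Fin n) × Finset (Fin n)) (a : ℝ), |a| = l →
      ∑ g : SimpleGraph (Fin n), graphProb Q g *
      Real.exp (∑ i, ∑ j ∈ Finset.Ioi i, (a * c ST i j) * (adjacency g i j - Q i j)) ≤
      Real.exp (2 * l ^ 2 * ∑ i, ∑ j, Q i j) := by
    intro ST a ha
    refine (sum_graphProb_mul_exp_le h0 h1 (fun i j => a * c ST i j) (2 * l) (by linarith)
      (fun i j => ?_)).trans (le_of_eq ?_)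
    · rw [abs_mul, ha, mul_comm]
      exact mul_le_mul_of_nonneg_right (hc2 _ _ _) hl0
    · rw [hQ]; ring_nf
  calc _ ≤ ∑ g : SimpleGraph (Fin n), graphProb Q g * ∑ ST : Finset (Fin n) × Finset (Fin n),
        (Real.exp (∑ i, ∑ j ∈ Finset.Ioi i, (l * c ST i j) * (adjacency g i j - Q i j)) +
         Real.exp (∑ i, ∑ j ∈ Finset.Ioi i, (-(l * c ST i j)) * (adjacency g i j - Q i j))) := by
        refine Finset.sum_le_sum fun g _ => ?_
        exact mul_le_mul_of_nonneg_left (hexp g) (graphProb_nonneg h0 h1 g)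
    _ = ∑ ST : Finset (Fin n) × Finset (Fin n), (∑ g : SimpleGraph (Fin n), graphProb Q g *
        Real.exp (∑ i, ∑ j ∈ Finset.Ioi i, (l * c ST i j) * (adjacency g i j - Q i j)) +
        ∑ g : SimpleGraph (Fin n), graphProb Q g *
        Real.exp (∑ i, ∑ j ∈ Finset.Ioi i, (-l * c ST i j) * (adjacency g i j - Q i j))) := by
        simp only [Finset.mul_sum]
        rw [Finset.sum_comm]
        refine Finset.sum_congr rfl fun ST _ => ?_
        rw [← Finset.sum_add_distrib]
        refine Finset.sum_congr rfl fun g _ => ?_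
        simp only [mul_add, neg_mul]
    _ ≤ ∑ ST : Finset (Fin n) × Finset (Fin n), 2 * Real.exp (2 * l ^ 2 * ∑ i, ∑ j, Q i j) := by
        refine Finset.sum_le_sum fun ST _ => ?_
        have a1 := hm ST l (abs_of_nonneg hl0)
        have a2 := hm ST (-l) (by rw [abs_neg, abs_of_nonneg hl0])
        linarith
    _ = _ := by
        rw [Finset.sum_const, nsmul_eq_mul, Finset.card_univ, Fintype.card_prod,
          Fintype.card_finset, Fintype.card_fin]
        push_cast
        rw [← mul_pow]
        norm_num
        ring

end RandomGraph

/-! ### Bounds conditional on the vertex positions. -/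

section Conditional

variable {Ω : Type u} [MeasurableSpace Ω] {π : Measure Ω} {n : ℕ}

lemma edgeProb_nonneg (W : Graphon Ω π) {ρ : ℝ} (hρ : 0 < ρ) (x : Fin n → Ω) (i j : Fin n) :
    0 ≤ edgeProb W ρ x i j := by
  unfold edgeProb
  split_ifs
  · rfl
  · exact le_min zero_le_one (mul_nonneg hρ.le (W.nonneg' _ _))

lemma edgeProb_le_one (W : Graphon Ω π) (ρ : ℝ) (x : Fin n → Ω) (i j : Fin n) :
    edgeProb W ρ x i j ≤ 1 := by
  unfold edgeProb
  split_ifs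
  · exact zero_le_one
  · exact min_le_left _ _

lemma edgeProb_isSymm (W : Graphon Ω π) (ρ : ℝ) (x : Fin n → Ω) : (edgeProb W ρ x).IsSymm := by
  ext i j
  simp only [Matrix.transpose_apply, edgeProb, W.symm' (x j) (x i), eq_comm (a := j)]

lemma edgeProb_self (W : Graphon Ω π) (ρ : ℝ) (x : Fin n → Ω) (i : Fin n) :
    edgeProb W ρ x i i = 0 := by simp [edgeProb]

lemma Graphon.measurable_comp (W : Graphon Ω π) {α : Type*} [MeasurableSpace α] {f g : α → Ω}
    (hf : Measurable f) (hg : Measurable g) : Measurable fun a => W.toFun (f a) (g a) :=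
  W.measurable'.comp (hf.prodMk hg)

lemma measurable_edgeProb (W : Graphon Ω π) (ρ : ℝ) (i j : Fin n) :
    Measurable fun x : Fin n → Ω => edgeProb W ρ x i j := by
  unfold edgeProb
  split_ifs
  · exact measurable_const
  · exact measurable_const.min
      ((W.measurable_comp (measurable_pi_apply i) (measurable_pi_apply j)).const_mul ρ)

lemma measurable_graphProb (W : Graphon Ω π) (ρ : ℝ) (g : SimpleGraph (Fin n)) :
    Measurable fun x : Fin n → Ω => graphProb (edgeProb W ρ x) g := by
  unfold graphProb
  refine Finset.measurable_prod _ fun i _ => Finset.measurable_prod _ fun j _ => ?_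
  split_ifs
  · exact measurable_edgeProb W ρ i j
  · exact measurable_const.sub (measurable_edgeProb W ρ i j)

lemma measurable_matrixCutNorm {α : Type*} [MeasurableSpace α]
    {M : α → Matrix (Fin n) (Fin n) ℝ} (hM : ∀ i j, Measurable fun a => M a i j) :
    Measurable fun a => matrixCutNorm (M a) := by
  unfold matrixCutNorm
  refine Measurable.iSup fun ST => ?_
  refine Measurable.div_const (Measurable.abs ?_) _
  exact Finset.measurable_sum _ fun i _ => Finset.measurable_sum _ fun j _ => hM i j

variable {Θ : Type v} [MeasurableSpace Θ] {P : Measure Θ}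

open Classical in
/-- A conditional Markov inequality for a `W`-random graph. -/
lemma IsWRandomGraph.measure_le {W : Graphon Ω π} {ρ : ℝ} {x : Fin n → Θ → Ω}
    {G : Θ → SimpleGraph (Fin n)} (hρ : 0 < ρ) (hx : ∀ i, Measurable (x i))
    (hG : IsWRandomGraph W ρ P x G)
    (F : SimpleGraph (Fin n) → (Fin n → Ω) → ℝ) (hF : ∀ g, Measurable (F g))
    (hF0 : ∀ g y, 0 ≤ F g y) (b : (Fin n → Ω) → ℝ)
    (hb : ∀ y, ∑ g, graphProb (edgeProb W ρ y) g * F g y ≤ b y) :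
    P {θ | 1 ≤ F (G θ) fun i => x i θ} ≤ ∫⁻ θ, ENNReal.ofReal (b fun i => x i θ) ∂P := by
  have hxm : Measurable fun θ i => x i θ := measurable_pi_lambda _ hx
  have h0 : ∀ (y : Fin n → Ω) (g : SimpleGraph (Fin n)), 0 ≤ graphProb (edgeProb W ρ y) g := fun y g =>
    graphProb_nonneg (edgeProb_nonneg W hρ y) (edgeProb_le_one W ρ y) g
  calc P {θ | 1 ≤ F (G θ) fun i => x i θ}
      ≤ P (⋃ g ∈ (Finset.univ : Finset (SimpleGraph (Fin n))),
          {θ | (fun i => x i θ) ∈ {y | 1 ≤ F g y} ∧ G θ = g}) := by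
        refine measure_mono fun θ hθ => ?_
        simp only [Set.mem_iUnion]
        exact ⟨G θ, Finset.mem_univ _, hθ, rfl⟩
    _ ≤ ∑ g, P {θ | (fun i => x i θ) ∈ {y | 1 ≤ F g y} ∧ G θ = g} :=
        measure_biUnion_finset_le _ _
    _ ≤ ∑ g, ∫⁻ θ, ENNReal.ofReal
          (graphProb (edgeProb W ρ fun i => x i θ) g * F g fun i => x i θ) ∂P := by
        refine Finset.sum_le_sum fun g _ => ?_
        have hm : MeasurableSet {y | 1 ≤ F g y} := measurableSet_le measurable_const (hF g)
        rw [(hG g).2 _ hm]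
        change ∫⁻ θ in (fun θ i => x i θ) ⁻¹' {y | 1 ≤ F g y}, _ ∂P ≤ _
        rw [← lintegral_indicator (hxm hm)]
        refine lintegral_mono fun θ => ?_
        by_cases hθ : θ ∈ (fun θ i => x i θ) ⁻¹' {y | 1 ≤ F g y}
        · rw [Set.indicator_of_mem hθ]
          exact ENNReal.ofReal_le_ofReal (le_mul_of_one_le_right (h0 _ _) hθ)
        · rw [Set.indicator_of_notMem hθ]
          exact zero_le
    _ = ∫⁻ θ, ∑ g, ENNReal.ofReal
          (graphProb (edgeProb W ρ fun i => x i θ) g * F g fun i => x i θ) ∂P := by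
        rw [lintegral_finsetSum]
        intro g _
        exact (((measurable_graphProb W ρ g).mul (hF g)).comp hxm).ennreal_ofReal
    _ ≤ _ := by
        refine lintegral_mono fun θ => ?_
        rw [← ENNReal.ofReal_sum_of_nonneg fun g _ => mul_nonneg (h0 _ _) (hF0 _ _)]
        exact ENNReal.ofReal_le_ofReal (hb _)

/-- Concentration of the adjacency matrix in the cut norm. -/
lemma IsWRandomGraph.measure_cutNorm_le [IsProbabilityMeasure P] {W : Graphon Ω π} {ρ : ℝ}
    {x : Fin n → Θ → Ω}
    {G : Θ → SimpleGraph (Fin n)} (hρ : 0 < ρ) (hn : 0 < n) (hx : ∀ i, Measurable (x i))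
    (hG : IsWRandomGraph W ρ P x G) {l : ℝ} (hl0 : 0 ≤ l) (hl : l ≤ 1 / 2) (τ : ℝ) :
    P {θ | τ + 2 * l ^ 2 * ∑ i, ∑ j, edgeProb W ρ (fun i => x i θ) i j ≤
      l * (n ^ 2 * matrixCutNorm (adjacency (G θ) - edgeProb W ρ fun i => x i θ))} ≤
      ENNReal.ofReal (2 * 4 ^ n * Real.exp (-τ)) := by
  classical
  -- The exponential moment bound depends on the positions through the sum of the edge
  -- probabilities. Subtracting this sum in the exponent makes the conditional expectation bounded
  -- by a constant.
  have h := hG.measure_le hρ hx (fun g y =>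
    Real.exp (l * (n ^ 2 * matrixCutNorm (adjacency g - edgeProb W ρ y)) -
      (τ + 2 * l ^ 2 * ∑ i, ∑ j, edgeProb W ρ y i j))) (by
      intro g
      refine Real.measurable_exp.comp (Measurable.sub ?_ ?_)
      · refine ((measurable_matrixCutNorm fun i j => ?_).const_mul _).const_mul _
        exact measurable_const.sub (measurable_edgeProb W ρ i j)
      · refine measurable_const.add (Measurable.const_mul ?_ _)
        exact Finset.measurable_sum _ fun i _ => Finset.measurable_sum _ fun j _ =>
          measurable_edgeProb W ρ i j)
    (fun _ _ => (Real.exp_pos _).le) (fun _ => 2 * 4 ^ n * Real.exp (-τ)) (by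
      intro y
      have h1 := sum_graphProb_mul_exp_cutNorm_le (edgeProb_nonneg W hρ y) (edgeProb_le_one W ρ y)
        (edgeProb_isSymm W ρ y) (edgeProb_self W ρ y) hn hl0 hl
      have h2 := mul_le_mul_of_nonneg_right h1
        (Real.exp_pos (-(τ + 2 * l ^ 2 * ∑ i, ∑ j, edgeProb W ρ y i j))).le
      rw [Finset.sum_mul] at h2
      refine le_trans (le_of_eq ?_) (h2.trans (le_of_eq ?_))
      · refine Finset.sum_congr rfl fun g _ => ?_
        rw [sub_eq_add_neg, Real.exp_add, ← mul_assoc]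
      · rw [mul_assoc, ← Real.exp_add]
        congr 2
        ring)
  rw [lintegral_const, measure_univ, mul_one] at h
  refine le_trans (measure_mono fun θ hθ => ?_) h
  exact Real.one_le_exp (sub_nonneg.2 hθ)

lemma n_sq_mul_matrixCutNorm_le (hn : 0 < n) (A : Matrix (Fin n) (Fin n) ℝ) :
    (n : ℝ) ^ 2 * matrixCutNorm A ≤ ∑ i, ∑ j, |A i j| := by
  have hn' : (0 : ℝ) < (n : ℝ) ^ 2 := by positivity
  have := matrixCutNorm_le_matrixL1 A
  unfold matrixL1 at this
  rw [le_div_iff₀ hn'] at this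
  linarith

/-- A first moment bound for the adjacency matrix in the cut norm. -/
lemma IsWRandomGraph.measure_cutNorm_le_mean {W : Graphon Ω π} {ρ : ℝ} {x : Fin n → Θ → Ω}
    {G : Θ → SimpleGraph (Fin n)} (hρ : 0 < ρ) (hn : 0 < n) (hx : ∀ i, Measurable (x i))
    (hG : IsWRandomGraph W ρ P x G) {t : ℝ} (ht : 0 < t) :
    P {θ | t ≤ n ^ 2 * matrixCutNorm (adjacency (G θ) - edgeProb W ρ fun i => x i θ)} ≤
      ∫⁻ θ, ENNReal.ofReal (2 * (∑ i, ∑ j, edgeProb W ρ (fun i => x i θ) i j) / t) ∂P := by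
  classical
  have h := hG.measure_le hρ hx (fun g y =>
    (∑ i, ∑ j, (adjacency g i j + edgeProb W ρ y i j)) / t) (by
      intro g
      refine Measurable.div_const ?_ _
      exact Finset.measurable_sum _ fun i _ => Finset.measurable_sum _ fun j _ =>
          measurable_const.add (measurable_edgeProb W ρ i j))
    (fun g y => div_nonneg (Finset.sum_nonneg fun i _ => Finset.sum_nonneg fun j _ =>
      add_nonneg (adjacency_nonneg g i j) (edgeProb_nonneg W hρ y i j)) ht.le)
    (fun y => 2 * (∑ i, ∑ j, edgeProb W ρ y i j) / t) (by
      intro y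
      have h1 := sum_graphProb_le_one (edgeProb_nonneg W hρ y) (edgeProb_le_one W ρ y)
      have h2 : ∀ i j, ∑ g, graphProb (edgeProb W ρ y) g *
          (adjacency g i j + edgeProb W ρ y i j) ≤ 2 * edgeProb W ρ y i j := by
        intro i j
        have e1 := sum_graphProb_mul_adjacency_le (edgeProb_nonneg W hρ y)
          (edgeProb_le_one W ρ y) (edgeProb_isSymm W ρ y) i j
        have e2 := mul_le_mul_of_nonneg_right h1 (edgeProb_nonneg W hρ y i j)
        rw [Finset.sum_mul, one_mul] at e2
        simp only [mul_add, Finset.sum_add_distrib]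
        linarith
      calc _ = (∑ i, ∑ j, ∑ g, graphProb (edgeProb W ρ y) g *
          (adjacency g i j + edgeProb W ρ y i j)) / t := by
            simp only [← mul_div_assoc, Finset.mul_sum, ← Finset.sum_div]
            congr 1
            rw [Finset.sum_comm]
            exact Finset.sum_congr rfl fun i _ => Finset.sum_comm
        _ ≤ _ := by
            rw [Finset.mul_sum]
            gcongr with i
            rw [Finset.mul_sum]
            gcongr with j
            exact h2 i j)
  refine le_trans (measure_mono fun θ hθ => ?_) h
  simp only [Set.mem_ofPred_eq] at hθ ⊢
  rw [le_div_iff₀ ht, one_mul]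
  refine hθ.trans ((n_sq_mul_matrixCutNorm_le hn _).trans ?_)
  gcongr with i _ j _
  rw [Matrix.sub_apply]
  refine (abs_sub _ _).trans ?_
  rw [abs_of_nonneg (adjacency_nonneg _ _ _), abs_of_nonneg (edgeProb_nonneg W hρ _ _ _)]

end Conditional

/-! ### Moments of i.i.d. samples. -/

section IID

variable {Ω : Type u} [MeasurableSpace Ω] {π : Measure Ω} {Θ : Type v} [MeasurableSpace Θ]
  {P : Measure Θ} {ι : Type}

lemma IsIIDSample.map_pair [IsProbabilityMeasure P] {x : ι → Θ → Ω} (h : IsIIDSample π P x)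
    {i j : ι} (hij : i ≠ j) : P.map (fun θ => (x i θ, x j θ)) = π.prod π := by
  have := (indepFun_iff_map_prod_eq_prod_map_map (h.1 i).aemeasurable (h.1 j).aemeasurable).1
    (h.2.1.indepFun hij)
  rw [this, h.2.2, h.2.2]

lemma IsIIDSample.integral_comp {x : ι → Θ → Ω} (h : IsIIDSample π P x) (i : ι) {f : Ω → ℝ}
    (hf : Measurable f) : ∫ θ, f (x i θ) ∂P = ∫ a, f a ∂π := by
  rw [← h.2.2 i, integral_map (h.1 i).aemeasurable hf.aestronglyMeasurable]

lemma IsIIDSample.integrable_comp {x : ι → Θ → Ω} (h : IsIIDSample π P x) (i : ι) {f : Ω → ℝ}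
    (hf : Integrable f π) : Integrable (fun θ => f (x i θ)) P := by
  rw [← h.2.2 i] at hf
  exact hf.comp_measurable (h.1 i)

lemma IsIIDSample.integral_pair [IsProbabilityMeasure P] {x : ι → Θ → Ω} (h : IsIIDSample π P x)
    {i j : ι} (hij : i ≠ j) {f : Ω × Ω → ℝ} (hf : Measurable f) :
    ∫ θ, f (x i θ, x j θ) ∂P = ∫ a, f a ∂(π.prod π) := by
  rw [← h.map_pair hij, integral_map ((h.1 i).prodMk (h.1 j)).aemeasurable
    hf.aestronglyMeasurable]

lemma IsIIDSample.integrable_pair [IsProbabilityMeasure P] {x : ι → Θ → Ω}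
    (h : IsIIDSample π P x) {i j : ι} (hij : i ≠ j) {f : Ω × Ω → ℝ}
    (hf : Integrable f (π.prod π)) : Integrable (fun θ => f (x i θ, x j θ)) P := by
  rw [← h.map_pair hij] at hf
  exact hf.comp_measurable ((h.1 i).prodMk (h.1 j))

lemma isIIDSample_pi [IsProbabilityMeasure π] [Fintype ι] :
    IsIIDSample π (Measure.pi fun _ : ι => π) (fun i y => y i) :=
  ⟨fun i => measurable_pi_apply i, iIndepFun_pi (X := fun _ a => a) fun _ => aemeasurable_id,
    fun i => (measurePreserving_eval (fun _ : ι => π) i).map_eq⟩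

lemma IsIIDSample.map_eq_pi [IsProbabilityMeasure P] [Fintype ι] {x : ι → Θ → Ω}
    (h : IsIIDSample π P x) : P.map (fun θ i => x i θ) = Measure.pi fun _ => π := by
  rw [(iIndepFun_iff_map_fun_eq_pi_map fun i => (h.1 i).aemeasurable).1 h.2.1]
  simp only [h.2.2]

/-- The second moment of the deviation of an empirical count. -/
lemma IsIIDSample.integral_count_sub_sq_le [IsProbabilityMeasure P] {n : ℕ} {x : Fin n → Θ → Ω}
    (h : IsIIDSample π P x) {A : Set Ω} (hA : MeasurableSet A) :
    ∫ θ, (∑ i, A.indicator (fun _ => (1 : ℝ)) (x i θ) - n * π.real A) ^ 2 ∂P ≤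
      n * π.real A := by
  have hm : Measurable (A.indicator fun _ => (1 : ℝ)) := measurable_const.indicator hA
  set X : Fin n → Θ → ℝ := fun i θ => A.indicator (fun _ => (1 : ℝ)) (x i θ) with hX
  have hXm : ∀ i, Measurable (X i) := fun i => hm.comp (h.1 i)
  have hX01 : ∀ i θ, 0 ≤ X i θ ∧ X i θ ≤ 1 := by
    intro i θ
    simp only [hX]
    by_cases hθ : x i θ ∈ A <;> simp [hθ]
  have hL : ∀ i, MemLp (X i) 2 P := fun i =>
    MemLp.of_bound (hXm i).aestronglyMeasurable 1 (Eventually.of_forall fun θ => by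
      rw [Real.norm_eq_abs, abs_of_nonneg (hX01 i θ).1]; exact (hX01 i θ).2)
  have hE : ∀ i, ∫ θ, X i θ ∂P = π.real A := by
    intro i
    rw [h.integral_comp i hm, integral_indicator_const _ hA]
    simp
  have hind : Set.Pairwise (Finset.univ : Finset (Fin n)) fun i j => IndepFun (X i) (X j) P := by
    intro i _ j _ hij
    exact (h.2.1.indepFun hij).comp hm hm
  have hvar := IndepFun.variance_sum (s := Finset.univ) (fun i _ => hL i) hind
  have hsum : ∫ θ, (∑ i, X i) θ ∂P = n * π.real A := by
    simp only [Finset.sum_apply]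
    rw [integral_finsetSum _ fun i _ => (hL i).integrable (by norm_num)]
    simp [hE]
  rw [variance_eq_integral (Finset.univ.aemeasurable_sum fun i _ => (hXm i).aemeasurable),
    hsum] at hvar
  simp only [Finset.sum_apply] at hvar
  rw [hvar]
  calc _ ≤ ∑ i : Fin n, π.real A := by
        refine Finset.sum_le_sum fun i _ => ?_
        refine (variance_le_expectation_sq (hXm i).aestronglyMeasurable).trans ?_
        rw [← hE i]
        refine integral_mono (hL i).integrable_sq ((hL i).integrable (by norm_num)) fun θ => ?_
        have := hX01 i θ
        simp only [Pi.pow_apply]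
        nlinarith
    _ = _ := by simp

end IID

/-! ### Fitting a block model to the edge probabilities. -/

section BalancedApproximation

variable {Ω : Type u} [MeasurableSpace Ω] {π : Measure Ω} {n : ℕ}

/-- The error of the block model `V` for the positions and blocks `y`, before balancing. -/
def blockFitError (W : Graphon Ω π) (ρ : ℝ) (V : BlockModel) (y : Fin n → Ω × Fin V.k) : ℝ :=
  (∑ u, ∑ v, (if u = v then 0 else
      |min (W.toFun (y u).1 (y v).1) ρ⁻¹ - V.B (y u).2 (y v).2|) +
    ∑ u, V.B (y u).2 (y u).2 +
    4 * ∑ i, ∑ j, classDeviation V.p (fun u => (y u).2) i *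
      (n * V.p j + classDeviation V.p (fun u => (y u).2) j) * V.B i j) / (n : ℝ) ^ 2

/-- The three parts of `blockFitError` are the off-diagonal error with the given labels, where
rescaling turns the edge probabilities into `min W ρ⁻¹`; the diagonal, where the edge probability is
zero; and the cost of rebalancing the labels. -/
lemma exists_isBalanced_matrixL1_le (W : Graphon Ω π) {ρ : ℝ} (hρ : 0 < ρ) (V : BlockModel)
    (y : Fin n → Ω × Fin V.k) :
    ∃ z : Fin n → Fin V.k, IsBalanced V.p z ∧
      matrixL1 ((1 / ρ) • edgeProb W ρ (fun u => (y u).1) - V.B.submatrix z z) ≤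
        blockFitError W ρ V y := by
  obtain ⟨z, hz, hzB⟩ := exists_isBalanced V.p V.p_nonneg V.p_sum V.B V.B_nonneg V.B_symm
    (fun u => (y u).2)
  refine ⟨z, hz, ?_⟩
  unfold matrixL1 blockFitError
  gcongr ?_ / _
  have h1 : ∀ u v, |((1 / ρ) • edgeProb W ρ (fun u => (y u).1) - V.B.submatrix z z) u v| ≤
      (if u = v then 0 else |min (W.toFun (y u).1 (y v).1) ρ⁻¹ - V.B (y u).2 (y v).2|) +
      (if u = v then V.B (y u).2 (y u).2 else 0) +
      |V.B (y u).2 (y v).2 - V.B (z u) (z v)| := by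
    intro u v
    simp only [Matrix.sub_apply, Matrix.smul_apply, Matrix.submatrix_apply, smul_eq_mul, edgeProb]
    split_ifs with h
    · subst h
      have := V.B_nonneg (y u).2 (y u).2
      have h2 := abs_sub_le (0 : ℝ) (V.B (y u).2 (y u).2) (V.B (z u) (z u))
      simp only [zero_sub, abs_neg, abs_of_nonneg this] at h2
      simpa using h2
    · have h2 : 1 / ρ * min 1 (ρ * W.toFun (y u).1 (y v).1) =
          min (W.toFun (y u).1 (y v).1) ρ⁻¹ := by
        rw [mul_min_of_nonneg _ _ (by positivity), min_comm]
        congr 1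
        · field_simp
        · simp
      rw [h2, add_zero]
      exact abs_sub_le _ _ _
  calc _ ≤ ∑ u, ∑ v, ((if u = v then 0 else
        |min (W.toFun (y u).1 (y v).1) ρ⁻¹ - V.B (y u).2 (y v).2|) +
      (if u = v then V.B (y u).2 (y u).2 else 0) +
      |V.B (y u).2 (y v).2 - V.B (z u) (z v)|) := by
        gcongr with u _ v _
        exact h1 u v
    _ ≤ _ := by
        simp only [Finset.sum_add_distrib]
        gcongr
        simp

variable {κ : ℝ}

/-- By `(a + 1) ^ 2 ≤ 2 a ^ 2 + 2`, the binomial variance bound `n p_i` gives `2 n p_i + 2`, and the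
room for rounding is absorbed since `n p_i ≥ 1`. -/
lemma integral_classDeviation_sq_le [IsProbabilityMeasure π] (V : BlockModel)
    {ν : Measure (Ω × Fin V.k)} (hν : IsCoupling π V.measure ν) (i : Fin V.k)
    (hi : 1 ≤ n * V.p i) :
    ∫ y : Fin n → Ω × Fin V.k, classDeviation V.p (fun u => (y u).2) i ^ 2
      ∂(Measure.pi fun _ => ν) ≤ 4 * (n * V.p i) := by
  have := hν.isProbabilityMeasure
  have hA : MeasurableSet (Prod.snd ⁻¹' {i} : Set (Ω × Fin V.k)) :=
    measurable_snd (MeasurableSet.singleton i)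
  have hνi : ν.real (Prod.snd ⁻¹' {i}) = V.p i := by
    rw [measureReal_def, ← Measure.map_apply measurable_snd (MeasurableSet.singleton i), hν.2,
      V.measure_singleton, ENNReal.toReal_ofReal (V.p_nonneg i)]
  have h := (isIIDSample_pi (π := ν) (ι := Fin n)).integral_count_sub_sq_le hA
  rw [hνi] at h
  have hcount : ∀ y : Fin n → Ω × Fin V.k,
      ∑ u, (Prod.snd ⁻¹' {i} : Set (Ω × Fin V.k)).indicator (fun _ => (1 : ℝ)) (y u) =
        ((partClass (fun u => (y u).2) i).card : ℝ) := by
    intro y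
    rw [partClass, Finset.card_filter]
    push_cast
    refine Finset.sum_congr rfl fun u _ => ?_
    by_cases hu : (y u).2 = i
    · rw [Set.indicator_of_mem (by exact hu), if_pos hu]
    · rw [Set.indicator_of_notMem (by exact hu), if_neg hu]
  simp only [hcount] at h
  have hm : Measurable fun y : Fin n → Ω × Fin V.k => fun u => (y u).2 := by fun_prop
  have hint : ∀ φ : (Fin n → Fin V.k) → ℝ, Integrable (fun y : Fin n → Ω × Fin V.k =>
      φ fun u => (y u).2) (Measure.pi fun _ => ν) := fun φ =>
    (Integrable.of_finite (f := φ)).comp_measurable hm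
  calc _ ≤ ∫ y : Fin n → Ω × Fin V.k, (2 * (((partClass (fun u => (y u).2) i).card : ℝ) -
        n * V.p i) ^ 2 + 2) ∂(Measure.pi fun _ => ν) := by
        refine integral_mono (hint fun w => classDeviation V.p w i ^ 2)
          (hint fun w => 2 * (((partClass w i).card : ℝ) - n * V.p i) ^ 2 + 2) fun y => ?_
        simp only [classDeviation]
        rw [← sq_abs (((partClass (fun u => (y u).2) i).card : ℝ) - n * V.p i)]
        nlinarith [sq_nonneg (|((partClass (fun u => (y u).2) i).card : ℝ) - n * V.p i| - 1)]
    _ = 2 * ∫ y : Fin n → Ω × Fin V.k, (((partClass (fun u => (y u).2) i).card : ℝ) -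
        n * V.p i) ^ 2 ∂(Measure.pi fun _ => ν) + 2 := by
        rw [integral_add (hint fun w => 2 * (((partClass w i).card : ℝ) - n * V.p i) ^ 2)
          (integrable_const _), integral_const_mul]
        simp
    _ ≤ 4 * (n * V.p i) := by linarith

/-- The expected error of a block model with large blocks. -/
lemma integral_blockFitError_le [IsProbabilityMeasure π] (W : Graphon Ω π) {ρ : ℝ}
    (V : BlockModel) (hκ : 0 < κ) (hV : ∀ i, κ ≤ V.p i)
    (hn : 0 < n) (hκn : 1 ≤ κ * n) {ν : Measure (Ω × Fin V.k)} (hν : IsCoupling π V.measure ν) :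
    Integrable (blockFitError (n := n) W ρ V) (Measure.pi fun _ => ν) ∧
    ∫ y, blockFitError (n := n) W ρ V y ∂(Measure.pi fun _ => ν) ≤
      W.tail ρ + ∫ a : (Ω × Fin V.k) × (Ω × Fin V.k),
        |W.toFun a.1.1 a.2.1 - V.B a.1.2 a.2.2| ∂(ν.prod ν) +
      25 * (∑ i, ∑ j, V.p i * V.p j * V.B i j) * √(1 / (κ * n)) := by
  have hνp := hν.isProbabilityMeasure
  have hn' : (0 : ℝ) < n := by exact_mod_cast hn
  have hn2 : (0 : ℝ) < (n : ℝ) ^ 2 := by positivity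
  set P' : Measure (Fin n → Ω × Fin V.k) := Measure.pi fun _ => ν with hP'
  have hiid : IsIIDSample ν P' (fun i y => y i) := isIIDSample_pi
  have hm : Measurable fun y : Fin n → Ω × Fin V.k => fun u => (y u).2 := by fun_prop
  have hint : ∀ φ : (Fin n → Fin V.k) → ℝ, Integrable (fun y : Fin n → Ω × Fin V.k =>
      φ fun u => (y u).2) P' := fun φ => (Integrable.of_finite (f := φ)).comp_measurable hm
  set β := ∑ i, ∑ j, V.p i * V.p j * V.B i j with hβ
  set r := √(1 / (κ * n)) with hr
  have hr0 : 0 < r := Real.sqrt_pos.2 (by positivity)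
  have hr1 : r ≤ 1 := by
    have h : 1 / (κ * n) ≤ 1 := by rw [div_le_one (by positivity)]; exact hκn
    exact (Real.sqrt_le_sqrt h).trans Real.sqrt_one.le
  have hr2 : r ^ 2 = 1 / (κ * n) := Real.sq_sqrt (by positivity)
  have hp : ∀ i, 0 < V.p i := fun i => hκ.trans_le (hV i)
  have hnp : ∀ i, 1 ≤ n * V.p i := fun i => hκn.trans (by
    rw [mul_comm]; exact mul_le_mul_of_nonneg_left (hV i) hn'.le)
  have hWm : Measurable fun a : (Ω × Fin V.k) × (Ω × Fin V.k) => W.toFun a.1.1 a.2.1 :=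
    W.measurable_comp (by fun_prop) (by fun_prop)
  have hBm : Measurable fun a : (Ω × Fin V.k) × (Ω × Fin V.k) => V.B a.1.2 a.2.2 :=
    (measurable_of_countable (fun x : Fin V.k × Fin V.k => V.B x.1 x.2)).comp
      (by fun_prop : Measurable fun a : (Ω × Fin V.k) × (Ω × Fin V.k) => (a.1.2, a.2.2))
  have hmap : (ν.prod ν).map (fun a => (a.1.1, a.2.1)) = π.prod π := by
    conv_rhs => rw [← hν.1, Measure.map_prod_map _ _ measurable_fst measurable_fst]
    rfl
  have hWi : Integrable (fun a : (Ω × Fin V.k) × (Ω × Fin V.k) => W.toFun a.1.1 a.2.1)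
      (ν.prod ν) := by
    have hW := W.integrable'
    rw [← hmap] at hW
    exact hW.comp_measurable (by fun_prop)
  have hBi : Integrable (fun a : (Ω × Fin V.k) × (Ω × Fin V.k) => V.B a.1.2 a.2.2) (ν.prod ν) :=
    integrable_prod_comp_finite ν ν measurable_snd V.B
  have hmini : Integrable (fun a : (Ω × Fin V.k) × (Ω × Fin V.k) =>
      min (W.toFun a.1.1 a.2.1) ρ⁻¹) (ν.prod ν) := hWi.inf (integrable_const _)
  set f : (Ω × Fin V.k) × (Ω × Fin V.k) → ℝ := fun a =>
    |min (W.toFun a.1.1 a.2.1) ρ⁻¹ - V.B a.1.2 a.2.2| with hf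
  have hfi : Integrable f (ν.prod ν) := (hmini.sub hBi).abs
  have hfm : Measurable f := ((hWm.min measurable_const).sub hBm).abs
  have hfle : ∫ a, f a ∂(ν.prod ν) ≤ W.tail ρ + ∫ a : (Ω × Fin V.k) × (Ω × Fin V.k),
        |W.toFun a.1.1 a.2.1 - V.B a.1.2 a.2.2| ∂(ν.prod ν) := by
    have htail : W.tail ρ = ∫ a : (Ω × Fin V.k) × (Ω × Fin V.k),
        |W.toFun a.1.1 a.2.1 - min (W.toFun a.1.1 a.2.1) ρ⁻¹| ∂(ν.prod ν) := by
      rw [Graphon.tail, ← hmap, integral_map (by fun_prop)]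
      exact ((W.measurable'.sub (W.measurable'.min measurable_const)).abs).aestronglyMeasurable
    rw [htail, ← integral_add
      (f := fun a : (Ω × Fin V.k) × (Ω × Fin V.k) =>
        |W.toFun a.1.1 a.2.1 - min (W.toFun a.1.1 a.2.1) ρ⁻¹|)
      (g := fun a : (Ω × Fin V.k) × (Ω × Fin V.k) => |W.toFun a.1.1 a.2.1 - V.B a.1.2 a.2.2|)
      (hWi.sub hmini).abs (hWi.sub hBi).abs]
    refine integral_mono hfi ((hWi.sub hmini).abs.add (hWi.sub hBi).abs) fun a => ?_
    simp only [hf]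
    rw [abs_sub_comm (W.toFun a.1.1 a.2.1) (min _ _)]
    exact abs_sub_le _ _ _
  have hf0 : 0 ≤ ∫ a, f a ∂(ν.prod ν) := integral_nonneg fun a => abs_nonneg _
  -- the three contributions
  have i1 : ∀ u v, Integrable (fun y : Fin n → Ω × Fin V.k =>
      if u = v then 0 else f (y u, y v)) P' := by
    intro u v
    split_ifs with h
    · exact integrable_zero _ _ _
    · exact hiid.integrable_pair h hfi
  have i1' : Integrable (fun y : Fin n → Ω × Fin V.k =>
      ∑ u, ∑ v, if u = v then 0 else f (y u, y v)) P' :=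
    integrable_finsetSum _ fun u _ => integrable_finsetSum _ fun v _ => i1 u v
  have i2 := hint fun w => ∑ u, V.B (w u) (w u)
  have i3 := hint fun w => 4 * ∑ i, ∑ j, classDeviation V.p w i *
      (n * V.p j + classDeviation V.p w j) * V.B i j
  have e1 : ∫ y : Fin n → Ω × Fin V.k, (∑ u, ∑ v, if u = v then 0 else f (y u, y v)) ∂P' ≤
      n ^ 2 * ∫ a, f a ∂(ν.prod ν) := by
    rw [integral_finsetSum _ fun u _ => integrable_finsetSum _ fun v _ => i1 u v]
    calc _ ≤ ∑ u : Fin n, ∑ v : Fin n, ∫ a, f a ∂(ν.prod ν) := by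
          refine Finset.sum_le_sum fun u _ => ?_
          rw [integral_finsetSum _ fun v _ => i1 u v]
          refine Finset.sum_le_sum fun v _ => ?_
          split_ifs with h
          · simpa using hf0
          · rw [hiid.integral_pair h hfm]
      _ = _ := by simp; ring
  have hpB : ∀ i j, 0 ≤ V.p i * V.p j * V.B i j := fun i j =>
    mul_nonneg (mul_nonneg (hp i).le (hp j).le) (V.B_nonneg i j)
  have hβ0 : 0 ≤ β := Finset.sum_nonneg fun i _ => Finset.sum_nonneg fun j _ => hpB i j
  have e2 : ∫ y : Fin n → Ω × Fin V.k, ∑ u, V.B (y u).2 (y u).2 ∂P' ≤ n ^ 2 * (β * r) := by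
    -- The diagonal entries are not controlled by `β` alone, but `p_i B_ii ≤ p_i ^ 2 B_ii / κ` since
    -- `p_i ≥ κ`.
    have hd : ∀ u, ∫ y : Fin n → Ω × Fin V.k, V.B (y u).2 (y u).2 ∂P' ≤ β / κ := by
      intro u
      have hmB : Measurable fun a : Fin V.k => V.B a a := measurable_of_countable _
      rw [hiid.integral_comp u (f := fun a => V.B a.2 a.2) (hmB.comp measurable_snd)]
      have : ∫ a, V.B a.2 a.2 ∂ν = ∫ i, V.B i i ∂V.measure := by
        rw [← hν.2, integral_map measurable_snd.aemeasurable hmB.aestronglyMeasurable]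
      rw [this, integral_fintype Integrable.of_finite, le_div_iff₀ hκ, Finset.sum_mul]
      refine Finset.sum_le_sum fun i _ => ?_
      rw [measureReal_def, V.measure_singleton, ENNReal.toReal_ofReal (V.p_nonneg i), smul_eq_mul]
      refine le_trans ?_ (Finset.single_le_sum (fun j _ => hpB i j) (Finset.mem_univ i))
      have h1 := V.B_nonneg i i
      have h2 := mul_le_mul_of_nonneg_left (hV i) (mul_nonneg (hp i).le h1)
      linarith
    rw [integral_finsetSum _ fun u _ => hint fun w => V.B (w u) (w u)]
    calc _ ≤ ∑ u : Fin n, β / κ := Finset.sum_le_sum fun u _ => hd u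
      _ = n ^ 2 * (β * r ^ 2) := by
          rw [hr2]; simp; field_simp
      _ ≤ n ^ 2 * (β * r) := by
          gcongr
          nlinarith
  have e3 : ∫ y : Fin n → Ω × Fin V.k, 4 * ∑ i, ∑ j, classDeviation V.p (fun u => (y u).2) i *
      (n * V.p j + classDeviation V.p (fun u => (y u).2) j) * V.B i j ∂P' ≤
      n ^ 2 * (24 * β * r) := by
    set D : (Fin n → Ω × Fin V.k) → Fin V.k → ℝ := fun y i =>
      classDeviation V.p (fun u => (y u).2) i with hD
    have hD2 : ∀ i, ∫ y, D y i ^ 2 ∂P' ≤ 4 * (n * V.p i) := fun i =>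
      integral_classDeviation_sq_le V hν i (hnp i)
    have hDi : ∀ i, Integrable (fun y => D y i ^ 2) P' := fun i =>
      hint fun w => classDeviation V.p w i ^ 2
    have hDi1 : ∀ i, Integrable (fun y => D y i) P' := fun i =>
      hint fun w => classDeviation V.p w i
    have hDDi : ∀ i j, Integrable (fun y => D y i * D y j) P' := fun i j =>
      hint fun w => classDeviation V.p w i * classDeviation V.p w j
    -- `s i` bounds the `L²` norm of `D · i`. The estimates `hD1` and `hDD` are Cauchy–Schwarz,
    -- obtained from squares of differences with these weights.
    set s : Fin V.k → ℝ := fun i => 2 * √(n * V.p i) with hs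
    have hs0 : ∀ i, 0 < s i := fun i => by
      have := hnp i
      simp only [hs]; positivity
    have hs2 : ∀ i, s i ^ 2 = 4 * (n * V.p i) := fun i => by
      simp only [hs]; rw [mul_pow, Real.sq_sqrt (by have := hnp i; linarith)]; norm_num
    have hD1 : ∀ i, ∫ y, D y i ∂P' ≤ s i := by
      intro i
      calc _ ≤ ∫ y, (1 / (2 * s i) * D y i ^ 2 + s i / 2) ∂P' := by
            refine integral_mono (hDi1 i) (((hDi i).const_mul _).add (integrable_const _))
              fun y => ?_
            have := sq_nonneg (D y i - s i)
            have h0 := hs0 i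
            rw [← sub_nonneg]
            have : 1 / (2 * s i) * D y i ^ 2 + s i / 2 - D y i =
                (D y i - s i) ^ 2 / (2 * s i) := by field_simp; ring
            simp only [this]
            positivity
        _ = 1 / (2 * s i) * ∫ y, D y i ^ 2 ∂P' + s i / 2 := by
            rw [integral_add ((hDi i).const_mul _) (integrable_const _), integral_const_mul]
            simp
        _ ≤ 1 / (2 * s i) * s i ^ 2 + s i / 2 := by
            rw [hs2]
            have := hs0 i
            have := hD2 i
            gcongr
        _ = s i := by have := hs0 i; field_simp; norm_num
    have hDD : ∀ i j, ∫ y, D y i * D y j ∂P' ≤ s i * s j := by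
      intro i j
      have h0 := hs0 i
      have h0' := hs0 j
      calc _ ≤ ∫ y, (s j / (2 * s i) * D y i ^ 2 + s i / (2 * s j) * D y j ^ 2) ∂P' := by
            refine integral_mono (hDDi i j) (((hDi i).const_mul _).add ((hDi j).const_mul _))
              fun y => ?_
            rw [← sub_nonneg]
            have : s j / (2 * s i) * D y i ^ 2 + s i / (2 * s j) * D y j ^ 2 - D y i * D y j =
                (s j * D y i - s i * D y j) ^ 2 / (2 * s i * s j) := by field_simp; ring
            simp only [this]
            positivity
        _ = s j / (2 * s i) * ∫ y, D y i ^ 2 ∂P' + s i / (2 * s j) * ∫ y, D y j ^ 2 ∂P' := by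
            rw [integral_add ((hDi i).const_mul _) ((hDi j).const_mul _), integral_const_mul,
              integral_const_mul]
        _ ≤ s j / (2 * s i) * s i ^ 2 + s i / (2 * s j) * s j ^ 2 := by
            rw [hs2, hs2]
            have := hD2 i
            have := hD2 j
            gcongr
        _ = s i * s j := by field_simp; norm_num
    -- Relative to its mean `n p_i`, a class size fluctuates by at most the order of `r`, as `p_i ≥
    -- κ`. With `r ≤ 1`, the linear and quadratic terms below add up to `6 r`.
    have hsr : ∀ i, s i ≤ n * V.p i * (2 * r) := by
      intro i
      have h1 : (s i) ^ 2 ≤ (n * V.p i * (2 * r)) ^ 2 := by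
        rw [hs2, mul_pow, mul_pow, mul_pow, hr2]
        have h2 : κ * n ≤ n * V.p i := by
          rw [mul_comm]; exact mul_le_mul_of_nonneg_left (hV i) hn'.le
        have h3 : 1 ≤ (n * V.p i) * (1 / (κ * n)) := by
          rw [mul_one_div, one_le_div (by positivity)]; exact h2
        have h4 := hnp i
        nlinarith
      exact le_of_sq_le_sq h1 (by have := hnp i; positivity)
    have hterm : ∀ i j, ∫ y, D y i * (n * V.p j + D y j) ∂P' ≤
        n ^ 2 * (6 * r) * (V.p i * V.p j) := by
      intro i j
      have h1 : ∫ y, D y i * (n * V.p j + D y j) ∂P' =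
          (∫ y, D y i ∂P') * (n * V.p j) + ∫ y, D y i * D y j ∂P' := by
        simp only [mul_add]
        rw [integral_add ((hDi1 i).mul_const _) (hDDi i j), integral_mul_const]
      rw [h1]
      have hj := hnp j
      have hi := hnp i
      calc _ ≤ s i * (n * V.p j) + s i * s j := by
            have := hD1 i
            have := hDD i j
            gcongr
        _ ≤ (n * V.p i * (2 * r)) * (n * V.p j) +
            (n * V.p i * (2 * r)) * (n * V.p j * (2 * r)) := by
            have := hsr i
            have := hsr j
            have := hs0 j
            gcongr
        _ ≤ (n * V.p i * (2 * r)) * (n * V.p j) +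
            (n * V.p i * (2 * r)) * (n * V.p j * (2 * 1)) := by
            gcongr
        _ = _ := by ring
    rw [integral_const_mul, integral_finsetSum _ fun i _ => hint fun w =>
      ∑ j, classDeviation V.p w i * (n * V.p j + classDeviation V.p w j) * V.B i j]
    calc _ ≤ 4 * ∑ i, ∑ j, n ^ 2 * (6 * r) * (V.p i * V.p j) * V.B i j := by
          gcongr with i
          rw [integral_finsetSum _ fun j _ => hint fun w =>
            classDeviation V.p w i * (n * V.p j + classDeviation V.p w j) * V.B i j]
          gcongr with j
          rw [integral_mul_const]
          exact mul_le_mul_of_nonneg_right (hterm i j) (V.B_nonneg i j)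
      _ = _ := by
          rw [hβ]
          simp only [Finset.mul_sum, Finset.sum_mul]
          refine Finset.sum_congr rfl fun i _ => Finset.sum_congr rfl fun j _ => by ring
  have itot := ((i1'.add i2).add i3).div_const ((n : ℝ) ^ 2)
  refine ⟨itot, ?_⟩
  have hdef : ∀ y, blockFitError W ρ V y = ((∑ u, ∑ v, if u = v then 0 else f (y u, y v)) +
      ∑ u, V.B (y u).2 (y u).2 +
      4 * ∑ i, ∑ j, classDeviation V.p (fun u => (y u).2) i *
        (n * V.p j + classDeviation V.p (fun u => (y u).2) j) * V.B i j) / (n : ℝ) ^ 2 :=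
    fun y => rfl
  simp only [hdef]
  rw [integral_div, integral_add (f := fun y : Fin n → Ω × Fin V.k =>
      (∑ u, ∑ v, if u = v then 0 else f (y u, y v)) + ∑ u, V.B (y u).2 (y u).2)
    (i1'.add i2) i3, integral_add i1' i2, div_le_iff₀ hn2]
  nlinarith [e1, e2, e3, hfle]

end BalancedApproximation

/-! ### Bounds in probability for the fit and for the cut norm. -/

section FirstMoment

variable {Ω : Type u} [MeasurableSpace Ω] {π : Measure Ω} {Θ : Type v} [MeasurableSpace Θ]
  {P : Measure Θ} {n : ℕ}

lemma measurable_matrixL1 {α : Type*} [MeasurableSpace α]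
    {M : α → Matrix (Fin n) (Fin n) ℝ} (hM : ∀ i j, Measurable fun a => M a i j) :
    Measurable fun a => matrixL1 (M a) := by
  unfold matrixL1
  exact (Finset.measurable_sum _ fun i _ => Finset.measurable_sum _ fun j _ =>
    (hM i j).abs).div_const _

/-- With high probability some balanced partition fits the edge probabilities well. -/
lemma measure_forall_balanced_le [IsProbabilityMeasure π] [IsProbabilityMeasure P]
    (W : Graphon Ω π) {ρ κ : ℝ} (hρ : 0 < ρ) (V : BlockModel) (hκ : 0 < κ)
    (hV : ∀ i, κ ≤ V.p i) (hn : 0 < n) (hκn : 1 ≤ κ * n) {ν : Measure (Ω × Fin V.k)}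
    (hν : IsCoupling π V.measure ν) {x : Fin n → Θ → Ω} (hx : IsIIDSample π P x) {t : ℝ}
    (ht : 0 < t) :
    P {θ | ∀ z : Fin n → Fin V.k, IsBalanced V.p z → t ≤
      matrixL1 ((1 / ρ) • edgeProb W ρ (fun i => x i θ) - V.B.submatrix z z)} ≤
    ENNReal.ofReal ((W.tail ρ + ∫ a : (Ω × Fin V.k) × (Ω × Fin V.k),
        |W.toFun a.1.1 a.2.1 - V.B a.1.2 a.2.2| ∂(ν.prod ν) +
      25 * (∑ i, ∑ j, V.p i * V.p j * V.B i j) * √(1 / (κ * n))) / t) := by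
  have hνp := hν.isProbabilityMeasure
  obtain ⟨hint, hle⟩ := integral_blockFitError_le W (ρ := ρ) V hκ hV hn hκn hν
  set E : Set (Fin n → Ω) := {y | ∀ z : Fin n → Fin V.k, IsBalanced V.p z → t ≤
      matrixL1 ((1 / ρ) • edgeProb W ρ y - V.B.submatrix z z)} with hE
  have hEm : MeasurableSet E := by
    have : E = ⋂ z : Fin n → Fin V.k, ⋂ _ : IsBalanced V.p z,
        {y | t ≤ matrixL1 ((1 / ρ) • edgeProb W ρ y - V.B.submatrix z z)} := by
      ext y
      simp only [hE, Set.mem_iInter]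
      rfl
    rw [this]
    refine MeasurableSet.iInter fun z => MeasurableSet.iInter fun _ => ?_
    refine measurableSet_le measurable_const (measurable_matrixL1 fun i j => ?_)
    exact ((measurable_edgeProb W ρ i j).const_mul (1 / ρ)).sub measurable_const
  -- The event involves only the positions, so its probability can be computed on the product of
  -- copies of `ν`, where block labels are available.
  have h1 : P {θ | ∀ z : Fin n → Fin V.k, IsBalanced V.p z → t ≤
      matrixL1 ((1 / ρ) • edgeProb W ρ (fun i => x i θ) - V.B.submatrix z z)} =
      (Measure.pi fun _ : Fin n => π) E := by
    rw [← hx.map_eq_pi, Measure.map_apply (measurable_pi_lambda _ hx.1) hEm]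
    rfl
  have hmap : (Measure.pi fun _ : Fin n => ν).map (fun y i => (y i).1) =
      Measure.pi fun _ : Fin n => π := by
    rw [Measure.pi_map_pi (μ := fun _ : Fin n => ν) (f := fun _ => Prod.fst)
      fun _ => measurable_fst.aemeasurable]
    simp only [hν.1]
  have hm : Measurable fun y : Fin n → Ω × Fin V.k => fun i => (y i).1 := by fun_prop
  rw [h1, ← hmap, Measure.map_apply hm hEm]
  have h2 : (fun y : Fin n → Ω × Fin V.k => fun i => (y i).1) ⁻¹' E ⊆
      {y | t ≤ blockFitError W ρ V y} := by
    intro y hy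
    obtain ⟨z, hz, hzle⟩ := exists_isBalanced_matrixL1_le W hρ V y
    exact (hy z hz).trans hzle
  refine (measure_mono h2).trans ?_
  have h0 : 0 ≤ᵐ[Measure.pi fun _ : Fin n => ν] blockFitError W ρ V :=
    Eventually.of_forall fun y => by
      obtain ⟨z, hz, hzle⟩ := exists_isBalanced_matrixL1_le W hρ V y
      exact (matrixL1_nonneg _).trans hzle
  have hmk := mul_meas_ge_le_integral_of_nonneg h0 hint t
  rw [← ofReal_measureReal]
  refine ENNReal.ofReal_le_ofReal ?_
  rw [le_div_iff₀ ht, mul_comm]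
  exact hmk.trans hle

lemma edgeProb_le (W : Graphon Ω π) (ρ : ℝ) (x : Fin n → Ω) (i j : Fin n) :
    edgeProb W ρ x i j ≤ ρ * (if i = j then 0 else W.toFun (x i) (x j)) := by
  unfold edgeProb
  split_ifs
  · simp
  · exact min_le_right _ _

/-- The expected sum of the edge probabilities. -/
lemma lintegral_sum_edgeProb_le [IsProbabilityMeasure P] (W : Graphon Ω π) (hW : W.Normalized)
    {ρ : ℝ} (hρ : 0 < ρ) {x : Fin n → Θ → Ω} (hx : IsIIDSample π P x) {c : ℝ} (hc : 0 ≤ c) :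
    ∫⁻ θ, ENNReal.ofReal (c * ∑ i, ∑ j, edgeProb W ρ (fun i => x i θ) i j) ∂P ≤
      ENNReal.ofReal (c * (ρ * n ^ 2)) := by
  have hW1 : ∫ z : Ω × Ω, W.toFun z.1 z.2 ∂(π.prod π) = 1 := by
    rw [← hW]
    exact integral_congr_ae (Eventually.of_forall fun z => (abs_of_nonneg (W.nonneg' _ _)).symm)
  have hi : ∀ i j, Integrable (fun θ => if i = j then 0 else W.toFun (x i θ) (x j θ)) P := by
    intro i j
    split_ifs with h
    · exact integrable_zero _ _ _
    · exact hx.integrable_pair h W.integrable'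
  have hI : Integrable (fun θ => c * (ρ * ∑ i, ∑ j,
      if i = j then 0 else W.toFun (x i θ) (x j θ))) P :=
    ((integrable_finsetSum _ fun i _ => integrable_finsetSum _ fun j _ => hi i j).const_mul
      ρ).const_mul c
  have hE : ∫ θ, c * (ρ * ∑ i, ∑ j, if i = j then 0 else W.toFun (x i θ) (x j θ)) ∂P ≤
      c * (ρ * n ^ 2) := by
    rw [integral_const_mul, integral_const_mul,
      integral_finsetSum _ fun i _ => integrable_finsetSum _ fun j _ => hi i j]
    gcongr
    calc _ ≤ ∑ i : Fin n, ∑ j : Fin n, (1 : ℝ) := by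
          refine Finset.sum_le_sum fun i _ => ?_
          rw [integral_finsetSum _ fun j _ => hi i j]
          refine Finset.sum_le_sum fun j _ => ?_
          split_ifs with h
          · simp
          · rw [hx.integral_pair h W.measurable', hW1]
      _ = n ^ 2 := by simp; ring
  refine le_trans ?_ (ENNReal.ofReal_le_ofReal hE)
  rw [ofReal_integral_eq_lintegral_ofReal hI]
  · refine lintegral_mono fun θ => ENNReal.ofReal_le_ofReal ?_
    simp only [Finset.mul_sum]
    refine Finset.sum_le_sum fun i _ => Finset.sum_le_sum fun j _ => ?_
    exact mul_le_mul_of_nonneg_left (edgeProb_le W ρ _ i j) hc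
  · refine Eventually.of_forall fun θ => mul_nonneg hc (mul_nonneg hρ.le
      (Finset.sum_nonneg fun i _ => Finset.sum_nonneg fun j _ => ?_))
    split_ifs
    · exact le_rfl
    · exact W.nonneg' _ _

lemma measure_sum_edgeProb_ge_le [IsProbabilityMeasure P] (W : Graphon Ω π) (hW : W.Normalized)
    {ρ : ℝ} (hρ : 0 < ρ) {x : Fin n → Θ → Ω} (hx : IsIIDSample π P x) {c : ℝ} (hc : 0 ≤ c) :
    P {θ | 1 ≤ c * ∑ i, ∑ j, edgeProb W ρ (fun i => x i θ) i j} ≤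
      ENNReal.ofReal (c * (ρ * n ^ 2)) := by
  refine le_trans ?_ (lintegral_sum_edgeProb_le W hW hρ hx hc)
  have hxm : Measurable fun θ i => x i θ := measurable_pi_lambda _ hx.1
  have hm : Measurable fun θ =>
      ENNReal.ofReal (c * ∑ i, ∑ j, edgeProb W ρ (fun i => x i θ) i j) :=
    (((Finset.measurable_sum _ fun i _ => Finset.measurable_sum _ fun j _ =>
      (measurable_edgeProb W ρ i j).comp hxm)).const_mul c).ennreal_ofReal
  have := mul_meas_ge_le_lintegral (μ := P) hm 1
  rw [one_mul] at this
  refine le_trans (measure_mono fun θ hθ => ?_) this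
  exact ENNReal.one_le_ofReal.2 hθ

/-- A bound in probability on the distance of the adjacency matrix from its expectation. -/
lemma exists_measure_cutNorm_ge_le (ε : ℝ) (hε : 0 < ε) : ∃ K : ℝ, 0 ≤ K ∧
    ∀ (Ω : Type u) [MeasurableSpace Ω] (π : Measure Ω) (W : Graphon Ω π), W.Normalized →
      ∀ (n : ℕ) (ρ : ℝ), 0 < n → 0 < ρ →
      ∀ (Θ : Type v) [MeasurableSpace Θ] (P : Measure Θ) [IsProbabilityMeasure P]
        (x : Fin n → Θ → Ω) (G : Θ → SimpleGraph (Fin n)),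
        IsIIDSample π P x → IsWRandomGraph W ρ P x G →
        P {θ | K * √(1 / (ρ * n)) <
          (1 / ρ) * matrixCutNorm (adjacency (G θ) - edgeProb W ρ fun i => x i θ)} ≤
          ENNReal.ofReal ε := by
  -- exponential decay rate
  set T : ℝ := Real.log 4 + max 0 (Real.log (4 / ε)) with hT
  have hT0 : 0 ≤ T := add_nonneg (Real.log_nonneg (by norm_num)) (le_max_left _ _)
  refine ⟨4 / ε + 2 * T, by positivity, ?_⟩
  intro Ω _ π W hW n ρ hn hρ Θ _ P _ x G hx hG
  have hn' : (0 : ℝ) < n := by exact_mod_cast hn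
  have hn1 : (1 : ℝ) ≤ n := by exact_mod_cast hn
  set r := √(1 / (ρ * n)) with hr
  have hr0 : 0 < r := Real.sqrt_pos.2 (by positivity)
  have hr2 : r ^ 2 = 1 / (ρ * n) := Real.sq_sqrt (by positivity)
  -- If `r ≥ 1`, that is `ρ n ≤ 1`, the expected mass `ρ n ^ 2` already has the right order and the
  -- first moment suffices. Otherwise `l = r / 2` is an allowed parameter for the exponential bound.
  rcases le_total 1 r with h1 | h1
  · have ht : 0 < 4 / ε * r * ρ * (n : ℝ) ^ 2 := by positivity
    have h := hG.measure_cutNorm_le_mean hρ hn hx.1 ht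
    refine le_trans (measure_mono fun θ hθ => ?_) (h.trans ?_)
    · rw [Set.mem_ofPred_eq]
      have hθ' : (4 / ε + 2 * T) * r <
          (1 / ρ) * matrixCutNorm (adjacency (G θ) - edgeProb W ρ fun i => x i θ) := hθ
      rw [one_div, inv_mul_eq_div, lt_div_iff₀ hρ] at hθ'
      have h3 : 4 / ε * r * ρ ≤ (4 / ε + 2 * T) * r * ρ := by gcongr; linarith
      calc _ ≤ (4 / ε + 2 * T) * r * ρ * (n : ℝ) ^ 2 := by gcongr
        _ ≤ _ := by rw [mul_comm]; gcongr
    · have e : ∀ θ, 2 * (∑ i, ∑ j, edgeProb W ρ (fun i => x i θ) i j) /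
          (4 / ε * r * ρ * (n : ℝ) ^ 2) = (2 / (4 / ε * r * ρ * (n : ℝ) ^ 2)) *
          ∑ i, ∑ j, edgeProb W ρ (fun i => x i θ) i j := fun θ => by ring
      simp only [e]
      refine (lintegral_sum_edgeProb_le W hW hρ hx (by positivity)).trans
        (ENNReal.ofReal_le_ofReal ?_)
      have : 2 / (4 / ε * r * ρ * (n : ℝ) ^ 2) * (ρ * n ^ 2) = ε / (2 * r) := by
        field_simp; norm_num
      rw [this, div_le_iff₀ (by positivity)]
      nlinarith
  · have hl0 : 0 ≤ r / 2 := by positivity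
    have hl : r / 2 ≤ 1 / 2 := by linarith
    -- The deviation `T * n` beats the factor `4 ^ n` and leaves probability at most `ε / 2`; the
    -- other half is spent in `hB` on the event that the sum of the edge probabilities exceeds its
    -- mean bound by a factor `2 / ε`.
    have hA := hG.measure_cutNorm_le hρ hn hx.1 hl0 hl (T * n)
    have hB := measure_sum_edgeProb_ge_le W hW hρ hx (c := ε / (2 * ρ * n ^ 2)) (by positivity)
    have hA' : ENNReal.ofReal (2 * 4 ^ n * Real.exp (-(T * n))) ≤ ENNReal.ofReal (ε / 2) := by
      refine ENNReal.ofReal_le_ofReal ?_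
      have e1 : (4 : ℝ) ^ n = Real.exp (Real.log 4 * n) := by
        rw [mul_comm, Real.exp_nat_mul, Real.exp_log (by norm_num)]
      have e2 : Real.exp (Real.log 4 * n) * Real.exp (-(T * n)) =
          Real.exp (-(max 0 (Real.log (4 / ε)) * n)) := by
        rw [← Real.exp_add, hT]; ring_nf
      rw [e1, mul_assoc, e2]
      have e3 : Real.log (4 / ε) ≤ max 0 (Real.log (4 / ε)) * n :=
        (le_max_right _ _).trans (le_mul_of_one_le_right (le_max_left _ _) hn1)
      calc 2 * Real.exp (-(max 0 (Real.log (4 / ε)) * n))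
          ≤ 2 * Real.exp (-Real.log (4 / ε)) := by gcongr
        _ = ε / 2 := by
            rw [Real.exp_neg, Real.exp_log (by positivity), inv_div]; ring
    have hB' : ε / (2 * ρ * n ^ 2) * (ρ * (n : ℝ) ^ 2) = ε / 2 := by field_simp
    rw [hB'] at hB
    have hε2 : ENNReal.ofReal ε = ENNReal.ofReal (ε / 2) + ENNReal.ofReal (ε / 2) := by
      rw [← ENNReal.ofReal_add (by positivity) (by positivity), add_halves]
    rw [hε2]
    refine le_trans (measure_mono fun θ hθ => ?_)
      ((measure_union_le _ _).trans (add_le_add (hA.trans hA') hB))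
    by_contra hcon
    rw [Set.mem_union, not_or, Set.mem_ofPred_eq, Set.mem_ofPred_eq, not_le, not_le] at hcon
    obtain ⟨c1', c2'⟩ := hcon
    have hθ' : (4 / ε + 2 * T) * r <
          (1 / ρ) * matrixCutNorm (adjacency (G θ) - edgeProb W ρ fun i => x i θ) := hθ
    set X := matrixCutNorm (adjacency (G θ) - edgeProb W ρ fun i => x i θ) with hX
    set s := ∑ i, ∑ j, edgeProb W ρ (fun i => x i θ) i j with hs
    have hs1 : s < 2 * ρ * n ^ 2 / ε := by
      rw [div_mul_eq_mul_div, div_lt_one (by positivity)] at c2'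
      rw [lt_div_iff₀ hε]; linarith
    -- rescale
    have h3 : r / 2 * (n ^ 2 * X) < T * n + r ^ 2 / 2 * (2 * ρ * n ^ 2 / ε) := by
      refine c1'.trans_le ?_
      have : r ^ 2 / 2 * s ≤ r ^ 2 / 2 * (2 * ρ * n ^ 2 / ε) := by gcongr
      nlinarith
    -- With this identity the entropy term `T * n` and the variance term have the same order, which
    -- is why `l` was taken proportional to `r`.
    have h4 : n = r ^ 2 * (ρ * (n : ℝ) ^ 2) := by rw [hr2]; field_simp
    have h5 : r / 2 * (n ^ 2 * X) < r / 2 * (n ^ 2 * (ρ * ((2 * T + 2 / ε) * r))) := by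
      refine h3.trans_le (le_of_eq ?_)
      conv_lhs => rw [show T * (n : ℝ) = T * (r ^ 2 * (ρ * (n : ℝ) ^ 2)) by rw [← h4]]
      field_simp
    have h6 : X < ρ * ((2 * T + 2 / ε) * r) := by
      have := lt_of_mul_lt_mul_left h5 (by positivity)
      exact lt_of_mul_lt_mul_left this (by positivity)
    rw [one_div, inv_mul_eq_div, lt_div_iff₀ hρ] at hθ'
    have h7 : (2 * T + 2 / ε) * r ≤ (4 / ε + 2 * T) * r := by
      refine mul_le_mul_of_nonneg_right ?_ hr0.le
      have : 2 / ε ≤ 4 / ε := by gcongr; norm_num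
      linarith
    nlinarith

end FirstMoment

/-! ### Nearly optimal block models, and the error bound in probability. -/

section Oracle

variable {Ω : Type u} [MeasurableSpace Ω] {π : Measure Ω}

lemma Graphon.tail_nonneg (W : Graphon Ω π) (ρ : ℝ) : 0 ≤ W.tail ρ :=
  integral_nonneg fun _ => abs_nonneg _

lemma Graphon.oracleError_nonneg (W : Graphon Ω π) (κ : ℝ) : 0 ≤ W.oracleError κ :=
  Real.iInf_nonneg fun _ => Real.iInf_nonneg fun _ => integral_nonneg fun _ => abs_nonneg _

lemma isCoupling_prod {Ω : Type u} {Ω' : Type v} [MeasurableSpace Ω] [MeasurableSpace Ω']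
    (π : Measure Ω) (π' : Measure Ω') [IsProbabilityMeasure π] [IsProbabilityMeasure π'] :
    IsCoupling π π' (π.prod π') := by
  constructor
  · rw [Measure.map_fst_prod, measure_univ, one_smul]
  · rw [Measure.map_snd_prod, measure_univ, one_smul]

/-- Block models that are almost optimal. -/
lemma Graphon.exists_coupling_lt_oracleError_add [IsProbabilityMeasure π] (W : Graphon Ω π)
    {κ : ℝ} (hκ : κ ≤ 1) {η : ℝ} (hη : 0 < η) :
    ∃ V : BlockModel, (∀ i, κ ≤ V.p i) ∧ ∃ ν : Measure (Ω × Fin V.k), IsCoupling π V.measure ν ∧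
      ∫ a : (Ω × Fin V.k) × (Ω × Fin V.k), |W.toFun a.1.1 a.2.1 - V.B a.1.2 a.2.2| ∂(ν.prod ν) <
        W.oracleError κ + η := by
  -- As `κ ≤ 1`, a single block qualifies; so the infimum is not the default value for an empty
  -- family.
  have : Nonempty {V : BlockModel // ∀ i, κ ≤ V.p i} :=
    ⟨⟨⟨1, fun _ => 1, fun _ _ => 0, fun _ => zero_le_one, by simp, rfl, fun _ _ => le_rfl⟩,
      fun _ => hκ⟩⟩
  obtain ⟨V, hV⟩ := exists_lt_of_ciInf_lt (lt_add_of_pos_right (W.oracleError κ) hη)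
  have : Nonempty {ν : Measure (Ω × Fin V.1.k) // IsCoupling π V.1.measure ν} :=
    ⟨⟨_, isCoupling_prod π V.1.measure⟩⟩
  obtain ⟨ν, hν⟩ := exists_lt_of_ciInf_lt hV
  exact ⟨V.1, V.2, ν.1, ν.2, hν⟩

/-- The norm of a block model is controlled by its distance from a normalized graphon. -/
lemma sum_p_mul_B_le [IsProbabilityMeasure π] (W : Graphon Ω π) (hW : W.Normalized)
    (V : BlockModel) {ν : Measure (Ω × Fin V.k)} (hν : IsCoupling π V.measure ν) :
    ∑ i, ∑ j, V.p i * V.p j * V.B i j ≤ 1 + ∫ a : (Ω × Fin V.k) × (Ω × Fin V.k),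
      |W.toFun a.1.1 a.2.1 - V.B a.1.2 a.2.2| ∂(ν.prod ν) := by
  have hνp := hν.isProbabilityMeasure
  have hmap : (ν.prod ν).map (fun a => (a.1.1, a.2.1)) = π.prod π := by
    conv_rhs => rw [← hν.1, Measure.map_prod_map _ _ measurable_fst measurable_fst]
    rfl
  have hWi : Integrable (fun a : (Ω × Fin V.k) × (Ω × Fin V.k) => W.toFun a.1.1 a.2.1)
      (ν.prod ν) := by
    have hW := W.integrable'
    rw [← hmap] at hW
    exact hW.comp_measurable (by fun_prop)
  have hBi : Integrable (fun a : (Ω × Fin V.k) × (Ω × Fin V.k) => V.B a.1.2 a.2.2) (ν.prod ν) :=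
    integrable_prod_comp_finite ν ν measurable_snd V.B
  have h1 : ∫ a : (Ω × Fin V.k) × (Ω × Fin V.k), |W.toFun a.1.1 a.2.1| ∂(ν.prod ν) = 1 := by
    rw [← hW, ← hmap, integral_map (by fun_prop) W.measurable'.abs.aestronglyMeasurable]
  have h2 : ∫ a : (Ω × Fin V.k) × (Ω × Fin V.k), V.B a.1.2 a.2.2 ∂(ν.prod ν) =
      ∑ i, ∑ j, V.p i * V.p j * V.B i j := by
    rw [integral_prod_comp_finite ν ν measurable_snd V.B]
    simp only [hν.2, measureReal_def, V.measure_singleton, ENNReal.toReal_ofReal (V.p_nonneg _)]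
  rw [← h1, ← h2, ← integral_add
    (g := fun a : (Ω × Fin V.k) × (Ω × Fin V.k) => |W.toFun a.1.1 a.2.1 - V.B a.1.2 a.2.2|)
    hWi.abs (hWi.sub hBi).abs]
  refine integral_mono hBi (hWi.abs.add (hWi.sub hBi).abs) fun a => ?_
  have e1 := neg_abs_le (W.toFun a.1.1 a.2.1 - V.B a.1.2 a.2.2)
  have e2 := le_abs_self (W.toFun a.1.1 a.2.1)
  beta_reduce
  linarith

/-- Since `1 / n ≤ κ ≤ p_j` and `1 ≤ p_i / κ`, the sum without the weight `p_i` is at most `3 / κ`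
times the weighted one. -/
lemma sum_rounding_le (V : BlockModel) {κ : ℝ} (hκ : 0 < κ) (hV : ∀ i, κ ≤ V.p i) {n : ℕ}
    (hn : 0 < n) (hκn : 1 ≤ κ * n) :
    2 / n * ∑ i, ∑ j, (2 * V.p j + 1 / n) * V.B i j ≤
      6 * (1 / (κ * n)) * ∑ i, ∑ j, V.p i * V.p j * V.B i j := by
  have hn' : (0 : ℝ) < n := by exact_mod_cast hn
  rw [show 6 * (1 / (κ * n)) = 2 / n * (3 / κ) by field_simp; norm_num, mul_assoc]
  refine mul_le_mul_of_nonneg_left ?_ (by positivity)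
  simp only [Finset.mul_sum]
  refine Finset.sum_le_sum fun i _ => Finset.sum_le_sum fun j _ => ?_
  rw [← mul_assoc]
  refine mul_le_mul_of_nonneg_right ?_ (V.B_nonneg i j)
  have hj := V.p_nonneg j
  have h1 : 1 / (n : ℝ) ≤ V.p j := by
    rw [div_le_iff₀ hn']
    refine hκn.trans ?_
    exact mul_le_mul_of_nonneg_right (hV j) hn'.le
  have h2 : 1 ≤ V.p i / κ := (one_le_div hκ).2 (hV i)
  calc 2 * V.p j + 1 / n ≤ 1 * (3 * V.p j) := by linarith
    _ ≤ V.p i / κ * (3 * V.p j) := by gcongr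
    _ = _ := by ring

end Oracle

/-- The error bound in probability for the least cut norm estimator. -/
theorem exists_estimationError_le_of_pos (ε : ℝ) (hε : 0 < ε) : ∃ M : ℝ,
      ∀ (Ω : Type u) [MeasurableSpace Ω] (π : Measure Ω) [IsProbabilityMeasure π]
        (W : Graphon Ω π), W.Normalized →
      ∀ (n : ℕ) (ρ κ : ℝ), 2 ≤ n → 0 < ρ → κ ≤ 1 → 1 ≤ κ * n →
      ∀ (Θ : Type v) [MeasurableSpace Θ] (P : Measure Θ) [IsProbabilityMeasure P]
        (x : Fin n → Θ → Ω) (G : Θ → SimpleGraph (Fin n)) (What : Θ → BlockModel),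
        IsIIDSample π P x →
        IsWRandomGraph W ρ P x G →
        (∀ θ, IsLeastCutNormOutput κ (G θ) (What θ)) →
        P {θ | ¬ estimationError W ρ (What θ) ≤
            M * (W.oracleError κ + Real.sqrt (1 / (ρ * n)) + Real.sqrt (Real.log n / (κ * n))
              + W.tail ρ)} ≤ ENNReal.ofReal ε := by
  obtain ⟨K, hK0, hK⟩ := exists_measure_cutNorm_ge_le.{u, v} (ε / 2) (half_pos hε)
  -- `612 = 3 · 2 · 51 · 2`: three fit errors, Markov at level `ε / 2`, the `51 r` in the expected
  -- fit, and `r ≤ 2 L`. The 39 covers the remaining `16 r ≤ 32 L` and seven oracle errors.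
  refine ⟨3 * K + 612 / ε + 39, ?_⟩
  intro Ω _ π _ W hW n ρ κ hn2 hρ hκ1 hκn Θ _ P _ x G What hx hG hout
  have hn : 0 < n := by omega
  have hn' : (0 : ℝ) < n := by exact_mod_cast hn
  have hκ : 0 < κ := by
    by_contra h
    nlinarith [not_lt.1 h]
  set r := √(1 / (κ * n)) with hr
  have hr0 : 0 < r := Real.sqrt_pos.2 (by positivity)
  have hr2 : r ^ 2 = 1 / (κ * n) := Real.sq_sqrt (by positivity)
  have hr1 : r ≤ 1 := by
    have h : 1 / (κ * n) ≤ 1 := by rw [div_le_one (by positivity)]; exact hκn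
    exact (Real.sqrt_le_sqrt h).trans Real.sqrt_one.le
  set L := √(Real.log n / (κ * n)) with hL
  -- Because `n ≥ 2`, `4 log n ≥ 4 log 2 > 1`, so the fluctuation term without a logarithm is
  -- absorbed.
  have hrL : r ≤ 2 * L := by
    have h2 : (2 : ℝ) = √4 := by
      rw [show (4 : ℝ) = 2 ^ 2 by norm_num, Real.sqrt_sq (by norm_num)]
    rw [h2, hL, ← Real.sqrt_mul (by norm_num)]
    refine Real.sqrt_le_sqrt ?_
    rw [← mul_div_assoc]
    gcongr
    have h3 : Real.log 2 ≤ Real.log n :=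
      Real.log_le_log (by norm_num) (by exact_mod_cast hn2)
    linarith [Real.log_two_gt_d9]
  have hL0 : 0 ≤ L := Real.sqrt_nonneg _
  set s := √(1 / (ρ * n)) with hs
  have hs0 : 0 ≤ s := Real.sqrt_nonneg _
  -- The infimum need not be attained; a slack of `r` is harmless, being of the order of an error
  -- term that is present anyway.
  obtain ⟨V, hV, ν, hν, hδ⟩ := W.exists_coupling_lt_oracleError_add hκ1 hr0
  set δ := ∫ a : (Ω × Fin V.k) × (Ω × Fin V.k),
    |W.toFun a.1.1 a.2.1 - V.B a.1.2 a.2.2| ∂(ν.prod ν) with hδdef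
  have hδ0 : 0 ≤ δ := integral_nonneg fun _ => abs_nonneg _
  set β := ∑ i, ∑ j, V.p i * V.p j * V.B i j with hβdef
  have hβ : β ≤ 1 + δ := sum_p_mul_B_le W hW V hν
  have hβ0 : 0 ≤ β := Finset.sum_nonneg fun i _ => Finset.sum_nonneg fun j _ =>
    mul_nonneg (mul_nonneg (V.p_nonneg i) (V.p_nonneg j)) (V.B_nonneg i j)
  have ho := W.oracleError_nonneg κ
  have htail := W.tail_nonneg ρ
  -- The norm of the model is at most `2 + W.oracleError κ`; using `r ≤ 1` only on the second
  -- summand keeps the bound linear in both errors.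
  have hβr : β * r ≤ 2 * r + W.oracleError κ := by
    have h1 : β * r ≤ (2 + W.oracleError κ) * r :=
      mul_le_mul_of_nonneg_right (by linarith) hr0.le
    have h2 : W.oracleError κ * r ≤ W.oracleError κ * 1 := mul_le_mul_of_nonneg_left hr1 ho
    linarith
  set E := W.tail ρ + δ + 25 * β * r with hE
  have hE0 : 0 ≤ E := by positivity
  -- Markov's inequality at this level fails with probability at most `ε / 2`; the added `r` keeps
  -- the level positive when `E = 0`.
  set t := 2 / ε * E + r with ht
  have ht0 : 0 < t := by positivity
  have hA := measure_forall_balanced_le W hρ V hκ hV hn hκn hν hx ht0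
  have hA' : E / t ≤ ε / 2 := by
    rw [div_le_iff₀ ht0, ht]
    have : ε / 2 * (2 / ε * E + r) = E + ε / 2 * r := by field_simp
    rw [this]
    have : 0 ≤ ε / 2 * r := by positivity
    linarith
  have hB := hK Ω π W hW n ρ hn hρ Θ P x G hx hG
  have hε2 : ENNReal.ofReal ε = ENNReal.ofReal (ε / 2) + ENNReal.ofReal (ε / 2) := by
    rw [← ENNReal.ofReal_add (by positivity) (by positivity), add_halves]
  rw [hε2]
  refine le_trans (measure_mono fun θ hθ => ?_) ((measure_union_le _ _).trans
    (add_le_add (hA.trans (ENNReal.ofReal_le_ofReal hA')) hB))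
  by_contra hcon
  rw [Set.mem_union, not_or, Set.mem_ofPred_eq, Set.mem_ofPred_eq, not_lt] at hcon
  obtain ⟨c1, c2⟩ := hcon
  push Not at c1
  obtain ⟨z, hz, hzt⟩ := c1
  refine hθ ?_
  have hmain := estimationError_le_of_isLeastCutNormOutput W hρ hn hκn (hout θ) V hV z hz V
    (fun i => hκ.trans_le (hV i)) ν hν z hz (edgeProb W ρ fun i => x i θ)
  have hround := sum_rounding_le V hκ hV hn hκn
  rw [← hr2, ← hβdef] at hround
  have hround' : 6 * r ^ 2 * β ≤ 6 * (β * r) := by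
    have h1 : β * r * r ≤ β * r * 1 := mul_le_mul_of_nonneg_left hr1 (by positivity)
    linarith
  have htb : t ≤ 2 / ε * (W.tail ρ + 26 * W.oracleError κ + 51 * r) + r := by
    rw [ht]
    gcongr
    rw [hE]
    linarith
  have hfin : estimationError W ρ (What θ) ≤
      3 * (K * s) + 3 * (2 / ε * (W.tail ρ + 26 * W.oracleError κ + 51 * r) + r) +
        6 * (2 * r + W.oracleError κ) + (W.oracleError κ + r) := by
    linarith
  refine hfin.trans ?_
  have hi : 0 < 1 / ε := by positivity
  rw [show 2 / ε = 2 * (1 / ε) by ring, show 612 / ε = 612 * (1 / ε) by ring]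
  set e := 1 / ε
  have p1 : e * r ≤ e * (2 * L) := by gcongr
  have p2 : 0 ≤ e * W.tail ρ := by positivity
  have p3 : 0 ≤ e * W.oracleError κ := by positivity
  have p4 : 0 ≤ e * s := by positivity
  have p5 : 0 ≤ K * L := by positivity
  have p6 : 0 ≤ K * W.tail ρ := by positivity
  have p7 : 0 ≤ K * W.oracleError κ := by positivity
  have p8 : 0 ≤ e * L := by positivity
  have e1 : (3 * K + 612 * e + 39) * (W.oracleError κ + s + L + W.tail ρ) =
    3 * (K * W.oracleError κ) + 3 * (K * s) + 3 * (K * L) + 3 * (K * W.tail ρ) +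
    612 * (e * W.oracleError κ) + 612 * (e * s) + 612 * (e * L) + 612 * (e * W.tail ρ) +
    39 * (W.oracleError κ + s + L + W.tail ρ) := by ring
  rw [e1]
  linarith

/-! ### Variance of `U`-statistics with bounded non-negative kernel. -/

section UStatisticVariance

variable {E : Type u} [MeasurableSpace E] {μ : Measure E} {Θ : Type v} [MeasurableSpace Θ]
  {P : Measure Θ}

/-- The unnormalized `U`-statistic of order two. -/
def pairSum (U : E → E → ℝ) (x : ℕ → Θ → E) (n : ℕ) (θ : Θ) : ℝ :=
  ∑ e ∈ (Finset.range n).offDiag, U (x e.1 θ) (x e.2 θ)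

lemma IsIIDSample.map_triple [IsProbabilityMeasure P] {x : ℕ → Θ → E} (h : IsIIDSample μ P x)
    {s p q : ℕ} (hsp : s ≠ p) (hsq : s ≠ q) (hpq : p ≠ q) :
    P.map (fun θ => (x s θ, (x p θ, x q θ))) = μ.prod (μ.prod μ) := by
  have hi : IndepFun (x s) (fun θ => (x p θ, x q θ)) P :=
    (h.2.1.indepFun_prodMk h.1 p q s hsp.symm hsq.symm).symm
  rw [(indepFun_iff_map_prod_eq_prod_map_map (h.1 s).aemeasurable
    ((h.1 p).prodMk (h.1 q)).aemeasurable).1 hi, h.map_pair hpq, h.2.2]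

variable {K : E → E → ℝ} {C : ℝ}

/-- Given the shared point, the two factors are independent with the same conditional mean. -/
lemma integral_mul_of_shared [IsProbabilityMeasure P] [IsProbabilityMeasure μ] {x : ℕ → Θ → E}
    (h : IsIIDSample μ P x) (hK : Measurable fun z : E × E => K z.1 z.2) (hK0 : ∀ a b, 0 ≤ K a b)
    (hKC : ∀ a b, K a b ≤ C) {s p q : ℕ} (hsp : s ≠ p) (hsq : s ≠ q) (hpq : p ≠ q) :
    ∫ θ, K (x s θ) (x p θ) * K (x s θ) (x q θ) ∂P = ∫ a, (∫ b, K a b ∂μ) ^ 2 ∂μ := by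
  have hm : Measurable fun t : E × (E × E) => K t.1 t.2.1 * K t.1 t.2.2 :=
    (hK.comp (by fun_prop : Measurable fun t : E × (E × E) => (t.1, t.2.1))).mul
      (hK.comp (by fun_prop : Measurable fun t : E × (E × E) => (t.1, t.2.2)))
  have h1 : ∫ θ, K (x s θ) (x p θ) * K (x s θ) (x q θ) ∂P =
      ∫ t, K t.1 t.2.1 * K t.1 t.2.2 ∂(μ.prod (μ.prod μ)) := by
    rw [← h.map_triple hsp hsq hpq, integral_map
      ((h.1 s).prodMk ((h.1 p).prodMk (h.1 q))).aemeasurable hm.aestronglyMeasurable]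
  have hint : Integrable (fun t : E × (E × E) => K t.1 t.2.1 * K t.1 t.2.2)
      (μ.prod (μ.prod μ)) := by
    refine Integrable.of_bound hm.aestronglyMeasurable (C * C) (Eventually.of_forall fun t => ?_)
    rw [Real.norm_eq_abs, abs_of_nonneg (mul_nonneg (hK0 _ _) (hK0 _ _))]
    exact mul_le_mul (hKC _ _) (hKC _ _) (hK0 _ _) ((hK0 t.1 t.2.1).trans (hKC _ _))
  rw [h1, integral_prod _ hint]
  refine integral_congr_ae (Eventually.of_forall fun a => ?_)
  simp only
  rw [integral_prod_mul (fun b => K a b) (fun b => K a b), sq]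

lemma memLp_pair [IsProbabilityMeasure P] {x : ℕ → Θ → E}
    (h : IsIIDSample μ P x) (hK : Measurable fun z : E × E => K z.1 z.2) (hK0 : ∀ a b, 0 ≤ K a b)
    (hKC : ∀ a b, K a b ≤ C) (e : ℕ × ℕ) :
    MemLp (fun θ => K (x e.1 θ) (x e.2 θ)) 2 P := by
  have hm : Measurable fun θ => K (x e.1 θ) (x e.2 θ) :=
    hK.comp ((h.1 e.1).prodMk (h.1 e.2))
  refine MemLp.of_bound hm.aestronglyMeasurable C (Eventually.of_forall fun θ => ?_)
  rw [Real.norm_eq_abs, abs_of_nonneg (hK0 _ _)]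
  exact hKC _ _

/-- The covariance of two terms of a `U`-statistic. -/
lemma covariance_pair_le [IsProbabilityMeasure P] [IsProbabilityMeasure μ] {x : ℕ → Θ → E}
    (h : IsIIDSample μ P x) (hK : Measurable fun z : E × E => K z.1 z.2) (hK0 : ∀ a b, 0 ≤ K a b)
    (hKC : ∀ a b, K a b ≤ C) (hKs : ∀ a b, K a b = K b a) {e e' : ℕ × ℕ} (he : e.1 ≠ e.2)
    (he' : e'.1 ≠ e'.2) :
    cov[fun θ => K (x e.1 θ) (x e.2 θ), fun θ => K (x e'.1 θ) (x e'.2 θ); P] ≤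
      ((if e.1 = e'.1 then 1 else 0) + (if e.1 = e'.2 then 1 else 0) +
        (if e.2 = e'.1 then 1 else 0) + (if e.2 = e'.2 then 1 else 0)) *
        ∫ a, (∫ b, K a b ∂μ) ^ 2 ∂μ +
      ((if e = e' then 1 else 0) + (if e = e'.swap then 1 else 0)) *
        ∫ z, K z.1 z.2 ^ 2 ∂(μ.prod μ) := by
  obtain ⟨i, j⟩ := e
  obtain ⟨i', j'⟩ := e'
  simp only at he he'
  set a := ∫ a, (∫ b, K a b ∂μ) ^ 2 ∂μ with ha
  set b := ∫ z, K z.1 z.2 ^ 2 ∂(μ.prod μ) with hb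
  have ha0 : 0 ≤ a := integral_nonneg fun _ => sq_nonneg _
  have hb0 : 0 ≤ b := integral_nonneg fun _ => sq_nonneg _
  -- The product of the means is non-negative and can be dropped. The case distinction then counts
  -- shared indices; disjoint pairs are independent.
  have hcov : cov[fun θ => K (x i θ) (x j θ), fun θ => K (x i' θ) (x j' θ); P] ≤
      ∫ θ, K (x i θ) (x j θ) * K (x i' θ) (x j' θ) ∂P := by
    rw [covariance_eq_sub (memLp_pair h hK hK0 hKC (i, j)) (memLp_pair h hK hK0 hKC (i', j'))]
    have h1 : 0 ≤ ∫ θ, K (x i θ) (x j θ) ∂P := integral_nonneg fun _ => hK0 _ _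
    have h2 : 0 ≤ ∫ θ, K (x i' θ) (x j' θ) ∂P := integral_nonneg fun _ => hK0 _ _
    have := mul_nonneg h1 h2
    simp only [Pi.mul_apply]
    linarith
  have hsq : ∀ i j, i ≠ j → ∫ θ, K (x i θ) (x j θ) * K (x i θ) (x j θ) ∂P = b := by
    intro i j hij
    have h1 := h.integral_pair hij (f := fun z => K z.1 z.2 ^ 2) (hK.pow_const 2)
    simp only [sq] at h1
    rw [h1, hb]
    simp only [sq]
  have hsh := fun {s p q : ℕ} (hsp : s ≠ p) (hsq : s ≠ q) (hpq : p ≠ q) =>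
    integral_mul_of_shared h hK hK0 hKC hsp hsq hpq
  by_cases h1 : i = i'
  · subst h1
    by_cases h2 : j = j'
    · subst h2
      rw [hsq i j he] at hcov
      refine hcov.trans ?_
      simp only [if_true, Prod.swap_prod_mk, Prod.mk.injEq]
      split_ifs <;> nlinarith
    · rw [hsh he he' h2] at hcov
      refine hcov.trans ?_
      simp only [if_true, Prod.swap_prod_mk, Prod.mk.injEq]
      split_ifs <;> nlinarith
  by_cases h2 : j = j'
  · subst h2
    rw [integral_congr_ae (g := fun θ => K (x j θ) (x i θ) * K (x j θ) (x i' θ))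
      (Eventually.of_forall fun θ => by simp only [hKs (x i θ), hKs (x i' θ)]),
      hsh he.symm he'.symm h1] at hcov
    refine hcov.trans ?_
    simp only [if_true, Prod.swap_prod_mk, Prod.mk.injEq]
    split_ifs <;> nlinarith
  by_cases h3 : i = j'
  · subst h3
    by_cases h4 : j = i'
    · subst h4
      rw [integral_congr_ae (g := fun θ => K (x i θ) (x j θ) * K (x i θ) (x j θ))
        (Eventually.of_forall fun θ => by simp only [hKs (x j θ)]), hsq i j he] at hcov
      refine hcov.trans ?_
      simp only [if_true, Prod.swap_prod_mk, Prod.mk.injEq]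
      split_ifs <;> nlinarith
    · rw [integral_congr_ae (g := fun θ => K (x i θ) (x j θ) * K (x i θ) (x i' θ))
        (Eventually.of_forall fun θ => by simp only [hKs (x i' θ)]), hsh he h1 h4] at hcov
      refine hcov.trans ?_
      simp only [if_true, Prod.swap_prod_mk, Prod.mk.injEq]
      split_ifs <;> nlinarith
  by_cases h4 : j = i'
  · subst h4
    rw [integral_congr_ae (g := fun θ => K (x j θ) (x i θ) * K (x j θ) (x j' θ))
      (Eventually.of_forall fun θ => by simp only [hKs (x i θ)]),
      hsh he.symm h2 h3] at hcov
    refine hcov.trans ?_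
    simp only [if_true, Prod.swap_prod_mk, Prod.mk.injEq]
    split_ifs <;> nlinarith
  have hind : IndepFun (fun θ => (x i θ, x j θ)) (fun θ => (x i' θ, x j' θ)) P :=
    h.2.1.indepFun_prodMk_prodMk h.1 i j i' j' h1 h3 h4 h2
  have hz := (hind.comp hK hK).covariance_eq_zero (memLp_pair h hK hK0 hKC (i, j))
    (memLp_pair h hK hK0 hKC (i', j'))
  refine (le_of_eq hz).trans ?_
  positivity

/-- The variance of a `U`-statistic with bounded kernel. -/
lemma variance_pairSum_le [IsProbabilityMeasure P] [IsProbabilityMeasure μ] {x : ℕ → Θ → E}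
    (h : IsIIDSample μ P x) (hK : Measurable fun z : E × E => K z.1 z.2) (hK0 : ∀ a b, 0 ≤ K a b)
    (hKC : ∀ a b, K a b ≤ C) (hKs : ∀ a b, K a b = K b a) (n : ℕ) :
    Var[pairSum K x n; P] ≤ 4 * n ^ 3 * ∫ a, (∫ b, K a b ∂μ) ^ 2 ∂μ +
      2 * n ^ 2 * ∫ z, K z.1 z.2 ^ 2 ∂(μ.prod μ) := by
  set a := ∫ a, (∫ b, K a b ∂μ) ^ 2 ∂μ with ha
  set b := ∫ z, K z.1 z.2 ^ 2 ∂(μ.prod μ) with hb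
  have ha0 : 0 ≤ a := integral_nonneg fun _ => sq_nonneg _
  have hb0 : 0 ≤ b := integral_nonneg fun _ => sq_nonneg _
  set s := (Finset.range n).offDiag with hs
  set R := Finset.range n ×ˢ Finset.range n with hR
  have hsR : s ⊆ R := fun e he => by
    rw [hs, Finset.mem_offDiag] at he
    exact Finset.mem_product.2 ⟨he.1, he.2.1⟩
  have hvar : Var[pairSum K x n; P] = ∑ e ∈ s, ∑ e' ∈ s,
      cov[fun θ => K (x e.1 θ) (x e.2 θ), fun θ => K (x e'.1 θ) (x e'.2 θ); P] :=
    variance_fun_sum' fun e _ => memLp_pair h hK hK0 hKC e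
  rw [hvar]
  have hone : ∀ m : ℕ, (∑ k ∈ Finset.range n, if m = k then (1 : ℝ) else 0) ≤ 1 := by
    intro m
    rw [Finset.sum_ite_eq]
    split_ifs <;> norm_num
  have hfst : ∀ m : ℕ, (∑ e' ∈ R, if m = e'.1 then (1 : ℝ) else 0) ≤ n := by
    intro m
    rw [hR, Finset.sum_product_right]
    calc _ ≤ ∑ k ∈ Finset.range n, (1 : ℝ) := Finset.sum_le_sum fun k _ => hone m
      _ = n := by simp
  have hsnd : ∀ m : ℕ, (∑ e' ∈ R, if m = e'.2 then (1 : ℝ) else 0) ≤ n := by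
    intro m
    rw [hR, Finset.sum_product]
    calc _ ≤ ∑ k ∈ Finset.range n, (1 : ℝ) := Finset.sum_le_sum fun k _ => hone m
      _ = n := by simp
  have hid : ∀ e : ℕ × ℕ, (∑ e' ∈ R, if e = e' then (1 : ℝ) else 0) ≤ 1 := by
    intro e
    rw [Finset.sum_ite_eq]
    split_ifs <;> norm_num
  have hsw : ∀ e : ℕ × ℕ, (∑ e' ∈ R, if e = e'.swap then (1 : ℝ) else 0) ≤ 1 := by
    intro e
    have : ∀ e' : ℕ × ℕ, (e = e'.swap) = (e.swap = e') := fun e' => by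
      rw [Prod.swap_eq_iff_eq_swap]
    simp only [this]
    exact hid e.swap
  calc _ ≤ ∑ e ∈ s, ∑ e' ∈ s, (((if e.1 = e'.1 then 1 else 0) + (if e.1 = e'.2 then 1 else 0) +
        (if e.2 = e'.1 then 1 else 0) + (if e.2 = e'.2 then 1 else 0)) * a +
      ((if e = e' then 1 else 0) + (if e = e'.swap then 1 else 0)) * b) := by
        refine Finset.sum_le_sum fun e he => Finset.sum_le_sum fun e' he' => ?_
        exact covariance_pair_le h hK hK0 hKC hKs (Finset.mem_offDiag.1 he).2.2
          (Finset.mem_offDiag.1 he').2.2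
    _ ≤ ∑ e ∈ R, ∑ e' ∈ R, (((if e.1 = e'.1 then 1 else 0) + (if e.1 = e'.2 then 1 else 0) +
        (if e.2 = e'.1 then 1 else 0) + (if e.2 = e'.2 then 1 else 0)) * a +
      ((if e = e' then 1 else 0) + (if e = e'.swap then 1 else 0)) * b) := by
        have hnn : ∀ e e' : ℕ × ℕ, 0 ≤ (((if e.1 = e'.1 then (1 : ℝ) else 0) +
          (if e.1 = e'.2 then 1 else 0) +
          (if e.2 = e'.1 then 1 else 0) + (if e.2 = e'.2 then 1 else 0)) * a +
          ((if e = e' then 1 else 0) + (if e = e'.swap then 1 else 0)) * b) := by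
          intro e e'; positivity
        refine (Finset.sum_le_sum fun e _ => Finset.sum_le_sum_of_subset_of_nonneg hsR
          fun e' _ _ => hnn e e').trans ?_
        exact Finset.sum_le_sum_of_subset_of_nonneg hsR fun e _ _ =>
          Finset.sum_nonneg fun e' _ => hnn e e'
    _ ≤ ∑ e ∈ R, ((n + n + n + n) * a + (1 + 1) * b) := by
        refine Finset.sum_le_sum fun e _ => ?_
        rw [Finset.sum_add_distrib, ← Finset.sum_mul, ← Finset.sum_mul]
        simp only [Finset.sum_add_distrib]
        have := hfst e.1
        have := hfst e.2
        have := hsnd e.1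
        have := hsnd e.2
        have := hid e
        have := hsw e
        gcongr
    _ = _ := by
        rw [Finset.sum_const, hR, Finset.card_product, Finset.card_range, nsmul_eq_mul]
        push_cast
        ring

lemma integral_pairSum [IsProbabilityMeasure P] [IsProbabilityMeasure μ] {x : ℕ → Θ → E}
    (h : IsIIDSample μ P x) (hK : Measurable fun z : E × E => K z.1 z.2)
    (hKi : Integrable (fun z : E × E => K z.1 z.2) (μ.prod μ)) (n : ℕ) :
    ∫ θ, pairSum K x n θ ∂P = ((Finset.range n).offDiag.card : ℝ) *
      ∫ z, K z.1 z.2 ∂(μ.prod μ) := by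
  unfold pairSum
  rw [integral_finsetSum]
  · rw [← nsmul_eq_mul, ← Finset.sum_const]
    exact Finset.sum_congr rfl fun e he => h.integral_pair (Finset.mem_offDiag.1 he).2.2 hK
  · exact fun e he => h.integrable_pair (Finset.mem_offDiag.1 he).2.2 hKi

/-- A Chebyshev bound for a `U`-statistic with bounded kernel. -/
lemma measure_pairSum_ge_le [IsProbabilityMeasure P] [IsProbabilityMeasure μ] {x : ℕ → Θ → E}
    (h : IsIIDSample μ P x) (hK : Measurable fun z : E × E => K z.1 z.2) (hK0 : ∀ a b, 0 ≤ K a b)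
    (hKC : ∀ a b, K a b ≤ C) (hKs : ∀ a b, K a b = K b a) {n : ℕ} (hn : 0 < n) {c : ℝ}
    (hc : 0 < c) (hm : ∫ z, K z.1 z.2 ∂(μ.prod μ) ≤ c) :
    P {θ | 2 * c * n ^ 2 ≤ pairSum K x n θ} ≤
      ENNReal.ofReal (4 / c ^ 2 * ((n : ℝ)⁻¹ * ∫ a, (∫ b, K a b ∂μ) ^ 2 ∂μ) +
        2 / c ^ 2 * (((n : ℝ) ^ 2)⁻¹ * ∫ z, K z.1 z.2 ^ 2 ∂(μ.prod μ))) := by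
  have hn' : (0 : ℝ) < n := by exact_mod_cast hn
  have hKi : Integrable (fun z : E × E => K z.1 z.2) (μ.prod μ) :=
    Integrable.of_bound hK.aestronglyMeasurable C (Eventually.of_forall fun z => by
      rw [Real.norm_eq_abs, abs_of_nonneg (hK0 _ _)]; exact hKC _ _)
  have hL : MemLp (pairSum K x n) 2 P := memLp_finsetSum _ fun e _ => memLp_pair h hK hK0 hKC e
  have hmean := integral_pairSum h hK hKi n
  have hcard : ((Finset.range n).offDiag.card : ℝ) ≤ n ^ 2 := by
    rw [Finset.offDiag_card, Finset.card_range, sq]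
    exact_mod_cast Nat.sub_le _ _
  have hmean' : ∫ θ, pairSum K x n θ ∂P ≤ c * n ^ 2 := by
    rw [hmean, mul_comm]
    exact mul_le_mul hm hcard (Nat.cast_nonneg _) hc.le
  refine le_trans (measure_mono fun θ hθ => ?_) ((meas_ge_le_variance_div_sq hL
    (show 0 < c * n ^ 2 by positivity)).trans (ENNReal.ofReal_le_ofReal ?_))
  · have hθ' : 2 * c * n ^ 2 ≤ pairSum K x n θ := hθ
    rw [Set.mem_ofPred_eq]
    refine le_trans ?_ (le_abs_self _)
    linarith
  · refine (div_le_div_of_nonneg_right (variance_pairSum_le h hK hK0 hKC hKs n)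
      (by positivity)).trans (le_of_eq ?_)
    field_simp

end UStatisticVariance

/-! ### Summability of truncated moments along geometric scales. -/

section DyadicTruncation

/-- A geometric sum with ratio at least 2 is at most twice its last term, which here is below `X`.
-/
lemma sum_pow_lt_le {q X : ℝ} (hq : 2 ≤ q) (hX : 0 ≤ X) (n : ℕ) :
    ∑ k ∈ Finset.range n, (if q ^ k < X then q ^ k else 0) ≤ 2 * X := by
  have hq0 : 0 < q := by linarith
  have hgeom : ∀ n : ℕ, ∑ k ∈ Finset.range n, (if q ^ k < X then q ^ k else 0) ≤ q ^ n := by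
    intro n
    induction n with
    | zero => simp
    | succ n ih =>
      rw [Finset.sum_range_succ, pow_succ]
      have : 0 < q ^ n := by positivity
      split_ifs <;> nlinarith
  induction n with
  | zero => simp; linarith
  | succ n ih =>
    rw [Finset.sum_range_succ]
    split_ifs with h
    · have := hgeom n
      linarith
    · linarith

lemma sum_inv_pow_mul_sq_le {q X : ℝ} (hq : 2 ≤ q) (hX : 0 ≤ X) (n : ℕ) :
    ∑ k ∈ Finset.range n, (q ^ k)⁻¹ * (if X ≤ q ^ k then X ^ 2 else 0) ≤ 2 * X := by
  have hq0 : 0 < q := by linarith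
  -- Beyond the first power with `X ≤ q ^ k` this is a geometric series. The term `2 * X ^ 2 * (q ^
  -- n)⁻¹` reserves room for its remaining tail, so that the induction closes.
  have key : ∀ n : ℕ,
      (X ≤ q ^ n → ∑ k ∈ Finset.range n, (q ^ k)⁻¹ * (if X ≤ q ^ k then X ^ 2 else 0) ≤
        2 * X - 2 * X ^ 2 * (q ^ n)⁻¹) ∧
      (q ^ n < X → ∑ k ∈ Finset.range n, (q ^ k)⁻¹ * (if X ≤ q ^ k then X ^ 2 else 0) = 0) := by
    intro n
    have hbase : ∀ m : ℕ, X ≤ q ^ m → 0 ≤ 2 * X - 2 * X ^ 2 * (q ^ m)⁻¹ := by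
      intro m hm
      have hp : 0 < q ^ m := by positivity
      have : X * (q ^ m)⁻¹ ≤ 1 := by rw [← div_eq_mul_inv, div_le_one hp]; exact hm
      nlinarith
    induction n with
    | zero => exact ⟨fun h => by simpa using hbase 0 h, fun _ => by simp⟩
    | succ n ih =>
      have hp : 0 < q ^ n := by positivity
      have hle : q ^ n ≤ q ^ (n + 1) := by
        rw [pow_succ]; nlinarith
      have hinv : 2 * (q ^ (n + 1))⁻¹ ≤ (q ^ n)⁻¹ := by
        rw [pow_succ, mul_inv]
        have : 2 * q⁻¹ ≤ 1 := by rw [← div_eq_mul_inv, div_le_one hq0]; exact hq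
        have h0 : 0 < (q ^ n)⁻¹ := by positivity
        nlinarith
      rw [Finset.sum_range_succ]
      constructor
      · intro h
        by_cases hn : X ≤ q ^ n
        · have h1 := ih.1 hn
          rw [if_pos hn]
          nlinarith [sq_nonneg X]
        · rw [if_neg hn, ih.2 (not_le.1 hn), mul_zero, add_zero]
          exact hbase _ h
      · intro h
        have hn : q ^ n < X := lt_of_le_of_lt hle h
        rw [if_neg (not_le.2 hn), ih.2 hn, mul_zero, add_zero]
  rcases le_or_gt X (q ^ n) with h | h
  · refine ((key n).1 h).trans ?_
    have : 0 ≤ 2 * X ^ 2 * (q ^ n)⁻¹ := by positivity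
    linarith
  · rw [(key n).2 h]; linarith

variable {α : Type*} [MeasurableSpace α] {m : Measure α} {X : α → ℝ}

/-- After exchanging sum and integral, the integrand is at most `2 X`. With `q ^ k` terms at scale
`k`, this is the Borel–Cantelli condition for the truncation to be eventually harmless. -/
lemma tsum_pow_mul_measure_ne_top {q : ℝ} (hq : 2 ≤ q) (hXm : Measurable X) (hX0 : ∀ a, 0 ≤ X a)
    (hXi : Integrable X m) : ∑' k : ℕ, ENNReal.ofReal (q ^ k) * m {a | q ^ k < X a} ≠ ⊤ := by
  have hq0 : 0 < q := by linarith
  have h1 : ∀ k : ℕ, ENNReal.ofReal (q ^ k) * m {a | q ^ k < X a} =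
      ∫⁻ a, ENNReal.ofReal (if q ^ k < X a then q ^ k else 0) ∂m := by
    intro k
    have hs : MeasurableSet {a | q ^ k < X a} := measurableSet_lt measurable_const hXm
    rw [← lintegral_indicator_const hs]
    refine lintegral_congr fun a => ?_
    by_cases ha : q ^ k < X a
    · rw [Set.indicator_of_mem (by exact ha), if_pos ha]
    · rw [Set.indicator_of_notMem (by exact ha), if_neg ha, ENNReal.ofReal_zero]
  simp only [h1]
  rw [← lintegral_tsum fun k => ((Measurable.ite (measurableSet_lt measurable_const hXm)
    measurable_const measurable_const).ennreal_ofReal).aemeasurable]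
  refine ne_top_of_le_ne_top (hXi.const_mul 2).lintegral_lt_top.ne (lintegral_mono fun a => ?_)
  refine ENNReal.tsum_le_of_sum_range_le fun n => ?_
  rw [← ENNReal.ofReal_sum_of_nonneg fun k _ => by split_ifs <;> positivity]
  exact ENNReal.ofReal_le_ofReal (sum_pow_lt_le hq (hX0 a) n)

/-- The counterpart for truncated second moments: an integrable variable suffices for the Chebyshev
bounds along the scales to be summable. -/
lemma tsum_inv_pow_mul_integral_ne_top [IsFiniteMeasure m] {q : ℝ} (hq : 2 ≤ q) (hXm : Measurable X)
    (hX0 : ∀ a, 0 ≤ X a) (hXi : Integrable X m) :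
    ∑' k : ℕ, ENNReal.ofReal ((q ^ k)⁻¹ * ∫ a, (if X a ≤ q ^ k then X a ^ 2 else 0) ∂m) ≠ ⊤ := by
  have hq0 : 0 < q := by linarith
  have hm : ∀ k : ℕ, Measurable fun a => if X a ≤ q ^ k then X a ^ 2 else 0 := fun k =>
    Measurable.ite (measurableSet_le hXm measurable_const) (hXm.pow_const 2) measurable_const
  have h0 : ∀ (k : ℕ) a, 0 ≤ (if X a ≤ q ^ k then X a ^ 2 else 0) := fun k a => by
    split_ifs <;> positivity
  have hi : ∀ k : ℕ, Integrable (fun a => if X a ≤ q ^ k then X a ^ 2 else 0) m := by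
    intro k
    refine Integrable.of_bound (hm k).aestronglyMeasurable ((q ^ k) ^ 2)
      (Eventually.of_forall fun a => ?_)
    rw [Real.norm_eq_abs, abs_of_nonneg (h0 k a)]
    split_ifs with h
    · exact pow_le_pow_left₀ (hX0 a) h 2
    · positivity
  have h1 : ∀ k : ℕ, ENNReal.ofReal ((q ^ k)⁻¹ * ∫ a, (if X a ≤ q ^ k then X a ^ 2 else 0) ∂m) =
      ∫⁻ a, ENNReal.ofReal ((q ^ k)⁻¹ * (if X a ≤ q ^ k then X a ^ 2 else 0)) ∂m := by
    intro k
    rw [← integral_const_mul, ofReal_integral_eq_lintegral_ofReal ((hi k).const_mul _)]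
    exact Eventually.of_forall fun a => mul_nonneg (by positivity) (h0 k a)
  simp only [h1]
  rw [← lintegral_tsum fun k => (((hm k).const_mul _).ennreal_ofReal).aemeasurable]
  refine ne_top_of_le_ne_top (hXi.const_mul 2).lintegral_lt_top.ne (lintegral_mono fun a => ?_)
  refine ENNReal.tsum_le_of_sum_range_le fun n => ?_
  rw [← ENNReal.ofReal_sum_of_nonneg fun k _ => mul_nonneg (by positivity) (h0 k a)]
  exact ENNReal.ofReal_le_ofReal (sum_inv_pow_mul_sq_le hq (hX0 a) n)

end DyadicTruncation

/-! ### A crude almost sure bound for `U`-statistics with integrable kernel. -/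

section AlmostSureBound

lemma pairSum_mono {E : Type u} {Θ : Type v} {U : E → E → ℝ} (hU0 : ∀ a b, 0 ≤ U a b) (x : ℕ → Θ → E) {n m : ℕ}
    (h : n ≤ m) (θ : Θ) : pairSum U x n θ ≤ pairSum U x m θ :=
  Finset.sum_le_sum_of_subset_of_nonneg
    (Finset.offDiag_mono (Finset.range_subset_range.2 h)) fun _ _ _ => hU0 _ _

variable {E : Type u} [MeasurableSpace E] {μ : Measure E} {Θ : Type v} [MeasurableSpace Θ]
  {P : Measure Θ}

/-- Almost surely, a `U`-statistic with symmetric non-negative kernel is eventually at most a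
constant multiple of its mean. -/
theorem ae_eventually_pairSum_le [IsProbabilityMeasure P] [IsProbabilityMeasure μ]
    {x : ℕ → Θ → E} (h : IsIIDSample μ P x) {U : E → E → ℝ}
    (hU : Measurable fun z : E × E => U z.1 z.2) (hU0 : ∀ a b, 0 ≤ U a b)
    (hUs : ∀ a b, U a b = U b a) (hUi : Integrable (fun z : E × E => U z.1 z.2) (μ.prod μ))
    {c : ℝ} (hc : 0 < c) (hm : ∫ z, U z.1 z.2 ∂(μ.prod μ) ≤ c) :
    ∀ᵐ θ ∂P, ∀ᶠ n : ℕ in atTop, pairSum U x n θ ≤ 8 * c * n ^ 2 := by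
  set w : E → ℝ := fun a => ∫ b, U a b ∂μ with hw
  have hwm : Measurable w := hU.stronglyMeasurable.integral_prod_right.measurable
  have hw0 : ∀ a, 0 ≤ w a := fun a => integral_nonneg fun b => hU0 a b
  have hwi : Integrable w μ := hUi.integral_prod_left
  have hae : ∀ᵐ a ∂μ, Integrable (fun b => U a b) μ := hUi.prod_right_ae
  -- At scale `k` there are `2 ^ k` points and fewer than `4 ^ k` ordered pairs; the kernel is
  -- truncated at the number of pairs and its conditional mean `w` at the number of points. The
  -- second truncation is needed because `w` governs the `n ^ 3` term of the variance and is only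
  -- integrable.
  set K : ℕ → E → E → ℝ := fun k a b =>
    if U a b ≤ 4 ^ k ∧ w a ≤ 2 ^ k ∧ w b ≤ 2 ^ k then U a b else 0 with hK
  have hKm : ∀ k, Measurable fun z : E × E => K k z.1 z.2 := by
    intro k
    refine Measurable.ite ?_ hU measurable_const
    exact (measurableSet_le hU measurable_const).inter
      ((measurableSet_le (hwm.comp measurable_fst) measurable_const).inter
        (measurableSet_le (hwm.comp measurable_snd) measurable_const))
  have hK0 : ∀ k a b, 0 ≤ K k a b := fun k a b => by
    simp only [hK]; split_ifs
    · exact hU0 a b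
    · exact le_rfl
  have hKU : ∀ k a b, K k a b ≤ U a b := fun k a b => by
    simp only [hK]; split_ifs
    · exact le_rfl
    · exact hU0 a b
  have hKC : ∀ k a b, K k a b ≤ 4 ^ k := fun k a b => by
    simp only [hK]; split_ifs with h
    · exact h.1
    · positivity
  have hKs : ∀ k a b, K k a b = K k b a := fun k a b => by
    simp only [hK, hUs a b, and_comm (a := w a ≤ 2 ^ k)]
  have hKi : ∀ k, Integrable (fun z : E × E => K k z.1 z.2) (μ.prod μ) := fun k =>
    hUi.mono' (hKm k).aestronglyMeasurable (Eventually.of_forall fun z => by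
      rw [Real.norm_eq_abs, abs_of_nonneg (hK0 _ _ _)]; exact hKU _ _ _)
  have hKmean : ∀ k, ∫ z, K k z.1 z.2 ∂(μ.prod μ) ≤ c := fun k =>
    (integral_mono (hKi k) hUi fun z => hKU _ _ _).trans hm
  have ha : ∀ k, ∫ a, (∫ b, K k a b ∂μ) ^ 2 ∂μ ≤
      ∫ a, (if w a ≤ 2 ^ k then w a ^ 2 else 0) ∂μ := by
    intro k
    refine integral_mono_of_nonneg (Eventually.of_forall fun a => sq_nonneg _) ?_ ?_
    · refine Integrable.of_bound (Measurable.ite (measurableSet_le hwm measurable_const)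
        (hwm.pow_const 2) measurable_const).aestronglyMeasurable ((2 ^ k) ^ 2)
        (Eventually.of_forall fun a => ?_)
      rw [Real.norm_eq_abs]
      split_ifs with h
      · rw [abs_of_nonneg (sq_nonneg _)]
        exact pow_le_pow_left₀ (hw0 a) h 2
      · rw [abs_zero]; positivity
    · filter_upwards [hae] with a hai
      split_ifs with h
      · refine pow_le_pow_left₀ (integral_nonneg fun b => hK0 k a b) ?_ 2
        exact integral_mono_of_nonneg (Eventually.of_forall fun b => hK0 k a b) hai
          (Eventually.of_forall fun b => hKU k a b)
      · have : ∀ b, K k a b = 0 := fun b => by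
          simp only [hK]
          rw [if_neg]
          tauto
        simp [this]
  have hb : ∀ k, ∫ z, K k z.1 z.2 ^ 2 ∂(μ.prod μ) ≤
      ∫ z : E × E, (if U z.1 z.2 ≤ 4 ^ k then U z.1 z.2 ^ 2 else 0) ∂(μ.prod μ) := by
    intro k
    refine integral_mono_of_nonneg (Eventually.of_forall fun a => sq_nonneg _) ?_ ?_
    · refine Integrable.of_bound (Measurable.ite (measurableSet_le hU measurable_const)
        (hU.pow_const 2) measurable_const).aestronglyMeasurable ((4 ^ k) ^ 2)
        (Eventually.of_forall fun a => ?_)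
      rw [Real.norm_eq_abs]
      split_ifs with h
      · rw [abs_of_nonneg (sq_nonneg _)]
        exact pow_le_pow_left₀ (hU0 _ _) h 2
      · rw [abs_zero]; positivity
    · refine Eventually.of_forall fun z => ?_
      beta_reduce
      split_ifs with h
      · exact pow_le_pow_left₀ (hK0 _ _ _) (hKU _ _ _) 2
      · have : K k z.1 z.2 = 0 := by
          simp only [hK]
          rw [if_neg]
          tauto
        simp [this]
  -- the exceptional events
  have hB1 : ∀ᵐ θ ∂P, ∀ᶠ k : ℕ in atTop, θ ∉ {θ | ∃ e ∈ (Finset.range (2 ^ k)).offDiag,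
      4 ^ k < U (x e.1 θ) (x e.2 θ)} := by
    refine ae_eventually_notMem (ne_top_of_le_ne_top
      (tsum_pow_mul_measure_ne_top (q := 4) (by norm_num) hU (fun z => hU0 z.1 z.2) hUi)
      (ENNReal.tsum_le_tsum fun k => ?_))
    have hs : MeasurableSet {z : E × E | 4 ^ k < U z.1 z.2} :=
      measurableSet_lt measurable_const hU
    calc P {θ | ∃ e ∈ (Finset.range (2 ^ k)).offDiag, 4 ^ k < U (x e.1 θ) (x e.2 θ)}
        = P (⋃ e ∈ (Finset.range (2 ^ k)).offDiag, {θ | 4 ^ k < U (x e.1 θ) (x e.2 θ)}) := by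
          congr 1
          ext θ
          simp only [Set.mem_iUnion]
          constructor
          · rintro ⟨e, he, h⟩; exact ⟨e, he, h⟩
          · rintro ⟨e, he, h⟩; exact ⟨e, he, h⟩
      _ ≤ ∑ e ∈ (Finset.range (2 ^ k)).offDiag, P {θ | 4 ^ k < U (x e.1 θ) (x e.2 θ)} :=
          measure_biUnion_finset_le _ _
      _ = ∑ e ∈ (Finset.range (2 ^ k)).offDiag, (μ.prod μ) {z : E × E | 4 ^ k < U z.1 z.2} := by
          refine Finset.sum_congr rfl fun e he => ?_
          rw [← h.map_pair (Finset.mem_offDiag.1 he).2.2,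
            Measure.map_apply ((h.1 e.1).prodMk (h.1 e.2)) hs]
          rfl
      _ ≤ _ := by
          rw [Finset.sum_const, nsmul_eq_mul]
          gcongr
          rw [Finset.offDiag_card, Finset.card_range, show (4 : ℝ) ^ k = ((4 ^ k : ℕ) : ℝ) by simp,
            ENNReal.ofReal_natCast]
          have : 2 ^ k * 2 ^ k = 4 ^ k := by rw [← mul_pow]; norm_num
          rw [this]
          exact_mod_cast Nat.sub_le _ _
  -- Together with `hB1` this shows that eventually neither truncation changes any term.
  have hB2 : ∀ᵐ θ ∂P, ∀ᶠ k : ℕ in atTop, θ ∉ {θ | ∃ i ∈ Finset.range (2 ^ k),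
      2 ^ k < w (x i θ)} := by
    refine ae_eventually_notMem (ne_top_of_le_ne_top
      (tsum_pow_mul_measure_ne_top (q := 2) (by norm_num) hwm hw0 hwi)
      (ENNReal.tsum_le_tsum fun k => ?_))
    have hs : MeasurableSet {a : E | 2 ^ k < w a} := measurableSet_lt measurable_const hwm
    calc P {θ | ∃ i ∈ Finset.range (2 ^ k), 2 ^ k < w (x i θ)}
        = P (⋃ i ∈ Finset.range (2 ^ k), {θ | 2 ^ k < w (x i θ)}) := by
          congr 1
          ext θ
          simp only [Set.mem_iUnion]
          constructor
          · rintro ⟨e, he, h⟩; exact ⟨e, he, h⟩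
          · rintro ⟨e, he, h⟩; exact ⟨e, he, h⟩
      _ ≤ ∑ i ∈ Finset.range (2 ^ k), P {θ | 2 ^ k < w (x i θ)} :=
          measure_biUnion_finset_le _ _
      _ = ∑ i ∈ Finset.range (2 ^ k), μ {a : E | 2 ^ k < w a} := by
          refine Finset.sum_congr rfl fun i _ => ?_
          have hi := congrArg (fun ν : Measure E => ν {a : E | 2 ^ k < w a}) (h.2.2 i)
          rw [← hi, Measure.map_apply (h.1 i) hs]
          rfl
      _ ≤ _ := by
          rw [Finset.sum_const, nsmul_eq_mul]
          gcongr
          rw [Finset.card_range, show (2 : ℝ) ^ k = ((2 ^ k : ℕ) : ℝ) by simp,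
            ENNReal.ofReal_natCast]
  -- Chebyshev for the truncated statistic: the two variance terms, divided by the square of the
  -- deviation, are summable by `tsum_inv_pow_mul_integral_ne_top` with ratios 2 and 4.
  have hB3 : ∀ᵐ θ ∂P, ∀ᶠ k : ℕ in atTop,
      θ ∉ {θ | 2 * c * ((2 ^ k : ℕ) : ℝ) ^ 2 ≤ pairSum (K k) x (2 ^ k) θ} := by
    have t1 := tsum_inv_pow_mul_integral_ne_top (q := 2) (by norm_num) hwm hw0 hwi
    have t2 := tsum_inv_pow_mul_integral_ne_top (q := 4) (by norm_num) hU
      (fun z => hU0 z.1 z.2) hUi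
    have hfin : ∑' k : ℕ, (ENNReal.ofReal (4 / c ^ 2) *
          ENNReal.ofReal ((2 ^ k)⁻¹ * ∫ a, (if w a ≤ 2 ^ k then w a ^ 2 else 0) ∂μ) +
        ENNReal.ofReal (2 / c ^ 2) * ENNReal.ofReal ((4 ^ k)⁻¹ *
          ∫ z : E × E, (if U z.1 z.2 ≤ 4 ^ k then U z.1 z.2 ^ 2 else 0) ∂(μ.prod μ))) ≠ ⊤ := by
      rw [ENNReal.tsum_add, ENNReal.tsum_mul_left, ENNReal.tsum_mul_left]
      exact ENNReal.add_ne_top.2 ⟨ENNReal.mul_ne_top ENNReal.ofReal_ne_top t1,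
        ENNReal.mul_ne_top ENNReal.ofReal_ne_top t2⟩
    refine ae_eventually_notMem (ne_top_of_le_ne_top hfin (ENNReal.tsum_le_tsum fun k => ?_))
    · refine (measure_pairSum_ge_le h (hKm k) (hK0 k) (hKC k) (hKs k) (by positivity) hc
        (hKmean k)).trans ?_
      rw [← ENNReal.ofReal_mul (by positivity), ← ENNReal.ofReal_mul (by positivity)]
      refine ENNReal.ofReal_add_le.trans ?_
      gcongr ?_ + ?_
      · refine ENNReal.ofReal_le_ofReal ?_
        push_cast
        have := ha k
        gcongr
      · refine ENNReal.ofReal_le_ofReal ?_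
        have h4 : ((2 ^ k : ℕ) : ℝ) ^ 2 = 4 ^ k := by
          push_cast
          rw [← pow_mul, mul_comm, pow_mul]
          norm_num
        rw [h4]
        have := hb k
        gcongr
  filter_upwards [hB1, hB2, hB3] with θ h1 h2 h3
  obtain ⟨k₀, hk₀⟩ := eventually_atTop.1 (h1.and (h2.and h3))
  filter_upwards [eventually_ge_atTop (2 ^ k₀)] with n hn
  have hn0 : n ≠ 0 := (lt_of_lt_of_le (by positivity) hn).ne'
  have hlog : k₀ ≤ Nat.log 2 n := Nat.le_log_of_pow_le (by norm_num) hn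
  obtain ⟨g1, g2, g3⟩ := hk₀ (Nat.log 2 n + 1) (by omega)
  -- Since the terms are non-negative, `n` may be rounded up to a power of two. As `2 ^ k ≤ 2 n`,
  -- this costs a factor 4 and turns the constant 2 into 8.
  set k := Nat.log 2 n + 1 with hk
  have hnk : n ≤ 2 ^ k := (Nat.lt_pow_succ_log_self (by norm_num) n).le
  have hkn : ((2 ^ k : ℕ) : ℝ) ≤ 2 * n := by
    have : 2 ^ k ≤ 2 * n := by
      rw [hk, pow_succ, mul_comm]
      exact Nat.mul_le_mul_left 2 (Nat.pow_log_le_self 2 hn0)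
    exact_mod_cast this
  push Not at g1 g2 g3
  have heq : pairSum U x (2 ^ k) θ = pairSum (K k) x (2 ^ k) θ := by
    refine Finset.sum_congr rfl fun e he => ?_
    have he' := Finset.mem_offDiag.1 he
    simp only [hK]
    rw [if_pos ⟨g1 e he, g2 _ he'.1, g2 _ he'.2.1⟩]
  calc pairSum U x n θ ≤ pairSum U x (2 ^ k) θ := pairSum_mono hU0 x hnk θ
    _ ≤ 2 * c * ((2 ^ k : ℕ) : ℝ) ^ 2 := by rw [heq]; exact g3.le
    _ ≤ 2 * c * (2 * n) ^ 2 := by gcongr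
    _ = 8 * c * n ^ 2 := by ring

end AlmostSureBound

/-! ### Approximation of kernels by step kernels, and of graphons by block models. -/

section StepKernels

variable {E : Type u} [MeasurableSpace E] {μ : Measure E}

lemma measurable_simpleFunc_kernel (t : SimpleFunc E ℕ) (B : ℕ → ℕ → ℝ) :
    Measurable fun z : E × E => B (t z.1) (t z.2) :=
  (measurable_of_countable fun e : ℕ × ℕ => B e.1 e.2).comp
    ((t.measurable.comp measurable_fst).prodMk (t.measurable.comp measurable_snd))

lemma exists_abs_simpleFunc_kernel_le (t : SimpleFunc E ℕ) (B : ℕ → ℕ → ℝ) :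
    ∃ C, 0 ≤ C ∧ ∀ a b, |B (t a) (t b)| ≤ C := by
  refine ⟨∑ e ∈ t.range ×ˢ t.range, |B e.1 e.2|, Finset.sum_nonneg fun _ _ => abs_nonneg _,
    fun a b => ?_⟩
  exact Finset.single_le_sum (f := fun e : ℕ × ℕ => |B e.1 e.2|) (fun _ _ => abs_nonneg _)
    (Finset.mk_mem_product (t.mem_range_self a) (t.mem_range_self b))

lemma integrable_simpleFunc_kernel [IsFiniteMeasure μ] (t : SimpleFunc E ℕ) (B : ℕ → ℕ → ℝ) :
    Integrable (fun z : E × E => B (t z.1) (t z.2)) (μ.prod μ) := by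
  obtain ⟨C, -, hC⟩ := exists_abs_simpleFunc_kernel_le t B
  exact Integrable.of_bound (measurable_simpleFunc_kernel t B).aestronglyMeasurable C
    (Eventually.of_forall fun z => hC _ _)

/-- The sets `{z | R (t z.1) (t z.2)}` with `t` a simple function. -/
def stepSets (E : Type u) [MeasurableSpace E] : Set (Set (E × E)) :=
  {s | ∃ (t : SimpleFunc E ℕ) (R : ℕ → ℕ → Prop), s = {z | R (t z.1) (t z.2)}}

/-- The common refinement of two simple functions. -/
def pairSimpleFunc (t t' : SimpleFunc E ℕ) : SimpleFunc E ℕ :=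
  (t.pair t').map fun e => Nat.pair e.1 e.2

lemma unpair_pairSimpleFunc (t t' : SimpleFunc E ℕ) (a : E) :
    Nat.unpair (pairSimpleFunc t t' a) = (t a, t' a) := by
  simp [pairSimpleFunc]

/-- Step sets are the finite unions of measurable rectangles; unions are formed over the common
refinement of the two partitions. -/
lemma isSetAlgebra_stepSets : IsSetAlgebra (stepSets E) where
  empty_mem := ⟨SimpleFunc.const E 0, fun _ _ => False, by ext; simp⟩
  compl_mem := by
    rintro s ⟨t, R, rfl⟩
    exact ⟨t, fun a b => ¬ R a b, rfl⟩
  union_mem := by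
    rintro s s' ⟨t, R, rfl⟩ ⟨t', R', rfl⟩
    refine ⟨pairSimpleFunc t t', fun a b => R a.unpair.1 b.unpair.1 ∨ R' a.unpair.2 b.unpair.2, ?_⟩
    ext z
    simp [unpair_pairSimpleFunc]

lemma generateFrom_stepSets :
    (Prod.instMeasurableSpace : MeasurableSpace (E × E)) =
      MeasurableSpace.generateFrom (stepSets E) := by
  refine le_antisymm ?_ (MeasurableSpace.generateFrom_le ?_)
  · rw [← generateFrom_prod]
    refine MeasurableSpace.generateFrom_le ?_
    rintro _ ⟨s, hs, s', hs', rfl⟩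
    refine MeasurableSpace.measurableSet_generateFrom
      ⟨pairSimpleFunc (SimpleFunc.piecewise s hs (SimpleFunc.const E 1) (SimpleFunc.const E 0))
        (SimpleFunc.piecewise s' hs' (SimpleFunc.const E 1) (SimpleFunc.const E 0)),
        fun a b => a.unpair.1 = 1 ∧ b.unpair.2 = 1, ?_⟩
    ext z
    by_cases h : z.1 ∈ s <;> by_cases h' : z.2 ∈ s' <;> simp [unpair_pairSimpleFunc, h, h']
  · rintro _ ⟨t, R, rfl⟩
    have : {z : E × E | R (t z.1) (t z.2)} =
        (fun z : E × E => (t z.1, t z.2)) ⁻¹' {e : ℕ × ℕ | R e.1 e.2} := rfl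
    rw [this]
    exact ((t.measurable.comp measurable_fst).prodMk (t.measurable.comp measurable_snd))
      (Set.to_countable _).measurableSet

/-- Step sets form an algebra that generates the product σ-algebra, so they approximate measurable
sets in measure. As step kernels are closed under addition, they are dense in `L¹`. -/
lemma exists_simpleFunc_kernel_aux [IsFiniteMeasure μ] {f : E × E → ℝ}
    (hf : Integrable f (μ.prod μ)) {η : ℝ} (hη : 0 < η) :
    ∃ (t : SimpleFunc E ℕ) (B : ℕ → ℕ → ℝ),
      ∫ z, |f z - B (t z.1) (t z.2)| ∂(μ.prod μ) ≤ η := by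
  classical
  have key : ∃ g : E × E → ℝ, eLpNorm (f - g) 1 (μ.prod μ) ≤ ENNReal.ofReal η ∧
      ∃ (t : SimpleFunc E ℕ) (B : ℕ → ℕ → ℝ), g = fun z => B (t z.1) (t z.2) := by
    refine (memLp_one_iff_integrable.2 hf).induction_dense (p := 1) (by simp)
      (fun g => ∃ (t : SimpleFunc E ℕ) (B : ℕ → ℕ → ℝ), g = fun z => B (t z.1) (t z.2))
      (fun c s hs _ ε hε => ?_) ?_ ?_ (ε := ENNReal.ofReal η) (by simpa using hη)
    · obtain ⟨δ, hδ, hδε⟩ : ∃ δ : ℝ, 0 < δ ∧ ‖c‖ₑ * ENNReal.ofReal δ ≤ ε := by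
        rcases eq_or_ne ε ⊤ with rfl | hε'
        · exact ⟨1, one_pos, le_top⟩
        · have hε0 : 0 < ε.toReal := ENNReal.toReal_pos hε hε'
          refine ⟨ε.toReal / (|c| + 1), by positivity, ?_⟩
          rw [← ofReal_norm, Real.norm_eq_abs, ← ENNReal.ofReal_mul (abs_nonneg _)]
          refine ENNReal.ofReal_le_of_le_toReal ?_
          rw [← mul_div_assoc, div_le_iff₀ (by positivity)]
          nlinarith [abs_nonneg c]
      obtain ⟨s', ⟨t, R, rfl⟩, hs'⟩ := (Measure.MeasureDense.of_generateFrom_isSetAlgebra_finite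
        (μ := μ.prod μ) isSetAlgebra_stepSets generateFrom_stepSets).approx s hs
          (measure_ne_top _ _) δ hδ
      refine ⟨_, le_trans ?_ hδε, t, fun a b => if R a b then c else 0, rfl⟩
      have heq : (fun z : E × E => if R (t z.1) (t z.2) then c else 0) =
          {z : E × E | R (t z.1) (t z.2)}.indicator fun _ => c := by
        ext z
        by_cases h : R (t z.1) (t z.2)
        · rw [if_pos h, Set.indicator_of_mem (by exact h)]
        · rw [if_neg h, Set.indicator_of_notMem (by exact h)]
      rw [heq, eLpNorm_indicator_sub_indicator]
      refine (eLpNorm_indicator_const_le c 1).trans ?_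
      simp only [ENNReal.toReal_one, div_one, ENNReal.rpow_one]
      gcongr
      rw [symmDiff_comm]
      exact hs'.le
    · rintro _ _ ⟨t, B, rfl⟩ ⟨t', B', rfl⟩
      refine ⟨pairSimpleFunc t t', fun a b => B a.unpair.1 b.unpair.1 + B' a.unpair.2 b.unpair.2, ?_⟩
      ext z
      simp [unpair_pairSimpleFunc]
    · rintro _ ⟨t, B, rfl⟩
      exact (measurable_simpleFunc_kernel t B).aestronglyMeasurable
  obtain ⟨g, hg, t, B, rfl⟩ := key
  refine ⟨t, B, ?_⟩
  rw [eLpNorm_one_eq_lintegral_enorm] at hg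
  have hi : Integrable (fun z => f z - B (t z.1) (t z.2)) (μ.prod μ) :=
    hf.sub (integrable_simpleFunc_kernel t B)
  rw [integral_eq_lintegral_of_nonneg_ae (Eventually.of_forall fun z => abs_nonneg _)
    hi.abs.aestronglyMeasurable]
  refine ENNReal.toReal_le_of_le_ofReal hη.le (le_trans (lintegral_mono fun z => ?_) hg)
  rw [← Real.norm_eq_abs, ofReal_norm]
  exact le_rfl

/-- A symmetric non-negative integrable kernel is approximated in `L¹` by symmetric non-negative
step kernels. -/
theorem exists_simpleFunc_kernel [IsFiniteMeasure μ] {U : E → E → ℝ} (hU0 : ∀ a b, 0 ≤ U a b)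
    (hUs : ∀ a b, U a b = U b a) (hUi : Integrable (fun z : E × E => U z.1 z.2) (μ.prod μ))
    {η : ℝ} (hη : 0 < η) :
    ∃ (t : SimpleFunc E ℕ) (B : ℕ → ℕ → ℝ), (∀ a b, 0 ≤ B a b) ∧ (∀ a b, B a b = B b a) ∧
      ∫ z : E × E, |U z.1 z.2 - B (t z.1) (t z.2)| ∂(μ.prod μ) ≤ η := by
  obtain ⟨t, B, hB⟩ := exists_simpleFunc_kernel_aux hUi hη
  -- Symmetrizing and taking the positive part do not increase the distance from a symmetric
  -- non-negative kernel.
  refine ⟨t, fun a b => max 0 ((B a b + B b a) / 2), fun a b => le_max_left _ _,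
    fun a b => by simp only [add_comm], ?_⟩
  set D : E × E → ℝ := fun z => |U z.1 z.2 - B (t z.1) (t z.2)| with hD
  have hDi : Integrable D (μ.prod μ) := (hUi.sub (integrable_simpleFunc_kernel t B)).abs
  have hDi' : Integrable (fun z => D z.swap) (μ.prod μ) := hDi.swap
  have hpt : ∀ z : E × E, |U z.1 z.2 - max 0 ((B (t z.1) (t z.2) + B (t z.2) (t z.1)) / 2)| ≤
      1 / 2 * (D z + D z.swap) := by
    intro z
    have h1 : U z.1 z.2 = max 0 (U z.1 z.2) := (max_eq_right (hU0 _ _)).symm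
    have h2 := abs_max_sub_max_le_abs (U z.1 z.2) ((B (t z.1) (t z.2) + B (t z.2) (t z.1)) / 2) 0
    rw [max_comm _ 0, max_comm _ 0, ← h1] at h2
    refine h2.trans ?_
    simp only [hD, Prod.fst_swap, Prod.snd_swap, hUs z.2 z.1]
    have h3 := abs_add_le (U z.1 z.2 - B (t z.1) (t z.2)) (U z.1 z.2 - B (t z.2) (t z.1))
    rw [show U z.1 z.2 - (B (t z.1) (t z.2) + B (t z.2) (t z.1)) / 2 =
      1 / 2 * (U z.1 z.2 - B (t z.1) (t z.2) + (U z.1 z.2 - B (t z.2) (t z.1))) by ring, abs_mul,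
      abs_of_pos (by norm_num : (0 : ℝ) < 1 / 2)]
    linarith
  calc _ ≤ ∫ z, 1 / 2 * (D z + D z.swap) ∂(μ.prod μ) :=
        integral_mono_of_nonneg (Eventually.of_forall fun z => abs_nonneg _)
          ((hDi.add hDi').const_mul _) (Eventually.of_forall hpt)
    _ = ∫ z, D z ∂(μ.prod μ) := by
        rw [integral_const_mul, integral_add (f := D) (g := fun z => D z.swap) hDi hDi',
          integral_prod_swap]
        ring
    _ ≤ η := hB

/-- A graphon is approximated in `L¹` by block models all of whose blocks have positive size. -/
theorem Graphon.exists_blockModel_approx {π : Measure E} [IsProbabilityMeasure π]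
    (W : Graphon E π) {η : ℝ} (hη : 0 < η) :
    ∃ V : BlockModel, (∀ i, 0 < V.p i) ∧ ∃ ν : Measure (E × Fin V.k), IsCoupling π V.measure ν ∧
      ∫ a : (E × Fin V.k) × (E × Fin V.k), |W.toFun a.1.1 a.2.1 - V.B a.1.2 a.2.2| ∂(ν.prod ν) ≤
        η := by
  classical
  obtain ⟨t, B, hB0, hBs, hB⟩ := exists_simpleFunc_kernel W.nonneg' W.symm' W.integrable' hη
  -- Only level sets of positive measure become blocks. The remaining ones are jointly null, and `r`
  -- below sends them to an arbitrary block.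
  set S : Finset ℕ := t.range.filter fun c => π (t ⁻¹' {c}) ≠ 0 with hS
  have haeS : ∀ᵐ a ∂π, t a ∈ S := by
    have : ∀ᵐ a ∂π, ∀ c ∈ t.range, π (t ⁻¹' {c}) = 0 → t a ≠ c := by
      refine (Finset.eventually_all t.range).2 fun c _ => ?_
      by_cases hc : π (t ⁻¹' {c}) = 0
      · have : ∀ᵐ a ∂π, a ∉ t ⁻¹' {c} := measure_eq_zero_iff_ae_notMem.1 hc
        filter_upwards [this] with a ha _ h
        exact ha h
      · exact Eventually.of_forall fun a h => absurd h hc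
    filter_upwards [this] with a ha
    refine Finset.mem_filter.2 ⟨t.mem_range_self a, fun h => ?_⟩
    exact ha _ (t.mem_range_self a) h rfl
  obtain ⟨a₀, ha₀⟩ := haeS.exists
  set e := S.equivFin with he
  set r : ℕ → Fin S.card := fun c => if h : c ∈ S then e ⟨c, h⟩ else e ⟨t a₀, ha₀⟩ with hr
  have hr' : ∀ c (h : c ∈ S), ((e.symm (r c) : S) : ℕ) = c := by
    intro c h
    simp only [hr, dif_pos h, Equiv.symm_apply_apply]
  have hrm : Measurable fun a => r (t a) := (measurable_of_countable r).comp t.measurable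
  have hpos : ∀ i, 0 < π.real ((fun a => r (t a)) ⁻¹' {i}) := by
    intro i
    rw [measureReal_def, ENNReal.toReal_pos_iff]
    refine ⟨pos_iff_ne_zero.2 fun h0 => ?_, measure_lt_top _ _⟩
    refine (Finset.mem_filter.1 (e.symm i).2).2 (measure_mono_null ?_ h0)
    intro a ha
    have ha' : t a = (e.symm i : ℕ) := ha
    have : r (t a) = i := by
      simp only [hr, ha', dif_pos (e.symm i).2, Subtype.coe_eta, Equiv.apply_symm_apply]
    exact this
  let V : BlockModel :=
    { k := S.card
      p := fun i => π.real ((fun a => r (t a)) ⁻¹' {i})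
      B := fun i j => B (e.symm i) (e.symm j)
      p_nonneg := fun i => (hpos i).le
      p_sum := by
        have h1 : (π.map fun a => r (t a)).real Set.univ = 1 := by
          have := Measure.isProbabilityMeasure_map (μ := π) hrm.aemeasurable
          simp
        have h2 := sum_measureReal_singleton (μ := π.map fun a => r (t a)) Finset.univ
        rw [Finset.coe_univ, h1] at h2
        rw [← h2]
        refine Finset.sum_congr rfl fun i _ => ?_
        rw [map_measureReal_apply hrm (measurableSet_singleton i)]
      B_symm := by ext i j; exact hBs _ _
      B_nonneg := fun i j => hB0 _ _ }
  refine ⟨V, hpos, π.map fun a => (a, r (t a)), ⟨?_, ?_⟩, ?_⟩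
  · rw [Measure.map_map measurable_fst (measurable_id'.prodMk hrm)]
    exact Measure.map_id
  · rw [Measure.map_map measurable_snd (measurable_id'.prodMk hrm)]
    refine Measure.ext_of_singleton fun i => ?_
    rw [BlockModel.measure_singleton]
    change π.map (fun a => r (t a)) {i} = _
    rw [Measure.map_apply hrm (measurableSet_singleton i)]
    exact (ENNReal.ofReal_toReal (measure_ne_top _ _)).symm
  · have hgm : Measurable fun a : E => (a, r (t a)) := measurable_id.prodMk hrm
    have hm : Measurable fun a : (E × Fin S.card) × (E × Fin S.card) =>
        |W.toFun a.1.1 a.2.1 - B (e.symm a.1.2) (e.symm a.2.2)| := by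
      refine ((W.measurable'.comp (by fun_prop : Measurable fun
        a : (E × Fin S.card) × (E × Fin S.card) => (a.1.1, a.2.1))).sub ?_).abs
      exact (measurable_of_countable fun q : Fin S.card × Fin S.card =>
        B (e.symm q.1) (e.symm q.2)).comp (by fun_prop : Measurable fun
        a : (E × Fin S.card) × (E × Fin S.card) => (a.1.2, a.2.2))
    have := Measure.isProbabilityMeasure_map (μ := π) hgm.aemeasurable
    refine le_trans (le_of_eq ?_) hB
    rw [Measure.map_prod_map _ _ hgm hgm]
    refine (integral_map (by fun_prop) hm.aestronglyMeasurable).trans ?_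
    refine integral_congr_ae ?_
    have h1 : ∀ᵐ z ∂(π.prod π), t z.1 ∈ S := by
      have := (measurePreserving_fst (μ := π) (ν := π)).quasiMeasurePreserving.ae haeS
      exact this
    have h2 : ∀ᵐ z ∂(π.prod π), t z.2 ∈ S := by
      have := (measurePreserving_snd (μ := π) (ν := π)).quasiMeasurePreserving.ae haeS
      exact this
    filter_upwards [h1, h2] with z hz1 hz2
    simp only [Prod.map_fst, Prod.map_snd, hr' _ hz1, hr' _ hz2]

end StepKernels

/-! ### The upper half of the strong law for `U`-statistics. -/

section UStatisticLaw

variable {E : Type u} [MeasurableSpace E] {μ : Measure E} {Θ : Type v} [MeasurableSpace Θ]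
  {P : Measure Θ}

/-- The strong law of large numbers for a function of an i.i.d. sample. -/
lemma IsIIDSample.ae_tendsto_average {x : ℕ → Θ → E} (h : IsIIDSample μ P x) {f : E → ℝ}
    (hf : Measurable f) (hfi : Integrable f μ) :
    ∀ᵐ θ ∂P, Tendsto (fun n : ℕ => (∑ i ∈ Finset.range n, f (x i θ)) / n) atTop
      (𝓝 (∫ a, f a ∂μ)) := by
  have h1 := strong_law_ae_real (μ := P) (fun i θ => f (x i θ)) (h.integrable_comp 0 hfi)
    (fun i j hij => (h.2.1.indepFun hij).comp hf hf)
    (fun i => (IdentDistrib.mk (h.1 i).aemeasurable (h.1 0).aemeasurable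
      ((h.2.2 i).trans (h.2.2 0).symm)).comp hf)
  rwa [h.integral_comp 0 hf] at h1

lemma integral_simpleFunc_comp [IsFiniteMeasure μ] (t : SimpleFunc E ℕ) (g : ℕ → ℝ) :
    ∫ a, g (t a) ∂μ = ∑ c ∈ t.range, μ.real (t ⁻¹' {c}) * g c := by
  have h1 : ∀ a, g (t a) = ∑ c ∈ t.range, (t ⁻¹' {c}).indicator (fun _ => g c) a := by
    intro a
    rw [Finset.sum_eq_single_of_mem (t a) (t.mem_range_self a)]
    · rw [Set.indicator_of_mem (by exact rfl)]
    · intro c _ hc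
      exact Set.indicator_of_notMem (fun h : t a = c => hc h.symm) _
  simp only [h1]
  rw [integral_finsetSum _ fun c _ =>
    (integrable_const _).indicator (t.measurableSet_fiber c)]
  refine Finset.sum_congr rfl fun c _ => ?_
  rw [integral_indicator_const _ (t.measurableSet_fiber c), smul_eq_mul]

/-- The law of large numbers for `V`-statistics with a step kernel. -/
lemma IsIIDSample.ae_tendsto_stepKernel [IsFiniteMeasure μ] {x : ℕ → Θ → E}
    (h : IsIIDSample μ P x) (t : SimpleFunc E ℕ) (B : ℕ → ℕ → ℝ) :
    ∀ᵐ θ ∂P, Tendsto (fun n : ℕ =>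
      (∑ i ∈ Finset.range n, ∑ j ∈ Finset.range n, B (t (x i θ)) (t (x j θ))) / (n : ℝ) ^ 2) atTop
      (𝓝 (∫ z : E × E, B (t z.1) (t z.2) ∂(μ.prod μ))) := by
  have hfi : ∀ g : ℕ → ℝ, Measurable (fun a => g (t a)) ∧ Integrable (fun a => g (t a)) μ := by
    intro g
    have := (t.map g).integrable_of_isFiniteMeasure (μ := μ)
    exact ⟨(t.map g).measurable, this⟩
  have h1 : ∀ᵐ θ ∂P, ∀ c : ℕ, Tendsto (fun n : ℕ =>
      (∑ i ∈ Finset.range n, (if t (x i θ) = c then 1 else 0 : ℝ)) / n) atTop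
      (𝓝 (∫ a, (if t a = c then 1 else 0 : ℝ) ∂μ)) :=
    ae_all_iff.2 fun c => h.ae_tendsto_average (hfi fun b => if b = c then 1 else 0).1
      (hfi fun b => if b = c then 1 else 0).2
  have h2 : ∀ᵐ θ ∂P, ∀ c : ℕ, Tendsto (fun n : ℕ =>
      (∑ j ∈ Finset.range n, B c (t (x j θ))) / n) atTop (𝓝 (∫ a, B c (t a) ∂μ)) :=
    ae_all_iff.2 fun c => h.ae_tendsto_average (hfi (B c)).1 (hfi (B c)).2
  filter_upwards [h1, h2] with θ g1 g2
  have hlim : ∫ z : E × E, B (t z.1) (t z.2) ∂(μ.prod μ) =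
      ∑ c ∈ t.range, (∫ a, (if t a = c then 1 else 0 : ℝ) ∂μ) * ∫ a, B c (t a) ∂μ := by
    rw [integral_prod _ (integrable_simpleFunc_kernel t B),
      integral_simpleFunc_comp t fun c => ∫ a, B c (t a) ∂μ]
    refine Finset.sum_congr rfl fun c hc => ?_
    congr 1
    rw [integral_simpleFunc_comp t fun b => if b = c then (1 : ℝ) else 0,
      Finset.sum_eq_single_of_mem c hc fun b _ hb => by rw [if_neg hb, mul_zero], if_pos rfl,
      mul_one]
  -- For a step kernel the `V`-statistic is a finite sum of products of two averages, so the
  -- ordinary strong law applies to each factor.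
  have hsum : ∀ n : ℕ,
      (∑ i ∈ Finset.range n, ∑ j ∈ Finset.range n, B (t (x i θ)) (t (x j θ))) / (n : ℝ) ^ 2 =
      ∑ c ∈ t.range, ((∑ i ∈ Finset.range n, (if t (x i θ) = c then 1 else 0 : ℝ)) / n) *
        ((∑ j ∈ Finset.range n, B c (t (x j θ))) / n) := by
    intro n
    have : ∀ i, ∑ j ∈ Finset.range n, B (t (x i θ)) (t (x j θ)) =
        ∑ c ∈ t.range, (if t (x i θ) = c then 1 else 0 : ℝ) *
          ∑ j ∈ Finset.range n, B c (t (x j θ)) := by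
      intro i
      rw [Finset.sum_eq_single_of_mem (t (x i θ)) (t.mem_range_self _)]
      · rw [if_pos rfl, one_mul]
      · intro c _ hc
        rw [if_neg hc.symm, zero_mul]
    simp only [this]
    rw [Finset.sum_comm, Finset.sum_div]
    refine Finset.sum_congr rfl fun c _ => ?_
    rw [← Finset.sum_mul, div_mul_div_comm, sq]
  simp only [hsum]
  rw [hlim]
  exact tendsto_finsetSum _ fun c _ => (g1 c).mul (g2 c)

/-- The upper half of the strong law of large numbers for `U`-statistics. -/
theorem IsIIDSample.ae_eventually_pairSum_le_integral [IsProbabilityMeasure P]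
    [IsProbabilityMeasure μ] {x : ℕ → Θ → E} (h : IsIIDSample μ P x) {U : E → E → ℝ}
    (hU : Measurable fun z : E × E => U z.1 z.2) (hU0 : ∀ a b, 0 ≤ U a b)
    (hUs : ∀ a b, U a b = U b a) (hUi : Integrable (fun z : E × E => U z.1 z.2) (μ.prod μ))
    {η : ℝ} (hη : 0 < η) :
    ∀ᵐ θ ∂P, ∀ᶠ n : ℕ in atTop,
      pairSum U x n θ ≤ (∫ z, U z.1 z.2 ∂(μ.prod μ) + η) * n ^ 2 := by
  -- The crude bound turns a remainder of mean `η / 10` into `8 η / 10`; the other `2 η / 10` covers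
  -- the mean of the step kernel and the convergence of its averages.
  obtain ⟨t, B, hB0, hBs, hB⟩ := exists_simpleFunc_kernel hU0 hUs hUi
    (show 0 < η / 10 by positivity)
  have hBi := integrable_simpleFunc_kernel (μ := μ) t B
  have hDi : Integrable (fun z : E × E => |U z.1 z.2 - B (t z.1) (t z.2)|) (μ.prod μ) :=
    (hUi.sub hBi).abs
  have h1 := ae_eventually_pairSum_le h (U := fun a b => |U a b - B (t a) (t b)|)
    (hU.sub (measurable_simpleFunc_kernel t B)).abs (fun a b => abs_nonneg _)
    (fun a b => by rw [hUs a b, hBs]) hDi (show 0 < η / 10 by positivity) hB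
  have hBU : ∫ z : E × E, B (t z.1) (t z.2) ∂(μ.prod μ) ≤
      ∫ z, U z.1 z.2 ∂(μ.prod μ) + η / 10 := by
    calc _ ≤ ∫ z : E × E, (U z.1 z.2 + |U z.1 z.2 - B (t z.1) (t z.2)|) ∂(μ.prod μ) := by
          refine integral_mono hBi (hUi.add hDi) fun z => ?_
          have := neg_abs_le (U z.1 z.2 - B (t z.1) (t z.2))
          change B (t z.1) (t z.2) ≤ U z.1 z.2 + |U z.1 z.2 - B (t z.1) (t z.2)|
          linarith
      _ ≤ _ := by
          rw [integral_add hUi hDi]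
          gcongr
  filter_upwards [h1, h.ae_tendsto_stepKernel t B] with θ g1 g2
  filter_upwards [g1, g2.eventually_le_const
    (show _ < ∫ z, U z.1 z.2 ∂(μ.prod μ) + 2 * (η / 10) by linarith), eventually_gt_atTop 0]
    with n e1 e2 hn
  have hn' : (0 : ℝ) < n := by exact_mod_cast hn
  rw [div_le_iff₀ (by positivity)] at e2
  have e3 : pairSum U x n θ ≤ pairSum (fun a b => |U a b - B (t a) (t b)|) x n θ +
      ∑ i ∈ Finset.range n, ∑ j ∈ Finset.range n, B (t (x i θ)) (t (x j θ)) := by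
    rw [← Finset.sum_product']
    have hsub : ∑ e ∈ (Finset.range n).offDiag, B (t (x e.1 θ)) (t (x e.2 θ)) ≤
        ∑ e ∈ Finset.range n ×ˢ Finset.range n, B (t (x e.1 θ)) (t (x e.2 θ)) :=
      Finset.sum_le_sum_of_subset_of_nonneg (fun e he => Finset.mk_mem_product
        (Finset.mem_offDiag.1 he).1 (Finset.mem_offDiag.1 he).2.1) fun e _ _ => hB0 _ _
    refine le_trans ?_ (add_le_add le_rfl hsub)
    unfold pairSum
    rw [← Finset.sum_add_distrib]
    refine Finset.sum_le_sum fun e _ => ?_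
    have := le_abs_self (U (x e.1 θ) (x e.2 θ) - B (t (x e.1 θ)) (t (x e.2 θ)))
    linarith
  have e4 : 0 ≤ η * (n : ℝ) ^ 2 := by positivity
  linarith

end UStatisticLaw

/-! ### Almost sure fit of balanced partitions. -/

section BlockFitLaw

variable {Ω : Type u} [MeasurableSpace Ω] {π : Measure Ω} {Θ : Type v} [MeasurableSpace Θ]
  {P : Measure Θ}

lemma pairSum_eq_sum_fin {E : Type u} {Θ : Type v} (U : E → E → ℝ) (x : ℕ → Θ → E) (n : ℕ) (θ : Θ) :
    pairSum U x n θ = ∑ i : Fin n, ∑ j : Fin n, if i = j then 0 else U (x i θ) (x j θ) := by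
  have h : pairSum U x n θ = ∑ i ∈ Finset.range n, ∑ j ∈ Finset.range n,
      if i = j then 0 else U (x i θ) (x j θ) := by
    rw [← Finset.sum_product', pairSum]
    refine Finset.sum_subset_zero_on_sdiff (fun e he => Finset.mk_mem_product
      (Finset.mem_offDiag.1 he).1 (Finset.mem_offDiag.1 he).2.1) (fun e he => ?_) fun e he => ?_
    · rw [Finset.mem_sdiff, Finset.mem_product, Finset.mem_offDiag] at he
      rw [if_pos]
      by_contra hne
      exact he.2 ⟨he.1.1, he.1.2, hne⟩
    · rw [if_neg (Finset.mem_offDiag.1 he).2.2]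
  rw [h, Finset.sum_range]
  refine Finset.sum_congr rfl fun i _ => ?_
  rw [Finset.sum_range]
  simp only [Fin.ext_iff]

lemma card_partClass_eq_sum_range {k : ℕ} (y : ℕ → Fin k) (n : ℕ) (i : Fin k) :
    ((partClass (fun u : Fin n => y u) i).card : ℝ) =
      ∑ u ∈ Finset.range n, if y u = i then (1 : ℝ) else 0 := by
  rw [Finset.sum_range, partClass, Finset.sum_boole]

/-- Truncation at a level above `b` only moves `w` towards `b`. For this reason no tail term appears
in the limit. -/
lemma abs_min_sub_le {w r b : ℝ} (h : b ≤ r) : |min w r - b| ≤ |w - b| := by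
  rcases le_total w r with hw | hw
  · rw [min_eq_left hw]
  · rw [min_eq_right hw, abs_of_nonneg (by linarith), abs_of_nonneg (by linarith)]
    linarith

/-- Almost surely, the fitting error of a block model is asymptotically at most its `L¹` distance
from the graphon. -/
lemma ae_eventually_blockFitError_le [IsProbabilityMeasure π] [IsProbabilityMeasure P]
    (W : Graphon Ω π) (V : BlockModel) {ν : Measure (Ω × Fin V.k)}
    (hν : IsCoupling π V.measure ν) {ρ : ℕ → ℝ} (hρ : ∀ n, 0 < ρ n)
    (hρ0 : Tendsto ρ atTop (𝓝 0)) {y : ℕ → Θ → Ω × Fin V.k} (hy : IsIIDSample ν P y) {η : ℝ}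
    (hη : 0 < η) :
    ∀ᵐ θ ∂P, ∀ᶠ n : ℕ in atTop, blockFitError W (ρ n) V (fun i : Fin n => y i θ) ≤
      ∫ a : (Ω × Fin V.k) × (Ω × Fin V.k),
        |W.toFun a.1.1 a.2.1 - V.B a.1.2 a.2.2| ∂(ν.prod ν) + η := by
  have hνp := hν.isProbabilityMeasure
  have hWm : Measurable fun a : (Ω × Fin V.k) × (Ω × Fin V.k) => W.toFun a.1.1 a.2.1 :=
    W.measurable_comp (by fun_prop) (by fun_prop)
  have hBm : Measurable fun a : (Ω × Fin V.k) × (Ω × Fin V.k) => V.B a.1.2 a.2.2 :=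
    (measurable_of_countable (fun x : Fin V.k × Fin V.k => V.B x.1 x.2)).comp
      (by fun_prop : Measurable fun a : (Ω × Fin V.k) × (Ω × Fin V.k) => (a.1.2, a.2.2))
  have hmap : (ν.prod ν).map (fun a => (a.1.1, a.2.1)) = π.prod π := by
    conv_rhs => rw [← hν.1, Measure.map_prod_map _ _ measurable_fst measurable_fst]
    rfl
  have hWi : Integrable (fun a : (Ω × Fin V.k) × (Ω × Fin V.k) => W.toFun a.1.1 a.2.1)
      (ν.prod ν) := by
    have hW := W.integrable'
    rw [← hmap] at hW
    exact hW.comp_measurable (by fun_prop)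
  have hBi : Integrable (fun a : (Ω × Fin V.k) × (Ω × Fin V.k) => V.B a.1.2 a.2.2) (ν.prod ν) :=
    integrable_prod_comp_finite ν ν measurable_snd V.B
  have h1 := hy.ae_eventually_pairSum_le_integral
    (U := fun a b => |W.toFun a.1 b.1 - V.B a.2 b.2|) (hWm.sub hBm).abs
    (fun a b => abs_nonneg _) (fun a b => by rw [W.symm', V.B_symm.apply]) (hWi.sub hBi).abs
    (show 0 < η / 2 by positivity)
  have h2 : ∀ᵐ θ ∂P, ∀ i : Fin V.k, Tendsto (fun n : ℕ =>
      (∑ u ∈ Finset.range n, if (y u θ).2 = i then (1 : ℝ) else 0) / n) atTop (𝓝 (V.p i)) := by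
    refine ae_all_iff.2 fun i => ?_
    have hm : Measurable fun a : Ω × Fin V.k => if a.2 = i then (1 : ℝ) else 0 :=
      (measurable_of_countable fun j : Fin V.k => if j = i then (1 : ℝ) else 0).comp measurable_snd
    have hs : MeasurableSet {a : Ω × Fin V.k | a.2 = i} :=
      measurable_snd (measurableSet_singleton i)
    have := hy.ae_tendsto_average hm (Integrable.of_bound hm.aestronglyMeasurable 1
      (Eventually.of_forall fun a => by split_ifs <;> simp))
    have hint : ∫ a : Ω × Fin V.k, (if a.2 = i then (1 : ℝ) else 0) ∂ν = V.p i := by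
      have heq : (fun a : Ω × Fin V.k => if a.2 = i then (1 : ℝ) else 0) =
          {a : Ω × Fin V.k | a.2 = i}.indicator fun _ => 1 := by
        ext a
        by_cases h : a.2 = i
        · rw [if_pos h, Set.indicator_of_mem (by exact h)]
        · rw [if_neg h, Set.indicator_of_notMem (by exact h)]
      rw [heq, integral_indicator_const _ hs, smul_eq_mul, mul_one]
      have h3 : ν {a : Ω × Fin V.k | a.2 = i} = ENNReal.ofReal (V.p i) := by
        rw [← V.measure_singleton, ← hν.2,
          Measure.map_apply measurable_snd (measurableSet_singleton i)]
        rfl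
      rw [measureReal_def, h3, ENNReal.toReal_ofReal (V.p_nonneg i)]
    rwa [hint] at this
  set β := ∑ i, ∑ j, V.B i j with hβ
  have hBβ : ∀ i j, V.B i j ≤ β := fun i j =>
    (Finset.single_le_sum (f := fun j => V.B i j) (fun j _ => V.B_nonneg i j)
      (Finset.mem_univ j)).trans
      (Finset.single_le_sum (f := fun i => ∑ j, V.B i j)
        (fun i _ => Finset.sum_nonneg fun j _ => V.B_nonneg i j) (Finset.mem_univ i))
  have hβ0 : 0 ≤ β := Finset.sum_nonneg fun i _ => Finset.sum_nonneg fun j _ => V.B_nonneg i j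
  -- As `ρ n` tends to zero, the truncation level eventually exceeds all entries of the fixed matrix
  -- `V.B`.
  have hρβ : ∀ᶠ n in atTop, β ≤ (ρ n)⁻¹ := by
    have := hρ0.eventually_lt_const (show (0 : ℝ) < (β + 1)⁻¹ by positivity)
    filter_upwards [this] with n hn
    have := (inv_lt_inv₀ (by positivity) (hρ n)).2 hn
    rw [inv_inv] at this
    linarith
  have hinv : Tendsto (fun n : ℕ => 1 / (n : ℝ)) atTop (𝓝 0) := tendsto_one_div_atTop_nhds_zero_nat
  filter_upwards [h1, h2] with θ g1 g2
  have hD : ∀ i, Tendsto (fun n : ℕ => classDeviation V.p (fun u : Fin n => (y u θ).2) i / n) atTop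
      (𝓝 0) := by
    intro i
    have : Tendsto (fun n : ℕ =>
        |(∑ u ∈ Finset.range n, if (y u θ).2 = i then (1 : ℝ) else 0) / n - V.p i| + 1 / n) atTop
        (𝓝 0) := by
      have := ((g2 i).sub_const (V.p i)).abs.add hinv
      simpa using this
    refine this.congr' ?_
    filter_upwards [eventually_gt_atTop 0] with n hn
    have hn' : (0 : ℝ) < n := by exact_mod_cast hn
    rw [classDeviation, card_partClass_eq_sum_range (fun u => (y u θ).2), add_div,
      ← abs_of_pos hn', ← abs_div, abs_of_pos hn']
    congr 2
    field_simp
  have hrest : Tendsto (fun n : ℕ => β * (1 / (n : ℝ)) + 4 * ∑ i, ∑ j,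
      classDeviation V.p (fun u : Fin n => (y u θ).2) i / n *
        (V.p j + classDeviation V.p (fun u : Fin n => (y u θ).2) j / n) * V.B i j) atTop (𝓝 0) := by
    have := (hinv.const_mul β).add ((tendsto_finsetSum Finset.univ fun i _ =>
      tendsto_finsetSum Finset.univ fun j _ => ((hD i).mul ((hD j).const_add (V.p j))).mul_const
        (V.B i j)).const_mul 4)
    simpa using this
  filter_upwards [g1, hρβ, hrest.eventually_le_const (show 0 < η / 2 by positivity),
    eventually_gt_atTop 0] with n e1 e2 e3 hn
  have hn' : (0 : ℝ) < n := by exact_mod_cast hn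
  have hn2 : (0 : ℝ) < (n : ℝ) ^ 2 := by positivity
  have s1 : (∑ u : Fin n, ∑ v : Fin n, if u = v then 0 else
      |min (W.toFun (y u θ).1 (y v θ).1) (ρ n)⁻¹ - V.B (y u θ).2 (y v θ).2|) ≤
      pairSum (fun a b => |W.toFun a.1 b.1 - V.B a.2 b.2|) y n θ := by
    rw [pairSum_eq_sum_fin]
    refine Finset.sum_le_sum fun u _ => Finset.sum_le_sum fun v _ => ?_
    split_ifs
    · exact le_rfl
    · exact abs_min_sub_le ((hBβ _ _).trans e2)
  have s2 : ∑ u : Fin n, V.B (y u θ).2 (y u θ).2 ≤ n * β := by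
    refine (Finset.sum_le_sum fun u _ => hBβ _ _).trans ?_
    simp
  have s3 : ∑ i, ∑ j, classDeviation V.p (fun u : Fin n => (y u θ).2) i *
      (n * V.p j + classDeviation V.p (fun u : Fin n => (y u θ).2) j) * V.B i j =
      n ^ 2 * ∑ i, ∑ j, classDeviation V.p (fun u : Fin n => (y u θ).2) i / n *
        (V.p j + classDeviation V.p (fun u : Fin n => (y u θ).2) j / n) * V.B i j := by
    rw [Finset.mul_sum]
    refine Finset.sum_congr rfl fun i _ => ?_
    rw [Finset.mul_sum]
    refine Finset.sum_congr rfl fun j _ => ?_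
    field_simp
  rw [blockFitError, div_le_iff₀ hn2, s3]
  have e4 := mul_le_mul_of_nonneg_right e3 hn2.le
  have e5 : (β * (1 / (n : ℝ))) * n ^ 2 = n * β := by field_simp
  rw [add_mul, e5] at e4
  linarith

/-- Almost surely, balanced partitions eventually fit the edge probabilities as well as the block
model fits the graphon. -/
theorem ae_eventually_exists_isBalanced [IsProbabilityMeasure π] [IsProbabilityMeasure P]
    (W : Graphon Ω π) (V : BlockModel) {ν : Measure (Ω × Fin V.k)}
    (hν : IsCoupling π V.measure ν) {ρ : ℕ → ℝ} (hρ : ∀ n, 0 < ρ n)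
    (hρ0 : Tendsto ρ atTop (𝓝 0)) {x : ℕ → Θ → Ω} (hx : IsIIDSample π P x) {η : ℝ}
    (hη : 0 < η) :
    ∀ᵐ θ ∂P, ∀ᶠ n : ℕ in atTop, ∃ z : Fin n → Fin V.k, IsBalanced V.p z ∧
      matrixL1 ((1 / ρ n) • edgeProb W (ρ n) (fun i : Fin n => x i θ) - V.B.submatrix z z) ≤
      ∫ a : (Ω × Fin V.k) × (Ω × Fin V.k),
        |W.toFun a.1.1 a.2.1 - V.B a.1.2 a.2.2| ∂(ν.prod ν) + η := by
  have hνp := hν.isProbabilityMeasure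
  set c := ∫ a : (Ω × Fin V.k) × (Ω × Fin V.k),
        |W.toFun a.1.1 a.2.1 - V.B a.1.2 a.2.2| ∂(ν.prod ν) + η with hc
  -- This event depends on the sequence of positions only and is measurable. It can therefore be
  -- transferred from the infinite product of copies of `ν`, where labels exist, to the given
  -- probability space.
  set S : Set (ℕ → Ω) := {s | ∀ᶠ n : ℕ in atTop, ∃ z : Fin n → Fin V.k, IsBalanced V.p z ∧
      matrixL1 ((1 / ρ n) • edgeProb W (ρ n) (fun i : Fin n => s i) - V.B.submatrix z z) ≤ c}
    with hS
  have hSm : MeasurableSet S := by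
    have : S = ⋃ N : ℕ, ⋂ n : ℕ, ⋂ _ : N ≤ n, ⋃ z : Fin n → Fin V.k, ⋃ _ : IsBalanced V.p z,
        {s : ℕ → Ω | matrixL1 ((1 / ρ n) • edgeProb W (ρ n) (fun i : Fin n => s i) -
          V.B.submatrix z z) ≤ c} := by
      ext s
      simp only [hS, Set.mem_iUnion, Set.mem_iInter, Set.mem_ofPred_eq, eventually_atTop,
        exists_prop]
    rw [this]
    refine MeasurableSet.iUnion fun N => MeasurableSet.iInter fun n => MeasurableSet.iInter fun _ =>
      MeasurableSet.iUnion fun z => MeasurableSet.iUnion fun _ => ?_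
    refine measurableSet_le (measurable_matrixL1 fun i j => ?_) measurable_const
    refine Measurable.sub (Measurable.const_mul ?_ (1 / ρ n)) measurable_const
    exact (measurable_edgeProb W (ρ n) i j).comp
      (by fun_prop : Measurable fun s : ℕ → Ω => fun i : Fin n => s i)
  have hfst : Measurable fun y : ℕ → Ω × Fin V.k => fun i => (y i).1 := by fun_prop
  have hmap : P.map (fun θ i => x i θ) =
      (Measure.infinitePi fun _ : ℕ => ν).map fun y i => (y i).1 := by
    rw [hx.2.1.map_fun_eq_infinitePi_map hx.1,
      Measure.infinitePi_map_pi (μ := fun _ : ℕ => ν) (f := fun _ => Prod.fst)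
        fun _ => measurable_fst]
    congr 1
    ext1 i
    rw [hx.2.2, hν.1]
  have hiid : IsIIDSample ν (Measure.infinitePi fun _ : ℕ => ν) (fun i y => y i) :=
    ⟨fun i => measurable_pi_apply i,
      iIndepFun_infinitePi (P := fun _ : ℕ => ν) (X := fun _ a => a) fun _ => measurable_id,
      fun i => Measure.infinitePi_map_eval (fun _ : ℕ => ν) i⟩
  have h1 : ∀ᵐ y ∂(Measure.infinitePi fun _ : ℕ => ν), (fun i => (y i).1) ∈ S := by
    filter_upwards [ae_eventually_blockFitError_le W V hν hρ hρ0 hiid hη] with y hy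
    filter_upwards [hy] with n hn
    obtain ⟨z, hz, hzle⟩ := exists_isBalanced_matrixL1_le W (hρ n) V fun i : Fin n => y i
    exact ⟨z, hz, hzle.trans hn⟩
  have h2 : ∀ᵐ s ∂(P.map fun θ i => x i θ), s ∈ S := by
    rw [hmap]
    exact (ae_map_iff hfst.aemeasurable hSm).2 h1
  exact (ae_map_iff (measurable_pi_lambda _ hx.1).aemeasurable hSm).1 h2

end BlockFitLaw

/-! ### Almost sure concentration in the cut norm. -/

section CutNormLaw

variable {Ω : Type u} [MeasurableSpace Ω] {π : Measure Ω} {Θ : Type v} [MeasurableSpace Θ]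
  {P : Measure Θ}

/-- Because `n ρ n` diverges, the exponent is eventually at least `n log 8`, which leaves a
geometric series with ratio `1 / 2`. -/
lemma summable_four_pow_mul_exp {c : ℝ} (hc : 0 < c) {ρ : ℕ → ℝ}
    (hρ : Tendsto (fun n : ℕ => n * ρ n) atTop atTop) :
    Summable fun n : ℕ => 2 * 4 ^ n * Real.exp (-(c * (ρ n * n ^ 2))) := by
  refine Summable.of_norm_bounded_eventually_nat (g := fun n : ℕ => 2 * (1 / 2 : ℝ) ^ n)
    (summable_geometric_two.mul_left 2) ?_
  filter_upwards [hρ.eventually_ge_atTop (Real.log 8 / c)] with n hn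
  rw [Real.norm_eq_abs, abs_of_nonneg (by positivity), mul_assoc]
  rw [div_le_iff₀ hc] at hn
  have h1 : Real.exp (-(c * (ρ n * n ^ 2))) ≤ (1 / 8 : ℝ) ^ n := by
    have h8 : (1 / 8 : ℝ) ^ n = Real.exp (-(n * Real.log 8)) := by
      rw [Real.exp_neg, Real.exp_nat_mul, Real.exp_log (by norm_num), one_div, inv_pow]
    rw [h8]
    refine Real.exp_le_exp.2 (neg_le_neg ?_)
    have := mul_le_mul_of_nonneg_left hn (Nat.cast_nonneg (α := ℝ) n)
    linarith
  calc 2 * (4 ^ n * Real.exp (-(c * (ρ n * n ^ 2)))) ≤ 2 * (4 ^ n * (1 / 8 : ℝ) ^ n) := by gcongr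
    _ = 2 * (1 / 2 : ℝ) ^ n := by rw [← mul_pow]; norm_num

/-- Almost surely, the adjacency matrix is eventually close in cut norm to the edge
probabilities. -/
theorem ae_eventually_cutNorm_le [IsProbabilityMeasure π] [IsProbabilityMeasure P]
    (W : Graphon Ω π) (hW : W.Normalized) {ρ : ℕ → ℝ} (hρ : ∀ n, 0 < ρ n)
    (hρn : Tendsto (fun n : ℕ => n * ρ n) atTop atTop) {x : ℕ → Θ → Ω}
    (hx : IsIIDSample π P x) {G : (n : ℕ) → Θ → SimpleGraph (Fin n)}
    (hG : ∀ n, IsWRandomGraph W (ρ n) P (fun i : Fin n => x i) (G n)) {η : ℝ} (hη : 0 < η) :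
    ∀ᵐ θ ∂P, ∀ᶠ n : ℕ in atTop, 1 / ρ n * matrixCutNorm (adjacency (G n θ) -
      edgeProb W (ρ n) fun i : Fin n => x i θ) ≤ η := by
  have hW1 : ∫ z : Ω × Ω, W.toFun z.1 z.2 ∂(π.prod π) ≤ 1 := by
    rw [← hW]
    exact (integral_congr_ae (Eventually.of_forall fun z => (abs_of_nonneg (W.nonneg' _ _)).symm)).le
  have h1 := ae_eventually_pairSum_le hx W.measurable' W.nonneg' W.symm' W.integrable' one_pos hW1
  -- Once the edge probabilities sum to at most `8 ρ n ^ 2`, the variance term is `16 l ^ 2 ρ n ^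
  -- 2`, and `l ≤ η / 32` makes it at most half of `l η ρ n ^ 2`.
  set l := min (1 / 2) (η / 32) with hl
  have hl0 : 0 < l := lt_min (by norm_num) (by positivity)
  have hl1 : l ≤ 1 / 2 := min_le_left _ _
  have hl2 : l ≤ η / 32 := min_le_right _ _
  have h2 : ∀ᵐ θ ∂P, ∀ᶠ n : ℕ in atTop, θ ∉ {θ | l * η / 2 * (ρ n * n ^ 2) +
      2 * l ^ 2 * ∑ i, ∑ j, edgeProb W (ρ n) (fun i : Fin n => x i θ) i j ≤
      l * (n ^ 2 * matrixCutNorm (adjacency (G n θ) - edgeProb W (ρ n)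
        fun i : Fin n => x i θ))} := by
    refine ae_eventually_notMem (ne_top_of_le_ne_top
      (summable_four_pow_mul_exp (show 0 < l * η / 2 by positivity) hρn).tsum_ofReal_ne_top
      (ENNReal.tsum_le_tsum fun n => ?_))
    rcases Nat.eq_zero_or_pos n with rfl | hn
    · refine prob_le_one.trans ?_
      simp
    · exact (hG n).measure_cutNorm_le (hρ n) hn (fun i => hx.1 i) hl0.le hl1 _
  filter_upwards [h1, h2] with θ g1 g2
  filter_upwards [g1, g2, eventually_gt_atTop 0] with n e1 e2 hn
  have hn' : (0 : ℝ) < n := by exact_mod_cast hn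
  have hn2 : (0 : ℝ) < (n : ℝ) ^ 2 := by positivity
  replace e2 := not_le.1 e2
  have e3 : ∑ i, ∑ j, edgeProb W (ρ n) (fun i : Fin n => x i θ) i j ≤ ρ n * (8 * n ^ 2) := by
    calc _ ≤ ∑ i : Fin n, ∑ j : Fin n, ρ n * (if i = j then 0 else W.toFun (x i θ) (x j θ)) :=
          Finset.sum_le_sum fun i _ => Finset.sum_le_sum fun j _ => edgeProb_le W (ρ n) _ i j
      _ = ρ n * pairSum W.toFun x n θ := by
          rw [pairSum_eq_sum_fin]
          simp only [Finset.mul_sum]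
      _ ≤ _ := mul_le_mul_of_nonneg_left (by linarith) (hρ n).le
  have e4 : 2 * l ^ 2 * ∑ i, ∑ j, edgeProb W (ρ n) (fun i : Fin n => x i θ) i j ≤
      2 * l ^ 2 * (ρ n * (8 * n ^ 2)) := mul_le_mul_of_nonneg_left e3 (by positivity)
  have hρn2 : 0 < ρ n * (n : ℝ) ^ 2 := mul_pos (hρ n) hn2
  have e5 : l * (16 * (ρ n * n ^ 2)) ≤ η / 32 * (16 * (ρ n * n ^ 2)) :=
    mul_le_mul_of_nonneg_right hl2 (by positivity)
  have e6 : l * (l * (16 * (ρ n * n ^ 2))) ≤ l * (η / 32 * (16 * (ρ n * n ^ 2))) :=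
    mul_le_mul_of_nonneg_left e5 hl0.le
  set T := matrixCutNorm (adjacency (G n θ) - edgeProb W (ρ n) fun i : Fin n => x i θ)
  have e7 : l * (n ^ 2 * T) < l * (n ^ 2 * (η * ρ n)) := by
    have : l * (n ^ 2 * (η * ρ n)) = l * η / 2 * (ρ n * n ^ 2) +
      l * (η / 32 * (16 * (ρ n * n ^ 2))) := by ring
    linarith
  have e8 : T < η * ρ n := lt_of_mul_lt_mul_left (lt_of_mul_lt_mul_left e7 hl0.le) hn2.le
  rw [one_div, inv_mul_le_iff₀ (hρ n), mul_comm]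
  exact e8.le

end CutNormLaw

/-! ### Almost sure error bounds for the estimator. -/

section Consistency

variable {Ω : Type u} [MeasurableSpace Ω] {π : Measure Ω} {Θ : Type v} [MeasurableSpace Θ]
  {P : Measure Θ}

lemma tendsto_rounding (V : BlockModel) :
    Tendsto (fun n : ℕ => 2 / (n : ℝ) * ∑ i, ∑ j, (2 * V.p j + 1 / n) * V.B i j) atTop (𝓝 0) := by
  have h1 : Tendsto (fun n : ℕ => 1 / (n : ℝ)) atTop (𝓝 0) := tendsto_one_div_atTop_nhds_zero_nat
  have h2 : Tendsto (fun n : ℕ => 2 / (n : ℝ)) atTop (𝓝 0) := by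
    simpa [div_eq_mul_inv] using h1.const_mul 2
  have := h2.mul (tendsto_finsetSum Finset.univ fun i _ => tendsto_finsetSum Finset.univ fun j _ =>
    (h1.const_add (2 * V.p j)).mul_const (V.B i j))
  simpa using this

/-- If `V₁` is an approximation of `W` with large blocks and `V₂` is a finer approximation, the
asymptotic estimation error is at most twice the error of `V₁`, up to the error of `V₂`. -/
lemma ae_eventually_estimationError_le [IsProbabilityMeasure π] [IsProbabilityMeasure P]
    (W : Graphon Ω π) (hW : W.Normalized) {κ ρ : ℕ → ℝ} (hρ : ∀ n, 0 < ρ n)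
    (hρ0 : Tendsto ρ atTop (𝓝 0)) (hρn : Tendsto (fun n : ℕ => n * ρ n) atTop atTop)
    (hκn : ∀ᶠ n : ℕ in atTop, 1 ≤ κ n * n) {x : ℕ → Θ → Ω}
    (hx : IsIIDSample π P x) {G : (n : ℕ) → Θ → SimpleGraph (Fin n)}
    (hG : ∀ n, IsWRandomGraph W (ρ n) P (fun i : Fin n => x i) (G n)) {What : ℕ → Θ → BlockModel}
    (hout : ∀ n : ℕ, 1 ≤ κ n * n → ∀ θ, IsLeastCutNormOutput (κ n) (G n θ) (What n θ))
    (V₁ : BlockModel) (hV₁ : ∀ᶠ n in atTop, ∀ i, κ n ≤ V₁.p i) {ν₁ : Measure (Ω × Fin V₁.k)}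
    (hν₁ : IsCoupling π V₁.measure ν₁) (V₂ : BlockModel) (hV₂ : ∀ i, 0 < V₂.p i)
    {ν₂ : Measure (Ω × Fin V₂.k)} (hν₂ : IsCoupling π V₂.measure ν₂) {η : ℝ} (hη : 0 < η) :
    ∀ᵐ θ ∂P, ∀ᶠ n : ℕ in atTop, estimationError W (ρ n) (What n θ) ≤
      2 * (∫ a : (Ω × Fin V₁.k) × (Ω × Fin V₁.k),
        |W.toFun a.1.1 a.2.1 - V₁.B a.1.2 a.2.2| ∂(ν₁.prod ν₁)) +
      2 * (∫ a : (Ω × Fin V₂.k) × (Ω × Fin V₂.k),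
        |W.toFun a.1.1 a.2.1 - V₂.B a.1.2 a.2.2| ∂(ν₂.prod ν₂)) + 7 * η := by
  filter_upwards [ae_eventually_exists_isBalanced W V₁ hν₁ hρ hρ0 hx hη,
    ae_eventually_exists_isBalanced W V₂ hν₂ hρ hρ0 hx hη,
    ae_eventually_cutNorm_le W hW hρ hρn hx hG hη] with θ h1 h2 h3
  filter_upwards [h1, h2, h3, hκn, hV₁, (tendsto_rounding V₂).eventually_le_const hη,
    eventually_gt_atTop 0] with n e1 e2 e3 e4 e5 e6 hn
  obtain ⟨z₁, hz₁, hz₁le⟩ := e1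
  obtain ⟨z₂, hz₂, hz₂le⟩ := e2
  -- The seven `η` are three from the cut norm, two and one from the fits of `V₁` and `V₂`, and one
  -- from rounding.
  have := estimationError_le_of_isLeastCutNormOutput W (hρ n) hn e4 (hout n e4 θ) V₁ e5 z₁ hz₁
    V₂ hV₂ ν₂ hν₂ z₂ hz₂ (edgeProb W (ρ n) fun i : Fin n => x i θ)
  linarith

/-- `V₁` is nearly optimal among models with blocks at least `κ`, while `V₂` approximates `W`
arbitrarily well with no uniform lower bound on its blocks. Using `V₁` in both roles would give the
constant 4. -/
theorem ae_limsup_estimationError_le [IsProbabilityMeasure π] [IsProbabilityMeasure P]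
    (W : Graphon Ω π) (hW : W.Normalized) {κ : ℝ} {ρ : ℕ → ℝ} (hκ0 : 0 < κ) (hκ1 : κ ≤ 1)
    (hρ : ∀ n, 0 < ρ n) (hρ0 : Tendsto ρ atTop (𝓝 0))
    (hρn : Tendsto (fun n : ℕ => n * ρ n) atTop atTop) {x : ℕ → Θ → Ω}
    (hx : IsIIDSample π P x) {G : (n : ℕ) → Θ → SimpleGraph (Fin n)}
    (hG : ∀ n, IsWRandomGraph W (ρ n) P (fun i : Fin n => x i) (G n)) {What : ℕ → Θ → BlockModel}
    (hout : ∀ n : ℕ, 1 ≤ κ * n → ∀ θ, IsLeastCutNormOutput κ (G n θ) (What n θ)) :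
    ∀ᵐ θ ∂P, limsup (fun n => ((estimationError W (ρ n) (What n θ) : ℝ) : EReal)) atTop ≤
      ((2 * W.oracleError κ : ℝ) : EReal) := by
  have hκn : ∀ᶠ n : ℕ in atTop, 1 ≤ κ * n :=
    (tendsto_natCast_atTop_atTop.const_mul_atTop hκ0).eventually_ge_atTop 1
  have hkey : ∀ m : ℕ, ∀ᵐ θ ∂P, ∀ᶠ n : ℕ in atTop, estimationError W (ρ n) (What n θ) ≤
      2 * W.oracleError κ + 11 * (1 / ((m : ℝ) + 1)) := by
    intro m
    have hη : (0 : ℝ) < 1 / ((m : ℝ) + 1) := by positivity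
    obtain ⟨V₁, hV₁, ν₁, hν₁, hδ₁⟩ := W.exists_coupling_lt_oracleError_add hκ1 hη
    obtain ⟨V₂, hV₂, ν₂, hν₂, hδ₂⟩ := W.exists_blockModel_approx hη
    filter_upwards [ae_eventually_estimationError_le (κ := fun _ => κ) W hW hρ hρ0 hρn hκn hx hG
      hout V₁ (Eventually.of_forall fun _ => hV₁) hν₁ V₂ hV₂ hν₂ hη] with θ hθ
    filter_upwards [hθ] with n hn
    linarith
  filter_upwards [ae_all_iff.2 hkey] with θ hθ
  have hlim : Tendsto (fun m : ℕ =>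
      ((2 * W.oracleError κ + 11 * (1 / ((m : ℝ) + 1)) : ℝ) : EReal)) atTop
      (𝓝 ((2 * W.oracleError κ : ℝ) : EReal)) := by
    refine (continuous_coe_real_ereal.tendsto _).comp ?_
    simpa using (tendsto_one_div_add_atTop_nhds_zero_nat (𝕜 := ℝ)).const_mul 11
      |>.const_add (2 * W.oracleError κ)
  refine ge_of_tendsto' hlim fun m => limsup_le_of_le (by isBoundedDefault) ?_
  filter_upwards [hθ m] with n hn
  exact EReal.coe_le_coe_iff.2 hn

/-- Any fixed model with positive blocks eventually satisfies the size condition because `κ n` tends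
to zero, so one fine approximation of `W` serves as both models. -/
theorem ae_tendsto_estimationError [IsProbabilityMeasure π] [IsProbabilityMeasure P]
    (W : Graphon Ω π) (hW : W.Normalized) {κ ρ : ℕ → ℝ} (hκ : ∀ n, 0 < κ n)
    (hρ : ∀ n, 0 < ρ n) (hρ0 : Tendsto ρ atTop (𝓝 0))
    (hρn : Tendsto (fun n : ℕ => n * ρ n) atTop atTop) (hκ0 : Tendsto κ atTop (𝓝 0))
    (hκn : Tendsto (fun n : ℕ => Real.log n / (n * κ n)) atTop (𝓝 0)) {x : ℕ → Θ → Ω}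
    (hx : IsIIDSample π P x) {G : (n : ℕ) → Θ → SimpleGraph (Fin n)}
    (hG : ∀ n, IsWRandomGraph W (ρ n) P (fun i : Fin n => x i) (G n)) {What : ℕ → Θ → BlockModel}
    (hout : ∀ n : ℕ, 1 ≤ κ n * n → ∀ θ, IsLeastCutNormOutput (κ n) (G n θ) (What n θ)) :
    ∀ᵐ θ ∂P, Tendsto (fun n => estimationError W (ρ n) (What n θ)) atTop (𝓝 0) := by
  -- For `n ≥ 3` one has `log n ≥ 1`, so `log n / (n κ n) ≤ 1` already forces this.
  have hκn' : ∀ᶠ n : ℕ in atTop, 1 ≤ κ n * n := by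
    filter_upwards [hκn.eventually_le_const one_pos, eventually_ge_atTop 3] with n h1 hn
    have hn' : (0 : ℝ) < n := by positivity
    rw [div_le_iff₀ (mul_pos hn' (hκ n)), one_mul] at h1
    have h2 : (1 : ℝ) ≤ Real.log n := by
      rw [Real.le_log_iff_exp_le hn']
      have : (3 : ℝ) ≤ n := by exact_mod_cast hn
      linarith [Real.exp_one_lt_d9]
    rw [mul_comm]
    exact h2.trans h1
  have hkey : ∀ m : ℕ, ∀ᵐ θ ∂P, ∀ᶠ n : ℕ in atTop, estimationError W (ρ n) (What n θ) ≤
      11 * (1 / ((m : ℝ) + 1)) := by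
    intro m
    have hη : (0 : ℝ) < 1 / ((m : ℝ) + 1) := by positivity
    obtain ⟨V, hV, ν, hν, hδ⟩ := W.exists_blockModel_approx hη
    have hV' : ∀ᶠ n in atTop, ∀ i, κ n ≤ V.p i :=
      eventually_all.2 fun i => hκ0.eventually_le_const (hV i)
    filter_upwards [ae_eventually_estimationError_le W hW hρ hρ0 hρn hκn' hx hG hout V hV' hν V hV
      hν hη] with θ hθ
    filter_upwards [hθ] with n hn
    linarith
  filter_upwards [ae_all_iff.2 hkey] with θ hθ
  refine tendsto_order.2 ⟨fun a ha => Eventually.of_forall fun n =>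
    ha.trans_le (estimationError_nonneg _ _ _), fun a ha => ?_⟩
  obtain ⟨m, hm⟩ := exists_nat_one_div_lt (show 0 < a / 11 by positivity)
  filter_upwards [hθ m] with n hn
  linarith

end Consistency

end

theorem mainTheorem2 :
    -- (i)
    (∀ ε : ℝ, 0 < ε → ∃ M : ℝ,
      ∀ (Ω : Type u) [MeasurableSpace Ω] (π : Measure Ω) [IsProbabilityMeasure π]
        (W : Graphon Ω π), W.Normalized →
      ∀ (n : ℕ) (ρ κ : ℝ), 2 ≤ n → 0 < ρ → Real.log n / n ≤ κ → κ ≤ 1 → 1 ≤ κ * n →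
      ∀ (Θ : Type v) [MeasurableSpace Θ] (P : Measure Θ) [IsProbabilityMeasure P]
        (x : Fin n → Θ → Ω) (G : Θ → SimpleGraph (Fin n)) (What : Θ → BlockModel),
        IsIIDSample π P x →
        IsWRandomGraph W ρ P x G →
        (∀ θ, IsLeastCutNormOutput κ (G θ) (What θ)) →
        P {θ | ¬ estimationError W ρ (What θ) ≤
            M * (W.oracleError κ + Real.sqrt (1 / (ρ * n)) + Real.sqrt (Real.log n / (κ * n))
              + W.tail ρ)} ≤ ENNReal.ofReal ε) ∧
    -- (ii)
    (∀ (Ω : Type u) [MeasurableSpace Ω] (π : Measure Ω) [IsProbabilityMeasure π]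
        (W : Graphon Ω π), W.Normalized →
      ∀ (κ : ℝ) (ρ : ℕ → ℝ), 0 < κ → κ ≤ 1 → (∀ n, 0 < ρ n) → Tendsto ρ atTop (𝓝 0) →
        Tendsto (fun n : ℕ => n * ρ n) atTop atTop →
      ∀ (Θ : Type v) [MeasurableSpace Θ] (P : Measure Θ) [IsProbabilityMeasure P]
        (x : ℕ → Θ → Ω) (G : (n : ℕ) → Θ → SimpleGraph (Fin n)) (What : ℕ → Θ → BlockModel),
        IsIIDSample π P x →
        (∀ n, IsWRandomGraph W (ρ n) P (fun i : Fin n => x i) (G n)) →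
        (∀ n : ℕ, 1 ≤ κ * n → ∀ θ, IsLeastCutNormOutput κ (G n θ) (What n θ)) →
        ∀ᵐ θ ∂P, limsup (fun n => ((estimationError W (ρ n) (What n θ) : ℝ) : EReal)) atTop ≤
          ((2 * W.oracleError κ : ℝ) : EReal)) ∧
    -- (iii)
    (∀ (Ω : Type u) [MeasurableSpace Ω] (π : Measure Ω) [IsProbabilityMeasure π]
        (W : Graphon Ω π), W.Normalized →
      ∀ (κ ρ : ℕ → ℝ), (∀ n, 0 < κ n ∧ κ n ≤ 1) → (∀ n, 0 < ρ n) → Tendsto ρ atTop (𝓝 0) →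
        Tendsto (fun n : ℕ => n * ρ n) atTop atTop → Tendsto κ atTop (𝓝 0) →
        Tendsto (fun n : ℕ => Real.log n / (n * κ n)) atTop (𝓝 0) →
      ∀ (Θ : Type v) [MeasurableSpace Θ] (P : Measure Θ) [IsProbabilityMeasure P]
        (x : ℕ → Θ → Ω) (G : (n : ℕ) → Θ → SimpleGraph (Fin n)) (What : ℕ → Θ → BlockModel),
        IsIIDSample π P x →
        (∀ n, IsWRandomGraph W (ρ n) P (fun i : Fin n => x i) (G n)) →
        (∀ n : ℕ, 1 ≤ κ n * n → ∀ θ, IsLeastCutNormOutput (κ n) (G n θ) (What n θ)) →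
        ∀ᵐ θ ∂P, Tendsto (fun n => estimationError W (ρ n) (What n θ)) atTop (𝓝 0)) := by
  refine ⟨fun ε hε => ?_, ?_, ?_⟩
  · obtain ⟨M, hM⟩ := exists_estimationError_le_of_pos.{u, v} ε hε
    exact ⟨M, fun Ω _ π _ W hW n ρ κ hn hρ _ => hM Ω π W hW n ρ κ hn hρ⟩
  · intro Ω _ π _ W hW κ ρ hκ0 hκ1 hρ hρ0 hρn Θ _ P _ x G What hx hG hout
    exact ae_limsup_estimationError_le W hW hκ0 hκ1 hρ hρ0 hρn hx hG hout
  · intro Ω _ π _ W hW κ ρ hκ hρ hρ0 hρn hκ0 hκn Θ _ P _ x G What hx hG hout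
    exact ae_tendsto_estimationError W hW (fun n => (hκ n).1) hρ hρ0 hρn hκ0 hκn hx hG hout
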